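/- All graphs are finite, undirected and simple. Let $s\ge 0$ be a fixed integer, let $sP_1+P_4$ be the disjoint union of $s$ isolated vertices and a path on four vertices, call a graph $(sP_1+P_4)$-free if it has no induced subgraph isomorphic to $sP_1+P_4$, and put $\alpha=(s+2)(2s+4)$. For a graph $G$ and vertices $u,v$ write $N(u)$ for the neighbourhood of $u$ and $T=V(G)\setminus(N[u]\cup N[v])$; a set of vertices is called connected if it is non-empty and induces a connected subgraph. For $k\ge 3$, a solution of an instance $(G,u,v)$ of $P_k$-Suitability ($G$ connected, $u\ne v$ non-adjacent) is a partition of $V(G)$ into connected sets $W_1,\dots,W_k$ with $W_1=\{u\}$, $W_k=\{v\}$, such that for $i\neq j$ there is an edge between $W_i$ and $W_j$ if and only if $|i-j|=1$; the instance is a yes-instance if it has a solution. For $k\ge 4$, a solution is $\alpha$-constant if there is a set $S\subseteq W_2\setminus N(u)$ with $|S|\le\alpha$ and $N(u)\cup S$ connected, or a set $S\subseteq W_{k-1}\setminus N(v)$ with $|S|\le\alpha$ and $N(v)\cup S$ connected. Then: (1) Longest Path Contractibility is polynomial-time solvable on $(sP_1+P_4)$-free graphs: given a connected $(sP_1+P_4)$-free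 graph $G$ and an integer $k\ge1$, one can decide in polynomial time whether $G$ can be modified into the $k$-vertex path $P_k$ by a sequence of edge contractions. (2) For every $k\ge4$, every yes-instance $(G,u,v)$ of $P_k$-Suitability with $G$ $(sP_1+P_4)$-free has an $\alpha$-constant solution. (3) Call $S\subseteq T$ admissible if $|S|\le\alpha$ and $N(u)\cup S$ is connected. Let the closure $\overline S$ be the set of all $x\in T$ such that every walk from $x$ to $v$ meets $N(u)\cup S$, and let $G_S$ be the graph obtained from $G$ by contracting $\{u\}\cup N(u)\cup\overline S$ to a single vertex $u_S$. For every $k\ge4$ and every instance $(G,u,v)$ of $P_k$-Suitability with $G$ $(sP_1+P_4)$-free, $(G,u,v)$ is a yes-instance of $P_k$-Suitability if and only if, for some admissible $S$, the graph $G_S$ has a partition as above with $k-1$ parts, first part $\{u_S\}$ and last part $\{v\}$. (4) There is a polynomial-time algorithm that computes from an instance $(G,u,v)$, where $G$ is connected and $(sP_1+P_4)$-free and $u\neq v$ are non-adjacent, a list of instances, each isomorphic to $(G_S,u_S,v)$ for some admissible $S$, each on a connected $(sP_1+P_4)$-free graph with fewer vertices than $G$ and with its two vertices distinct and non-adjacent,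 such that for every $k\ge 4$, $(G,u,v)$ is a yes-instance of $P_k$-Suitability if and only if at least one instance on the list is a yes-instance of $P_{k-1}$-Suitability. -/

import Mathlib

/-! ### Graphs: forbidden graph, contractions, witness structures -/

/-- The graph `sP₁ + P₄`: the disjoint union of `s` isolated vertices and a path on four vertices. -/
def sP1P4 (s : ℕ) : SimpleGraph (Fin s ⊕ Fin 4) :=
  SimpleGraph.sum (⊥ : SimpleGraph (Fin s)) (SimpleGraph.pathGraph 4)

/-- `G` is `H`-free: `G` has no induced subgraph isomorphic to `H`. -/
def HFree {W V : Type} (H : SimpleGraph W) (G : SimpleGraph V) : Prop :=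
  ¬ H.IsIndContained G

/-- The vertex set `S` is connected (in particular non-empty) in `G`. -/
def ConnectedSet {V : Type} (G : SimpleGraph V) (S : Set V) : Prop :=
  (G.induce S).Connected

/-- The equivalence relation that identifies all vertices of `C` and nothing else. -/
def contractSetoid {V : Type} (C : Set V) : Setoid V where
  r x y := x = y ∨ (x ∈ C ∧ y ∈ C)
  iseqv :=
    { refl := fun _ => Or.inl rfl
      symm := by
        rintro x y (rfl | ⟨hx, hy⟩)
        · exact Or.inl rfl
        · exact Or.inr ⟨hy, hx⟩
      trans := by
        rintro x y z (rfl | ⟨hx, hy⟩) (rfl | ⟨hy', hz⟩)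
        · exact Or.inl rfl
        · exact Or.inr ⟨hy', hz⟩
        · exact Or.inr ⟨hx, hy⟩
        · exact Or.inr ⟨hx, hz⟩ }

/-- The vertices of the graph obtained from `G` by contracting `C` to a single vertex. -/
abbrev ContractedVertex {V : Type} (C : Set V) : Type := Quotient (contractSetoid C)

/-- The vertex of the contracted graph to which the vertex `x` is mapped. -/
def toContracted {V : Type} (C : Set V) (x : V) : ContractedVertex C :=
  Quotient.mk (contractSetoid C) x

/-- The graph obtained from `G` by contracting the set `C` to a single vertex, without loops or
multiple edges. For `C = {u, v}` with `uv` an edge this is the contraction of the edge `uv`. -/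
def contractSet {V : Type} (G : SimpleGraph V) (C : Set V) : SimpleGraph (ContractedVertex C) where
  Adj p q := p ≠ q ∧ ∃ a b, toContracted C a = p ∧ toContracted C b = q ∧ G.Adj a b
  symm := ⟨by
    rintro p q ⟨hne, a, b, ha, hb, hab⟩
    exact ⟨hne.symm, b, a, hb, ha, hab.symm⟩⟩
  loopless := ⟨fun _ h => h.1 rfl⟩

/-- `ContractsTo H G`: the graph `G` contains `H` as a contraction, that is, `G` can be modified
into (a copy of) `H` by a sequence of edge contractions. -/
inductive ContractsTo {W : Type} (H : SimpleGraph W) : ∀ {V : Type}, SimpleGraph V → Prop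
  | iso {V : Type} {G : SimpleGraph V} (φ : G ≃g H) : ContractsTo H G
  | step {V : Type} {G : SimpleGraph V} (u v : V) (huv : G.Adj u v)
      (h : ContractsTo H (contractSet G {u, v})) : ContractsTo H G

/-- The family `W` of vertex sets is an `H`-witness structure of `G`. -/
structure IsWitnessStructure {V X : Type} (G : SimpleGraph V) (H : SimpleGraph X)
    (W : X → Set V) : Prop where
  connected : ∀ x, ConnectedSet G (W x)
  disjoint : ∀ x y, x ≠ y → Disjoint (W x) (W y)
  cover : ∀ a, ∃ x, a ∈ W x
  adj_iff : ∀ x y, x ≠ y → ((∃ a ∈ W x, ∃ b ∈ W y, G.Adj a b) ↔ H.Adj x y)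

/-- A solution for the instance `(G, u, v)` of `P_k`-Suitability: a `P_k`-witness structure whose
first bag is `{u}` and whose last bag is `{v}`. The bag of the `i`-th vertex of the path has index
`i - 1`. -/
structure IsSolution {V : Type} (k : ℕ) (G : SimpleGraph V) (u v : V) (W : Fin k → Set V) :
    Prop where
  witness : IsWitnessStructure G (SimpleGraph.pathGraph k) W
  first : ∀ i : Fin k, i.val = 0 → W i = {u}
  last : ∀ i : Fin k, i.val + 1 = k → W i = {v}

/-- `(u, v)` is a `P_k`-suitable pair of `G`. -/
def Suitable {V : Type} (k : ℕ) (G : SimpleGraph V) (u v : V) : Prop :=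
  ∃ W : Fin k → Set V, IsSolution k G u v W

/-- The solution `W` is `α`-constant. Here `S_u = W(p₂) \ N(u)` and `S_v = W(p_{k-1}) \ N(v)`. -/
def IsConstantSolution {V : Type} (α k : ℕ) (G : SimpleGraph V) (u v : V) (W : Fin k → Set V) :
    Prop :=
  IsSolution k G u v W ∧
    ((∃ i : Fin k, i.val = 1 ∧ ∃ S : Set V, S ⊆ W i \ G.neighborSet u ∧ S.Finite ∧ S.ncard ≤ α ∧
        ConnectedSet G (G.neighborSet u ∪ S)) ∨
      (∃ i : Fin k, i.val + 2 = k ∧ ∃ S : Set V, S ⊆ W i \ G.neighborSet v ∧ S.Finite ∧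
        S.ncard ≤ α ∧ ConnectedSet G (G.neighborSet v ∪ S)))

/-- `(G, u, v)` is an instance of `P_k`-Suitability, for every `k ≥ 3`: the graph is connected, and
`u` and `v` are distinct and non-adjacent. -/
def IsSuitabilityInstance {V : Type} (G : SimpleGraph V) (u v : V) : Prop :=
  G.Connected ∧ u ≠ v ∧ ¬ G.Adj u v

/-- The set `T = V \ (N[u] ∪ N[v])`. -/
def restSet {V : Type} (G : SimpleGraph V) (u v : V) : Set V :=
  {x | x ≠ u ∧ x ≠ v ∧ ¬ G.Adj u x ∧ ¬ G.Adj v x}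

/-- The possible choices of a set `S'_u`: at most `α` vertices of `T` that make `N(u)` connected. -/
def IsGuess {V : Type} (α : ℕ) (G : SimpleGraph V) (u v : V) (S : Set V) : Prop :=
  S ⊆ restSet G u v ∧ S.Finite ∧ S.ncard ≤ α ∧ ConnectedSet G (G.neighborSet u ∪ S)

/-- The closure of `S`: the vertices of `T` that are connected to `v` only via `N(u) ∪ S`. -/
def guessClosure {V : Type} (G : SimpleGraph V) (u v : V) (S : Set V) : Set V :=
  {x | x ∈ restSet G u v ∧ ∀ p : G.Walk x v, ∃ y ∈ p.support, y ∈ G.neighborSet u ∪ S}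

/-- The set `{u} ∪ N(u) ∪ closure(S)`, to be contracted to a new first vertex. -/
def guessBlock {V : Type} (G : SimpleGraph V) (u v : V) (S : Set V) : Set V :=
  {u} ∪ G.neighborSet u ∪ guessClosure G u v S

/-! ### A random access machine with unit cost

The machine has registers and an addressable memory, all holding natural numbers. Its arithmetic
is addition and truncated subtraction (no multiplication), so that numbers gain at most one bit per
step and polynomial time agrees with polynomial time on Turing machines. -/

/-- A state of the machine. -/
structure RamState where
  reg : ℕ → ℕ
  mem : ℕ → ℕ

/-- The state with register `r` set to `x`. -/
def RamState.setReg (σ : RamState) (r x : ℕ) : RamState :=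
  { σ with reg := Function.update σ.reg r x }

/-- The state with memory cell `a` set to `x`. -/
def RamState.setMem (σ : RamState) (a x : ℕ) : RamState :=
  { σ with mem := Function.update σ.mem a x }

/-- Programs. Below `R` stands for registers and `M` for memory cells. -/
inductive RamProg where
  /-- `R[r] := c` -/
  | const (r c : ℕ)
  /-- `R[r] := R[a]` -/
  | move (r a : ℕ)
  /-- `R[r] := R[a] + R[b]` -/
  | add (r a b : ℕ)
  /-- `R[r] := max (R[a] - R[b]) 0` -/
  | sub (r a b : ℕ)
  /-- `R[r] := M[R[a]]` -/
  | load (r a : ℕ)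
  /-- `M[R[a]] := R[b]` -/
  | store (a b : ℕ)
  /-- first `p`, then `q` -/
  | seq (p q : RamProg)
  /-- if `R[a] ≠ 0` then `p` else `q` -/
  | cond (a : ℕ) (p q : RamProg)
  /-- while `R[a] ≠ 0` do `p` -/
  | loop (a : ℕ) (p : RamProg)

/-- `Runs p σ t τ`: started in state `σ`, program `p` halts in state `τ` after exactly `t` steps,
where every elementary instruction and every test of a register costs one step. -/
inductive Runs : RamProg → RamState → ℕ → RamState → Prop
  | const (r c : ℕ) (σ : RamState) : Runs (.const r c) σ 1 (σ.setReg r c)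
  | move (r a : ℕ) (σ : RamState) : Runs (.move r a) σ 1 (σ.setReg r (σ.reg a))
  | add (r a b : ℕ) (σ : RamState) : Runs (.add r a b) σ 1 (σ.setReg r (σ.reg a + σ.reg b))
  | sub (r a b : ℕ) (σ : RamState) : Runs (.sub r a b) σ 1 (σ.setReg r (σ.reg a - σ.reg b))
  | load (r a : ℕ) (σ : RamState) : Runs (.load r a) σ 1 (σ.setReg r (σ.mem (σ.reg a)))
  | store (a b : ℕ) (σ : RamState) : Runs (.store a b) σ 1 (σ.setMem (σ.reg a) (σ.reg b))
  | seq {p q : RamProg} {σ τ ρ : RamState} {t t' : ℕ} (hp : Runs p σ t τ) (hq : Runs q τ t' ρ) :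
      Runs (.seq p q) σ (t + t') ρ
  | condPos {a : ℕ} {p q : RamProg} {σ τ : RamState} {t : ℕ} (ha : σ.reg a ≠ 0)
      (hp : Runs p σ t τ) : Runs (.cond a p q) σ (t + 1) τ
  | condZero {a : ℕ} {p q : RamProg} {σ τ : RamState} {t : ℕ} (ha : σ.reg a = 0)
      (hq : Runs q σ t τ) : Runs (.cond a p q) σ (t + 1) τ
  | loopStop {a : ℕ} {p : RamProg} {σ : RamState} (ha : σ.reg a = 0) : Runs (.loop a p) σ 1 σ
  | loopStep {a : ℕ} {p : RamProg} {σ τ ρ : RamState} {t t' : ℕ} (ha : σ.reg a ≠ 0)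
      (hp : Runs p σ t τ) (hl : Runs (.loop a p) τ t' ρ) : Runs (.loop a p) σ (t + 1 + t') ρ

/-- The machine is deterministic: the final state and the number of steps are unique. -/
theorem Runs.deterministic {p : RamProg} {σ τ : RamState} {t : ℕ} (h : Runs p σ t τ) :
    ∀ {t' : ℕ} {τ' : RamState}, Runs p σ t' τ' → t = t' ∧ τ = τ' := by
  induction h with
  | const | move | add | sub | load | store => intro t' τ' h'; cases h'; exact ⟨rfl, rfl⟩
  | seq _ _ ih1 ih2 =>
    intro t' τ' h'
    cases h' with
    | seq h1 h2 =>
      obtain ⟨rfl, rfl⟩ := ih1 h1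
      obtain ⟨rfl, rfl⟩ := ih2 h2
      exact ⟨rfl, rfl⟩
  | condPos ha _ ih =>
    intro t' τ' h'
    cases h' with
    | condPos _ h1 => obtain ⟨rfl, rfl⟩ := ih h1; exact ⟨rfl, rfl⟩
    | condZero h0 _ => exact absurd h0 ha
  | condZero ha _ ih =>
    intro t' τ' h'
    cases h' with
    | condPos h0 _ => exact absurd ha h0
    | condZero _ h1 => obtain ⟨rfl, rfl⟩ := ih h1; exact ⟨rfl, rfl⟩
  | loopStop ha =>
    intro t' τ' h'
    cases h' with
    | loopStop => exact ⟨rfl, rfl⟩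
    | loopStep h0 _ _ => exact absurd ha h0
  | loopStep ha _ _ ih1 ih2 =>
    intro t' τ' h'
    cases h' with
    | loopStop h0 => exact absurd h0 ha
    | loopStep _ h1 h2 =>
      obtain ⟨rfl, rfl⟩ := ih1 h1
      obtain ⟨rfl, rfl⟩ := ih2 h2
      exact ⟨rfl, rfl⟩

/-- The initial state on input `w`: the word is written in the memory from cell `0` on; all other
cells and all registers are `0`. -/
def inputState (w : List ℕ) : RamState where
  reg := fun _ => 0
  mem := fun a => w.getD a 0

/-- The word `w` stands in the memory from cell `R[1]` on. -/
def OutputsWord (σ : RamState) (w : List ℕ) : Prop :=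
  ∀ (a : ℕ) (ha : a < w.length), σ.mem (σ.reg 1 + a) = w[a]

/-- On every input satisfying `promise`, some fixed program halts after a number of steps that is
polynomial in the length of the input, in a state satisfying `post`. -/
def PolyTimeRealizable {X : Type} (word : X → List ℕ) (promise : X → Prop)
    (post : X → RamState → Prop) : Prop :=
  ∃ (p : RamProg) (c : ℕ), ∀ x, promise x → ∃ (t : ℕ) (σ : RamState),
    Runs p (inputState (word x)) t σ ∧ t ≤ c * ((word x).length + 1) ^ c ∧ post x σ

/-- The decision problem `yes`, restricted to inputs satisfying `promise`, is solvable in polynomial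
time; register `0` holds the answer. -/
def PolyTimeSolvable {X : Type} (word : X → List ℕ) (promise yes : X → Prop) : Prop :=
  PolyTimeRealizable word promise fun x σ => σ.reg 0 ≠ 0 ↔ yes x

/-! ### Encoding of the problems -/

open Classical in
/-- The rows of the adjacency matrix, one after the other. -/
noncomputable def adjacencyWord {n : ℕ} (G : SimpleGraph (Fin n)) : List ℕ :=
  (List.finRange n).flatMap fun i => (List.finRange n).map fun j => if G.Adj i j then 1 else 0

/-- An input of Longest Path Contractibility: a graph and a number. -/
structure PathInput where
  n : ℕ
  graph : SimpleGraph (Fin n)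
  k : ℕ

noncomputable def PathInput.word (x : PathInput) : List ℕ :=
  x.n :: x.k :: adjacencyWord x.graph

/-- An input of `P_k`-Suitability: a graph with two vertices. -/
structure PairInput where
  n : ℕ
  graph : SimpleGraph (Fin n)
  u : Fin n
  v : Fin n

noncomputable def PairInput.word (x : PairInput) : List ℕ :=
  x.n :: x.u.val :: x.v.val :: adjacencyWord x.graph

/-- Longest Path Contractibility, restricted to `H`-free graphs, is polynomial-time solvable: given
a connected `H`-free graph `G` and `k ≥ 1`, decide whether `G` contains `P_k` as a contraction. -/
def LongestPathContractibilityPolyTime {W : Type} (H : SimpleGraph W) : Prop :=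
  PolyTimeSolvable PathInput.word
    (fun x => x.graph.Connected ∧ HFree H x.graph ∧ 1 ≤ x.k)
    (fun x => ContractsTo (SimpleGraph.pathGraph x.k) x.graph)

/-- `y` is a copy of the instance obtained from `x` by contracting `{u} ∪ N(u) ∪ closure(S)` to a
single vertex, which takes the role of `u`, for some choice of `S` with `|S| ≤ α`. -/
def IsReducedInstance (α : ℕ) (x y : PairInput) : Prop :=
  ∃ S : Set (Fin x.n), IsGuess α x.graph x.u x.v S ∧
    ∃ φ : contractSet x.graph (guessBlock x.graph x.u x.v S) ≃g y.graph,
      φ (toContracted _ x.u) = y.u ∧ φ (toContracted _ x.v) = y.v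

/-- The final state holds the list `L` of instances: register `0` holds their number, and their
encodings stand in the memory one after the other, from cell `R[1]` on. -/
def OutputsInstances (σ : RamState) (L : List PairInput) : Prop :=
  σ.reg 0 = L.length ∧ OutputsWord σ (L.flatMap PairInput.word)

/-- On `H`-free graphs, `P_k`-Suitability reduces to `P_{k-1}`-Suitability for every `k ≥ 4`: one
polynomial-time program (the same for all `k`) computes from an instance a list of smaller `H`-free
instances, obtained by contractions as above, such that the given instance is a yes-instance for
`k` if and only if one of the new instances is a yes-instance for `k - 1`. -/
def SuitabilityReduction {W : Type} (H : SimpleGraph W) (α : ℕ) : Prop :=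
  PolyTimeRealizable PairInput.word
    (fun x => IsSuitabilityInstance x.graph x.u x.v ∧ HFree H x.graph)
    (fun x σ => ∃ L : List PairInput, OutputsInstances σ L ∧
      (∀ y ∈ L, IsSuitabilityInstance y.graph y.u y.v ∧ HFree H y.graph ∧ y.n < x.n ∧
        IsReducedInstance α x y) ∧
      ∀ k, 4 ≤ k → (Suitable k x.graph x.u x.v ↔ ∃ y ∈ L, Suitable (k - 1) y.graph y.u y.v))

/-! The combinatorial core is `exists_connector`: in an (sP₁+P₄)-free graph, any subset A of a
connected set D becomes connected after adding at most (s+2)(2s+4) vertices of D. Either one vertex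
of D lies in or is adjacent to every component of G[A], or D contains an induced P₄. In the second
case fewer than s components of G[A] stay away from that P₄, and each of them is linked to it by an
induced path, which has at most 2s+3 vertices because P_{2s+4} contains sP₁+P₄. With D the second
bag and A = N(u), this gives an α-constant solution.

For the reduction let S be such a connector and C = N(u) ∪ S. The vertices that C separates from v
are exactly the block to be contracted, and they all lie in the first two bags. They become the new
first bag; whatever remains of the second bag still reaches v around C, so it is attached to the
third bag and can be moved there. Conversely, a first bag of this form splits into {u} and a
connected remainder. Both directions are proved for an arbitrary connected first bag B in place of
{u} (`bagSuitable_succ_iff`), so iterated contractions can be followed inside one fixed graph with a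
growing B; `suitable_contractSet_iff` translates back to the contracted graph. Contracting a
connected set preserves freeness (`HFree.contractSet`).

A connected graph that contracts to P_k has an induced path on at least k vertices, so only k ≤ 2s+3
matters. For each such k ≥ 3, contractibility means that some pair u, v admits a chain of k-3
guesses of at most α vertices each, ending in a simple connectivity condition
(`bagSuitable_iff_chainSuitable`). This is a fixed formula of first-order logic with a reachability
operator, and every fixed formula compiles to a polynomial-time program (`Fml.exec_prog`). The list
for the reduction comes from nested loops over α vertices that evaluate such formulas and write the
contracted graphs (`exists_emitter`, `Emitter.exec_prog`). -/

/-! ### Walks inside a set of vertices -/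

/-- `y` can be reached from `x` by a walk all of whose vertices lie in `S`. -/
def ReachIn {V : Type} (G : SimpleGraph V) (S : Set V) (x y : V) : Prop :=
  x ∈ S ∧ Relation.ReflTransGen (fun a b => G.Adj a b ∧ b ∈ S) x y

namespace ReachIn

variable {V : Type} {G : SimpleGraph V} {S T : Set V} {x y z : V}

theorem refl (hx : x ∈ S) : ReachIn G S x x := ⟨hx, .refl⟩

theorem left_mem (h : ReachIn G S x y) : x ∈ S := h.1

/-- Induction along the walk. Most later arguments about `ReachIn` go through this principle instead
of explicit walks. -/
theorem closed {P : V → Prop} (h : ReachIn G S x y) (hx : P x)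
    (hP : ∀ a b, a ∈ S → b ∈ S → P a → G.Adj a b → P b) : P y ∧ y ∈ S := by
  obtain ⟨hxS, h⟩ := h
  induction h with
  | refl => exact ⟨hx, hxS⟩
  | tail _ hab ih => exact ⟨hP _ _ ih.2 hab.2 ih.1 hab.1, hab.2⟩

theorem right_mem (h : ReachIn G S x y) : y ∈ S :=
  (h.closed (P := fun _ => True) trivial (by simp)).2

theorem trans (h : ReachIn G S x y) (h' : ReachIn G S y z) : ReachIn G S x z :=
  ⟨h.1, h.2.trans h'.2⟩

theorem tail (h : ReachIn G S x y) (hyz : G.Adj y z) (hz : z ∈ S) : ReachIn G S x z :=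
  ⟨h.1, h.2.tail ⟨hyz, hz⟩⟩

theorem adj (hx : x ∈ S) (hxy : G.Adj x y) (hy : y ∈ S) : ReachIn G S x y :=
  (refl hx).tail hxy hy

theorem symm (h : ReachIn G S x y) : ReachIn G S y x :=
  (h.closed (P := fun y => ReachIn G S y x) (refl h.1)
    fun _ _ ha hb h hab => (adj hb hab.symm ha).trans h).1

theorem mono (h : ReachIn G S x y) (hST : S ⊆ T) : ReachIn G T x y :=
  (h.closed (P := fun y => ReachIn G T x y) (refl (hST h.1))
    fun _ _ _ hb h hab => h.tail hab (hST hb)).1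

theorem iff_walk : ReachIn G S x y ↔ ∃ p : G.Walk x y, ∀ z ∈ p.support, z ∈ S := by
  constructor
  · intro h
    refine (h.closed (P := fun y => ∃ p : G.Walk x y, ∀ z ∈ p.support, z ∈ S)
      ⟨.nil, by simpa using h.1⟩ ?_).1
    rintro a b - hb ⟨p, hp⟩ hab
    refine ⟨p.concat hab, fun z hz => ?_⟩
    rw [SimpleGraph.Walk.support_concat] at hz
    simp at hz
    rcases hz with hz | rfl
    · exact hp z hz
    · exact hb
  · rintro ⟨p, hp⟩
    induction p with
    | nil => exact refl (by simpa using hp)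
    | cons h p ih =>
      simp at hp
      exact (adj hp.1 h (hp.2 _ p.start_mem_support)).trans (ih hp.2)

theorem induce_reachable_iff (hx : x ∈ S) (hy : y ∈ S) :
    (G.induce S).Reachable ⟨x, hx⟩ ⟨y, hy⟩ ↔ ReachIn G S x y := by
  constructor
  · rintro ⟨p⟩
    suffices ∀ a b : S, (G.induce S).Walk a b → ReachIn G S a.1 b.1 from this _ _ p
    intro a b p
    induction p with
    | nil => exact refl (Subtype.prop _)
    | @cons u v w h p ih => exact (adj u.2 h v.2).trans ih
  · intro h
    obtain ⟨h', h''⟩ := (h.closed (P := fun y => ∃ hy : y ∈ S,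
      (G.induce S).Reachable ⟨x, hx⟩ ⟨y, hy⟩) ⟨hx, .refl _⟩ (by
        rintro a b ha hb ⟨_, h⟩ hab
        refine ⟨hb, h.trans (SimpleGraph.Adj.reachable ?_)⟩
        simpa using hab)).1
    exact h''

theorem univ_of_connected (hG : G.Connected) (x y : V) : ReachIn G Set.univ x y := by
  obtain ⟨p⟩ := hG.preconnected x y
  exact iff_walk.2 ⟨p, by simp⟩

/-- A walk that starts in `P` and ends outside `P` leaves `P` along an edge. -/
theorem exists_exit {P : Set V} (h : ReachIn G S x y) (hx : x ∈ P) (hy : y ∉ P) :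
    ∃ a b, ReachIn G (S ∩ P) x a ∧ b ∈ S ∧ b ∉ P ∧ G.Adj a b := by
  by_contra! hc
  have := (h.closed (P := fun y => ReachIn G (S ∩ P) x y) (refl ⟨h.1, hx⟩) (by
    intro a b _ hb hxa hab
    by_cases hbP : b ∈ P
    · exact hxa.tail hab ⟨hb, hbP⟩
    · exact absurd hab (hc a b hxa hb hbP))).1
  exact hy this.right_mem.2

end ReachIn

section ConnectedSets

variable {V : Type} {G : SimpleGraph V} {S T : Set V}

theorem connectedSet_iff :
    ConnectedSet G S ↔ S.Nonempty ∧ ∀ x ∈ S, ∀ y ∈ S, ReachIn G S x y := by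
  unfold ConnectedSet
  rw [SimpleGraph.connected_iff]
  constructor
  · rintro ⟨h, ⟨x⟩⟩
    exact ⟨⟨x, x.2⟩, fun x hx y hy => (ReachIn.induce_reachable_iff hx hy).1 (h _ _)⟩
  · rintro ⟨⟨x, hx⟩, h⟩
    exact ⟨fun a b => (ReachIn.induce_reachable_iff a.2 b.2).2 (h _ a.2 _ b.2), ⟨⟨x, hx⟩⟩⟩

theorem ConnectedSet.nonempty (h : ConnectedSet G S) : S.Nonempty := (connectedSet_iff.1 h).1

theorem ConnectedSet.reachIn (h : ConnectedSet G S) {x y : V} (hx : x ∈ S) (hy : y ∈ S) :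
    ReachIn G S x y := (connectedSet_iff.1 h).2 x hx y hy

theorem connectedSet_of_center {c : V} (hc : c ∈ S) (h : ∀ x ∈ S, ReachIn G S x c) :
    ConnectedSet G S :=
  connectedSet_iff.2 ⟨⟨c, hc⟩, fun x hx y hy => (h x hx).trans (h y hy).symm⟩

theorem connectedSet_singleton (x : V) : ConnectedSet G {x} :=
  connectedSet_of_center rfl (by rintro y rfl; exact .refl rfl)

theorem ConnectedSet.of_subset (hS : ConnectedSet G S) (hST : S ⊆ T)
    (h : ∀ x ∈ T, ∃ y ∈ S, ReachIn G T x y) : ConnectedSet G T := by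
  obtain ⟨c, hc⟩ := hS.nonempty
  refine connectedSet_of_center (hST hc) fun x hx => ?_
  obtain ⟨y, hy, hxy⟩ := h x hx
  exact hxy.trans ((hS.reachIn hy hc).mono hST)

theorem ConnectedSet.union_of_adj (hS : ConnectedSet G S) (hT : ConnectedSet G T) {a b : V}
    (ha : a ∈ S) (hb : b ∈ T) (hab : G.Adj a b) : ConnectedSet G (S ∪ T) := by
  refine hS.of_subset Set.subset_union_left ?_
  rintro x (hx | hx)
  · exact ⟨x, hx, .refl (Or.inl hx)⟩
  · exact ⟨a, ha, ((hT.reachIn hx hb).mono Set.subset_union_right).tail hab.symm (Or.inl ha)⟩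

theorem connectedSet_univ (hG : G.Connected) : ConnectedSet G Set.univ := by
  have := hG.nonempty
  exact connectedSet_iff.2 ⟨Set.univ_nonempty,
    fun x _ y _ => ReachIn.univ_of_connected hG x y⟩

theorem connected_of_connectedSet_univ (h : ConnectedSet G Set.univ) : G.Connected := by
  obtain ⟨x, _⟩ := h.nonempty
  have : Nonempty V := ⟨x⟩
  refine ⟨fun a b => ?_⟩
  obtain ⟨p, -⟩ := ReachIn.iff_walk.1 (h.reachIn (Set.mem_univ a) (Set.mem_univ b))
  exact ⟨p⟩

end ConnectedSets

/-! ### Induced paths -/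

section InducedPaths

variable {V : Type} {G : SimpleGraph V}

/-- Cutting a shortest walk at position `i` bounds the distances to both ends from above, and the
triangle inequality makes both bounds sharp. -/
theorem SimpleGraph.Reachable.exists_geodesic {a d : V} (h : G.Reachable a d) :
    ∃ f : ℕ → V, f 0 = a ∧ f (G.dist a d) = d ∧ (∀ i ≤ G.dist a d, G.dist a (f i) = i) ∧
      ∀ i < G.dist a d, G.Adj (f i) (f (i + 1)) := by
  obtain ⟨p, hp⟩ := h.exists_walk_length_eq_dist
  refine ⟨p.getVert, p.getVert_zero, by rw [← hp, p.getVert_length], fun i hi => ?_,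
    fun i hi => p.adj_getVert_succ (by omega)⟩
  have h1 := SimpleGraph.dist_le (p.take i)
  have h2 := SimpleGraph.dist_le (p.drop i)
  have h3 := (p.take i).reachable.dist_triangle_left d
  simp only [SimpleGraph.Walk.take_length, SimpleGraph.Walk.drop_length] at h1 h2
  omega

/-- A geodesic of `G[S]` has no chords, since the distances of adjacent vertices from `a` differ by
at most one. -/
theorem ReachIn.exists_induced_path {S : Set V} {a d : V} (h : ReachIn G S a d) :
    ∃ (l : ℕ) (f : ℕ → V), f 0 = a ∧ f l = d ∧ (∀ i ≤ l, f i ∈ S) ∧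
      (∀ i ≤ l, ∀ j ≤ l, f i = f j → i = j) ∧
      ∀ i ≤ l, ∀ j ≤ l, (G.Adj (f i) (f j) ↔ i + 1 = j ∨ j + 1 = i) := by
  have hr := (ReachIn.induce_reachable_iff h.left_mem h.right_mem).2 h
  obtain ⟨f, h0, hl, hd, ha⟩ := hr.exists_geodesic
  set l := (G.induce S).dist ⟨a, h.left_mem⟩ ⟨d, h.right_mem⟩
  refine ⟨l, fun i => (f i).1, by simp [h0], by simp [hl], fun i _ => (f i).2,
    fun i hi j hj hij => ?_, fun i hi j hj => ⟨fun hij => ?_, ?_⟩⟩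
  · rw [← hd i hi, ← hd j hj, Subtype.ext hij]
  · have hij' : (G.induce S).Adj (f i) (f j) := hij
    have h1 := hd i hi
    have h2 := hd j hj
    have h3 : i ≠ j := by rintro rfl; exact G.loopless.irrefl _ hij
    rcases hij'.diff_dist_adj (u := ⟨a, h.left_mem⟩) with h | h | h <;> omega
  · rintro (rfl | rfl)
    · exact ha i (by omega)
    · exact (ha j (by omega)).symm

/-- A vertex map that is injective and reflects and preserves adjacency up to index `m`. -/
theorem exists_embedding_pathGraph {f : ℕ → V} {l m : ℕ} (hm : m ≤ l + 1)
    (hinj : ∀ i ≤ l, ∀ j ≤ l, f i = f j → i = j)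
    (hadj : ∀ i ≤ l, ∀ j ≤ l, (G.Adj (f i) (f j) ↔ i + 1 = j ∨ j + 1 = i)) :
    ∃ e : SimpleGraph.pathGraph m ↪g G, ∀ i, e i = f i := by
  refine ⟨⟨⟨fun i => f i, fun i j hij => Fin.ext (hinj i (by omega) j (by omega) hij)⟩, ?_⟩,
    fun i => rfl⟩
  intro i j
  rw [SimpleGraph.pathGraph_adj]
  exact hadj i (by omega) j (by omega)

/-- A connected set with two vertices at distance at least three induces a path on four vertices. -/
theorem exists_induced_P4 {S : Set V} {a d : V} (h : ReachIn G S a d) (hne : a ≠ d)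
    (hadj : ¬ G.Adj a d) (hcom : ∀ z ∈ S, ¬ (G.Adj a z ∧ G.Adj z d)) :
    ∃ e : SimpleGraph.pathGraph 4 ↪g G, ∀ i, e i ∈ S := by
  obtain ⟨l, f, h0, hl, hS, hinj, ha⟩ := h.exists_induced_path
  -- Lengths 0, 1 and 2 contradict `hne`, `hadj` and `hcom` respectively; the first four vertices
  -- then form the P₄.
  have h3 : 3 ≤ l := by
    by_contra hlt
    have : l = 0 ∨ l = 1 ∨ l = 2 := by omega
    rcases this with rfl | rfl | rfl
    · exact hne (h0.symm.trans hl)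
    · have := (ha 0 (by omega) 1 (by omega)).2 (by simp)
      rw [h0, hl] at this
      exact hadj this
    · have h1 := (ha 0 (by omega) 1 (by omega)).2 (by simp)
      have h2 := (ha 1 (by omega) 2 (by omega)).2 (by simp)
      rw [h0] at h1
      rw [hl] at h2
      exact hcom (f 1) (hS 1 (by omega)) ⟨h1, h2⟩
  obtain ⟨e, he⟩ := exists_embedding_pathGraph (m := 4) (by omega) hinj ha
  exact ⟨e, fun i => by rw [he]; exact hS i (by omega)⟩

theorem sP1P4_isIndContained_iff {s : ℕ} :
    (sP1P4 s).IsIndContained G ↔ ∃ (f : Fin s → V) (e : SimpleGraph.pathGraph 4 ↪g G),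
      Function.Injective f ∧ (∀ i j, ¬ G.Adj (f i) (f j)) ∧
        ∀ i j, f i ≠ e j ∧ ¬ G.Adj (f i) (e j) := by
  constructor
  · rintro ⟨φ⟩
    refine ⟨fun i => φ (.inl i), ⟨⟨fun j => φ (.inr j), fun i j h => ?_⟩, ?_⟩, fun i j h => ?_,
      fun i j => ?_, fun i j => ⟨fun h => ?_, ?_⟩⟩
    · exact Sum.inr_injective (φ.injective h)
    · intro a b
      exact φ.map_adj_iff.trans (by simp [sP1P4])
    · exact Sum.inl_injective (φ.injective h)
    · exact fun h => absurd (φ.map_adj_iff.1 h) (by simp [sP1P4])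
    · exact absurd (φ.injective h) (by simp)
    · exact fun h => absurd (φ.map_adj_iff.1 h) (by simp [sP1P4])
  · rintro ⟨f, e, hf, hff, hfe⟩
    refine ⟨⟨⟨Sum.elim f e, ?_⟩, ?_⟩⟩
    · rintro (a | a) (b | b) h
      · exact congrArg _ (hf h)
      · exact absurd h (hfe a b).1
      · exact absurd h.symm (hfe b a).1
      · exact congrArg _ (e.injective h)
    · rintro (a | a) (b | b)
      · exact iff_of_false (hff a b) (by simp [sP1P4])
      · exact iff_of_false (hfe a b).2 (by simp [sP1P4])
      · exact iff_of_false (fun h => (hfe b a).2 h.symm) (by simp [sP1P4])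
      · exact e.map_adj_iff.trans (by simp [sP1P4])

/-- The isolated vertices sit at the even positions below `2 * s`, and the P₄ occupies the last four
positions. -/
theorem sP1P4_isIndContained_pathGraph (s : ℕ) :
    (sP1P4 s).IsIndContained (SimpleGraph.pathGraph (2 * s + 4)) := by
  rw [sP1P4_isIndContained_iff]
  refine ⟨fun i => ⟨2 * i, by omega⟩, ⟨⟨fun j => ⟨2 * s + j, by omega⟩, fun i j h => ?_⟩, ?_⟩,
    fun i j h => ?_, fun i j => ?_, fun i j => ⟨?_, ?_⟩⟩
  · simp at h; omega
  · intro i j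
    change (SimpleGraph.pathGraph _).Adj (⟨2 * s + i, _⟩ : Fin (2 * s + 4)) ⟨2 * s + j, _⟩ ↔ _
    simp only [SimpleGraph.pathGraph_adj]
    omega
  · simp at h; omega
  · rw [SimpleGraph.pathGraph_adj]; simp only; omega
  · intro h
    have : 2 * i.1 = 2 * s + j.1 := congrArg Fin.val h
    omega
  · change ¬ (SimpleGraph.pathGraph _).Adj _ (⟨2 * s + j, _⟩ : Fin (2 * s + 4))
    rw [SimpleGraph.pathGraph_adj]; simp only; omega

theorem HFree.length_lt {s : ℕ} (hG : HFree (sP1P4 s) G) {f : ℕ → V} {l : ℕ}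
    (hinj : ∀ i ≤ l, ∀ j ≤ l, f i = f j → i = j)
    (hadj : ∀ i ≤ l, ∀ j ≤ l, (G.Adj (f i) (f j) ↔ i + 1 = j ∨ j + 1 = i)) :
    l + 1 < 2 * s + 4 := by
  by_contra hlt
  obtain ⟨e, -⟩ := exists_embedding_pathGraph (m := 2 * s + 4) (by omega) hinj hadj
  exact hG ((sP1P4_isIndContained_pathGraph s).trans ⟨e⟩)

end InducedPaths

/-! ### Connecting a subset of a connected set by few vertices -/

section Connector

variable {V : Type} {G : SimpleGraph V}

/-- The vertices of an induced path from `x` to `y` suffice, and freeness bounds their number. -/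
theorem ConnectedSet.exists_small_connectedSet {s : ℕ} (hG : HFree (sP1P4 s) G) {D : Set V}
    (hD : ConnectedSet G D) {x y : V} (hx : x ∈ D) (hy : y ∈ D) :
    ∃ P : Finset V, (P : Set V) ⊆ D ∧ x ∈ P ∧ y ∈ P ∧ P.card ≤ 2 * s + 3 ∧
      ConnectedSet G (P : Set V) := by
  classical
  obtain ⟨l, f, h0, hl, hS, hinj, ha⟩ := (hD.reachIn hx hy).exists_induced_path
  have hlt := hG.length_lt hinj ha
  have hmem : ∀ i ≤ l, f i ∈ (((Finset.range (l + 1)).image f : Finset V) : Set V) :=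
    fun i hi => by simpa using ⟨i, by omega, rfl⟩
  refine ⟨(Finset.range (l + 1)).image f, ?_, ?_, ?_, ?_, ?_⟩
  · intro z hz
    simp at hz
    obtain ⟨i, hi, rfl⟩ := hz
    exact hS i (by omega)
  · simpa using ⟨0, by omega, h0⟩
  · simpa using ⟨l, by omega, hl⟩
  · exact Finset.card_image_le.trans (by simp; omega)
  · refine connectedSet_of_center (hmem 0 (by omega)) fun z hz => ?_
    simp only [Finset.coe_image, Set.mem_image, Finset.mem_coe, Finset.mem_range] at hz
    obtain ⟨i, hi, rfl⟩ := hz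
    induction i with
    | zero => exact .refl (hmem 0 (by omega))
    | succ i ih =>
      exact (ReachIn.adj (hmem _ (by omega)) ((ha _ (by omega) _ (by omega)).2 (by simp))
        (hmem i (by omega))).trans (ih (by omega))

/-- The vertices of `A` whose component in `G[A]` contains or is adjacent to `w`. -/
def touched (G : SimpleGraph V) (A : Set V) (w : V) : Set V :=
  {a | ∃ b, ReachIn G A a b ∧ (w = b ∨ G.Adj w b)}

/-- Take `w` touching as many vertices of `A` as possible, and suppose that it misses `d`. Either
`w` and `d` have distance at least three in `G[D]`, or they have a common neighbour `z`. Since `z`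
touches `d`, maximality gives a component touched by `w` but not by `z`; with `b` a neighbour of `w`
in it, `b, w, z, d` is an induced P₄. -/
theorem exists_touching_or_induced_P4 [Finite V] {D A : Set V} (hD : ConnectedSet G D)
    (hAD : A ⊆ D) : (∃ w ∈ D, A ⊆ touched G A w) ∨
      ∃ e : SimpleGraph.pathGraph 4 ↪g G, ∀ i, e i ∈ D := by
  by_contra! hc
  obtain ⟨hc, hQ⟩ := hc
  obtain ⟨w, hw, hmax⟩ := (Set.toFinite D).exists_maximalFor
    (fun w => (touched G A w).ncard) D hD.nonempty
  obtain ⟨d, hd, hwd⟩ := Set.not_subset.1 (hc w hw)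
  have hne : w ≠ d := by rintro rfl; exact hwd ⟨w, .refl hd, Or.inl rfl⟩
  have hadj : ¬ G.Adj w d := fun h => hwd ⟨d, .refl hd, Or.inr h⟩
  by_cases hcom : ∀ z ∈ D, ¬ (G.Adj w z ∧ G.Adj z d)
  · obtain ⟨e, he⟩ := exists_induced_P4 (hD.reachIn hw (hAD hd)) hne hadj hcom
    obtain ⟨i, hi⟩ := hQ e
    exact hi (he i)
  push Not at hcom
  obtain ⟨z, hz, hwz, hzd⟩ := hcom
  have hzt : d ∈ touched G A z := ⟨d, .refl hd, Or.inr hzd⟩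
  have hsub : ¬ touched G A w ⊆ touched G A z := by
    intro hsub
    have hlt := Set.ncard_lt_ncard (hsub.ssubset_of_ne (by rintro h; exact hwd (h ▸ hzt)))
    exact absurd (hmax hz hlt.le) (not_le.2 hlt)
  obtain ⟨d', ⟨b, hb, hwb⟩, hdz⟩ := Set.not_subset.1 hsub
  have hzb : z ≠ b := fun h => hdz ⟨b, hb, Or.inl h⟩
  have hzb' : ¬ G.Adj z b := fun h => hdz ⟨b, hb, Or.inr h⟩
  rcases hwb with rfl | hwb
  · exact hzb' hwz.symm
  -- `b` and `d` lie in different components of `G[A]`, because `z` touches the component of `d`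
  -- only.
  have hbd : ¬ ReachIn G A b d := fun h => hdz ⟨d, hb.trans h, Or.inr hzd⟩
  have hbA := hb.right_mem
  have hbw : b ≠ w := hwb.ne'
  have hbd1 : b ≠ d := by rintro rfl; exact hbd (.refl hd)
  have hbd2 : ¬ G.Adj b d := fun h => hbd (.adj hbA h hd)
  obtain ⟨e, he⟩ := exists_embedding_pathGraph (G := G) (m := 4) (l := 3)
    (f := fun i => if i = 0 then b else if i = 1 then w else if i = 2 then z else d) le_rfl
    (by
      intro i hi j hj
      interval_cases i <;> interval_cases j <;>
        simp [hbw, hbw.symm, hzb, hzb.symm, hbd1, hbd1.symm, hwz.ne, hwz.ne', hne, hne.symm,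
          hzd.ne, hzd.ne'])
    (by
      intro i hi j hj
      have h1 : ¬ G.Adj b z := fun h => hzb' h.symm
      have h2 : ¬ G.Adj d b := fun h => hbd2 h.symm
      have h3 : ¬ G.Adj d w := fun h => hadj h.symm
      interval_cases i <;> interval_cases j <;>
        simp [hwb, hwb.symm, hzb', h1, hbd2, h2, hwz, hwz.symm, hadj, h3, hzd, hzd.symm])
  obtain ⟨i, hi⟩ := hQ e
  refine hi ?_
  rw [he]
  split_ifs
  exacts [hAD hbA, hw, hz, hAD hd]

/-- In the main case the set consists of the four vertices of a P₄ and of fewer than `s` paths with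
at most `2 * s + 3` vertices; the bound is generous. -/
theorem exists_connector [Finite V] {s : ℕ} (hG : HFree (sP1P4 s) G) {D A : Set V}
    (hD : ConnectedSet G D) (hAD : A ⊆ D) :
    ∃ S ⊆ D \ A, S.Finite ∧ S.ncard ≤ (s + 2) * (2 * s + 4) ∧ ConnectedSet G (A ∪ S) := by
  classical
  suffices ∃ P : Finset V, (P : Set V) ⊆ D ∧ P.card ≤ (s + 2) * (2 * s + 4) ∧
      ConnectedSet G (A ∪ P) by
    obtain ⟨P, hPD, hP, hc⟩ := this
    refine ⟨P \ A, Set.sdiff_subset_sdiff_left hPD, Set.toFinite _, ?_, ?_⟩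
    · refine (Set.ncard_le_ncard Set.sdiff_subset (Set.toFinite _)).trans ?_
      rwa [Set.ncard_coe_finset]
    · rwa [Set.union_sdiff_self]
  rcases exists_touching_or_induced_P4 hD hAD with ⟨w, hw, hAw⟩ | ⟨e, he⟩
  · refine ⟨{w}, by simpa using hw, by simp; nlinarith, ?_⟩
    have hw' : w ∈ A ∪ (({w} : Finset V) : Set V) := by simp
    refine connectedSet_of_center hw' ?_
    rintro x (hx | hx)
    · obtain ⟨b, hb, h⟩ := hAw hx
      have hb' := hb.mono (T := A ∪ (({w} : Finset V) : Set V)) Set.subset_union_left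
      rcases h with rfl | h
      · exact hb'
      · exact hb'.tail h.symm hw'
    · simp at hx
      subst hx
      exact .refl hw'
  · set Q : Finset V := Finset.univ.image e with hQ
    have heQ : ∀ i, e i ∈ Q := fun i => by simp [hQ]
    have hQc : Q.card ≤ 4 := Finset.card_image_le.trans (by simp)
    have hQr : ∀ q ∈ Q, ReachIn G Q q (e 0) := by
      intro q hq
      simp only [hQ, Finset.mem_image, Finset.mem_univ, true_and] at hq
      obtain ⟨i, rfl⟩ := hq
      have hstep : ∀ i j : Fin 4, i.val + 1 = j.val → ReachIn G Q (e j) (e i) := fun i j hij =>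
        .adj (by simpa using heQ j) (e.map_adj_iff.2 (SimpleGraph.pathGraph_adj.2 (Or.inr hij)))
          (by simpa using heQ i)
      have h1 := hstep 0 1 rfl
      have h2 := (hstep 1 2 rfl).trans h1
      have h3 := (hstep 2 3 rfl).trans h2
      fin_cases i
      exacts [.refl (by simpa using heQ 0), h1, h2, h3]
    -- `U` is the union of the components of `G[A]` that the P₄ does not touch; `R` is a maximal
    -- choice of vertices from pairwise different ones among them.
    set U : Set V := {a | a ∈ A ∧ ∀ q ∈ Q, a ∉ touched G A q} with hU
    obtain ⟨R, hR⟩ := (Set.toFinite {R : Set V | R ⊆ U ∧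
      ∀ x ∈ R, ∀ y ∈ R, x ≠ y → ¬ ReachIn G A x y}).exists_maximal ⟨∅, by simp⟩
    obtain ⟨⟨hRU, hRind⟩, hRmax⟩ := hR
    -- Otherwise `s` vertices of `R` and the P₄ induce the forbidden graph.
    have hRcard : R.toFinite.toFinset.card < s := by
      by_contra! hle
      obtain ⟨R', hR', hcard⟩ := Finset.exists_subset_card_eq hle
      have hR'' : ∀ x ∈ R', x ∈ R := fun x hx => by simpa using hR' hx
      let f : Fin s → V := fun i => (R'.equivFin.symm (Fin.cast hcard.symm i)).1
      have hfR : ∀ i, f i ∈ R := fun i => hR'' _ (R'.equivFin.symm (Fin.cast hcard.symm i)).2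
      have hfi : Function.Injective f := fun i j h =>
        Fin.cast_injective _ (R'.equivFin.symm.injective (Subtype.ext h))
      refine hG (sP1P4_isIndContained_iff.2 ⟨f, e, hfi, fun i j h => ?_, fun i j => ⟨fun h => ?_,
        fun h => ?_⟩⟩)
      · exact hRind _ (hfR i) _ (hfR j) h.ne
          (.adj (hRU (hfR i)).1 h (hRU (hfR j)).1)
      · exact (hRU (hfR i)).2 _ (heQ j) ⟨f i, .refl (hRU (hfR i)).1, Or.inl h.symm⟩
      · exact (hRU (hfR i)).2 _ (heQ j) ⟨f i, .refl (hRU (hfR i)).1, Or.inr h.symm⟩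
    have hRcov : ∀ a ∈ U, ∃ r ∈ R, ReachIn G A a r := by
      intro a ha
      by_contra! hc
      have haR : a ∉ R := fun h => hc a h (.refl ha.1)
      refine haR (hRmax (y := insert a R) ⟨Set.insert_subset ha hRU, ?_⟩ (Set.subset_insert a R)
        (Set.mem_insert a R))
      rintro x (rfl | hx) y (rfl | hy) hxy
      · exact absurd rfl hxy
      · exact hc y hy
      · exact fun h => hc x hx h.symm
      · exact hRind x hx y hy hxy
    -- The empty set for `r ∉ R` is a dummy value that lets `choose` produce a total function.
    have hP : ∀ r : V, ∃ P : Finset V, r ∈ R → (P : Set V) ⊆ D ∧ r ∈ P ∧ e 0 ∈ P ∧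
        P.card ≤ 2 * s + 3 ∧ ConnectedSet G (P : Set V) := by
      intro r
      by_cases hr : r ∈ R
      · obtain ⟨P, hP⟩ := hD.exists_small_connectedSet hG (hAD (hRU hr).1) (he 0)
        exact ⟨P, fun _ => hP⟩
      · exact ⟨∅, fun h => absurd h hr⟩
    choose P hP using hP
    have hPR : ∀ r ∈ R, (P r : Set V) ⊆
        A ∪ ((Q ∪ R.toFinite.toFinset.biUnion P : Finset V) : Set V) := by
      intro r hr x hx
      refine Or.inr ?_
      simp only [Finset.coe_union, Set.mem_union, Finset.mem_coe, Finset.mem_biUnion]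
      exact Or.inr ⟨r, by simpa using hr, hx⟩
    have hQR : (Q : Set V) ⊆ A ∪ ((Q ∪ R.toFinite.toFinset.biUnion P : Finset V) : Set V) := by
      intro x hx
      exact Or.inr (by simp only [Finset.coe_union]; exact Or.inl hx)
    refine ⟨Q ∪ R.toFinite.toFinset.biUnion P, ?_, ?_, ?_⟩
    · intro x hx
      simp only [Finset.coe_union, Set.mem_union, Finset.mem_coe, Finset.mem_biUnion,
        Set.Finite.mem_toFinset] at hx
      rcases hx with hx | ⟨r, hr, hx⟩
      · simp only [hQ, Finset.mem_image, Finset.mem_univ, true_and] at hx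
        obtain ⟨i, rfl⟩ := hx
        exact he i
      · exact (hP r hr).1 hx
    · have h1 := Finset.card_biUnion_le_card_mul R.toFinite.toFinset P (2 * s + 3)
        fun r hr => (hP r (by simpa using hr)).2.2.2.1
      have h2 := Finset.card_union_le Q (R.toFinite.toFinset.biUnion P)
      nlinarith
    · refine connectedSet_of_center (c := e 0) (hQR (heQ 0)) ?_
      have hrr : ∀ r ∈ R, ∀ x ∈ P r, ReachIn G
          (A ∪ ((Q ∪ R.toFinite.toFinset.biUnion P : Finset V) : Set V)) x (e 0) :=
        fun r hr x hx => ((hP r hr).2.2.2.2.reachIn hx (hP r hr).2.2.1).mono (hPR r hr)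
      rintro x (hx | hx)
      · by_cases hxU : x ∈ U
        · obtain ⟨r, hr, hxr⟩ := hRcov x hxU
          exact (hxr.mono Set.subset_union_left).trans (hrr r hr r (hP r hr).2.1)
        · simp only [hU, Set.mem_ofPred_eq, not_and, not_forall, not_not] at hxU
          obtain ⟨q, hq, b, hb, hqb⟩ := hxU hx
          have hb' := hb.mono (T := A ∪ ((Q ∪ R.toFinite.toFinset.biUnion P : Finset V) : Set V))
            Set.subset_union_left
          have hq' := (hQr q hq).mono hQR
          rcases hqb with rfl | hqb
          · exact hb'.trans hq'
          · exact (hb'.tail hqb.symm hq'.left_mem).trans hq'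
      · simp only [Finset.coe_union, Set.mem_union, Finset.mem_coe, Finset.mem_biUnion,
          Set.Finite.mem_toFinset] at hx
        rcases hx with hx | ⟨r, hr, hx⟩
        · exact (hQr x hx).mono hQR
        · exact hrr r hr x hx

end Connector

/-! ### Suitability relative to a connected first bag -/

section Bags

variable {V : Type}

/-- The vertices outside `B` with a neighbour in `B`. -/
def outerNbrs (G : SimpleGraph V) (B : Set V) : Set V := {x | x ∉ B ∧ ∃ b ∈ B, G.Adj b x}

/-- The vertices outside `B` and `v` that are adjacent to neither. -/
def outerRest (G : SimpleGraph V) (B : Set V) (v : V) : Set V :=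
  {x | x ∉ B ∧ x ∉ outerNbrs G B ∧ x ≠ v ∧ ¬ G.Adj v x}

/-- The vertices that `C` separates from `v`. -/
def separated (G : SimpleGraph V) (C : Set V) (v : V) : Set V := {x | ¬ ReachIn G Cᶜ x v}

/-- At most `α` vertices that make the neighbourhood of the bag `B` connected. -/
def IsBagGuess (α : ℕ) (G : SimpleGraph V) (B : Set V) (v : V) (S : Set V) : Prop :=
  S ⊆ outerRest G B v ∧ S.Finite ∧ S.ncard ≤ α ∧ ConnectedSet G (outerNbrs G B ∪ S)

/-- The map `r` numbers the bags of a `P_k`-witness structure with first bag `B` and last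
bag `{v}`. -/
structure IsPathRank (k : ℕ) (G : SimpleGraph V) (B : Set V) (v : V) (r : V → ℕ) : Prop where
  lt : ∀ x, r x < k
  lip : ∀ x y, G.Adj x y → r x ≤ r y + 1
  connected : ∀ i < k, ConnectedSet G {x | r x = i}
  first : ∀ x, r x = 0 ↔ x ∈ B
  last : ∀ x, r x + 1 = k ↔ x = v

/-- `B = {u}` gives the original problem. A larger connected `B` plays the role of a vertex created
by contraction, while the graph itself stays unchanged. -/
def BagSuitable (k : ℕ) (G : SimpleGraph V) (B : Set V) (v : V) : Prop :=
  ∃ r, IsPathRank k G B v r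

variable {G : SimpleGraph V} {B C S : Set V} {v : V}

/-! ### Guesses and the vertices they separate from `v` -/

theorem outerNbrs_singleton (G : SimpleGraph V) (u : V) : outerNbrs G {u} = G.neighborSet u := by
  ext x
  simp only [outerNbrs, Set.mem_singleton_iff, exists_eq_left, Set.mem_ofPred_eq,
    SimpleGraph.mem_neighborSet, and_iff_right_iff_imp]
  intro h
  exact h.ne'

theorem subset_separated : C ⊆ separated G C v := fun _ hx h => h.left_mem hx

theorem notMem_separated (hv : v ∉ C) : v ∉ separated G C v := fun h => h (.refl hv)

/-- A walk that starts in `B` and avoids `outerNbrs G B` never leaves `B`. -/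
theorem bag_subset_separated (hv : v ∉ B) : B ⊆ separated G (outerNbrs G B ∪ S) v := by
  intro b hb h
  exact hv (h.closed (P := (· ∈ B)) hb fun a c _ hc ha hac => by
    by_contra hcB
    exact hc (Or.inl ⟨hcB, a, ha, hac⟩)).1

/-- Follow a walk from `x` to `v` up to its first vertex in `C`. All vertices before it are
separated like `x`, and they stay outside `B` because entering `B` would require passing an outer
neighbour, which lies in `C`. -/
theorem exists_reachIn_separated (hG : G.Connected) {x : V} (hS : S ∩ B = ∅)
    (hx : x ∈ separated G (outerNbrs G B ∪ S) v) (hxB : x ∉ B) :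
    ∃ c ∈ outerNbrs G B ∪ S,
      ReachIn G (separated G (outerNbrs G B ∪ S) v \ B) x c := by
  set C := outerNbrs G B ∪ S with hC
  have hCB : ∀ c ∈ C, c ∉ B := by
    rintro c (hc | hc) hcB
    · exact hc.1 hcB
    · exact Set.eq_empty_iff_forall_notMem.1 hS c ⟨hc, hcB⟩
  by_cases hxC : x ∈ C
  · exact ⟨x, hxC, .refl ⟨hx, hxB⟩⟩
  have hkey : ∀ y, ReachIn G Cᶜ x y → ReachIn G (separated G C v \ B) x y := by
    intro y hy
    refine (hy.closed (P := fun y => ReachIn G (separated G C v \ B) x y ∧ ReachIn G Cᶜ x y)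
      ⟨.refl ⟨hx, hxB⟩, .refl hxC⟩ ?_).1.1
    rintro a b ha hb ⟨h1, h2⟩ hab
    have h3 := h2.tail hab hb
    refine ⟨h1.tail hab ⟨fun h => hx (h3.trans h), fun hbB => ha ?_⟩, h3⟩
    exact Or.inl ⟨h1.right_mem.2, b, hbB, hab.symm⟩
  obtain ⟨a, b, ha, -, hb, hab⟩ := (ReachIn.univ_of_connected hG x v).exists_exit
    (P := {y | ReachIn G Cᶜ x y}) (.refl hxC) hx
  have haX : ReachIn G Cᶜ x a := ha.right_mem.2
  have hbC : b ∈ C := by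
    by_contra hbC
    exact hb (haX.tail hab hbC)
  exact ⟨b, hbC, (hkey a haX).tail hab ⟨subset_separated hbC, hCB b hbC⟩⟩

theorem IsBagGuess.inter_eq_empty {α : ℕ} (h : IsBagGuess α G B v S) : S ∩ B = ∅ :=
  Set.eq_empty_iff_forall_notMem.2 fun _ hx => (h.1 hx.1).1 hx.2

theorem IsBagGuess.notMem {α : ℕ} (h : IsBagGuess α G B v S) (hv : v ∉ outerNbrs G B) :
    v ∉ outerNbrs G B ∪ S := by
  rintro (h' | h')
  · exact hv h'
  · exact (h.1 h').2.2.1 rfl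

theorem IsBagGuess.connectedSet_diff {α : ℕ} (hG : G.Connected) (h : IsBagGuess α G B v S) :
    ConnectedSet G (separated G (outerNbrs G B ∪ S) v \ B) := by
  refine h.2.2.2.of_subset ?_ fun x hx =>
    exists_reachIn_separated hG h.inter_eq_empty hx.1 hx.2
  rintro x hx
  refine ⟨subset_separated hx, fun hxB => ?_⟩
  rcases hx with hx | hx
  · exact hx.1 hxB
  · exact (h.1 hx).1 hxB

theorem outerNbrs_nonempty (hG : G.Connected) (hB : B.Nonempty) (hv : v ∉ B) :
    (outerNbrs G B).Nonempty := by
  obtain ⟨b, hb⟩ := hB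
  obtain ⟨a, c, ha, -, hc, hac⟩ := (ReachIn.univ_of_connected hG b v).exists_exit hb hv
  exact ⟨c, hc, a, ha.right_mem.2, hac⟩

theorem IsBagGuess.connectedSet_separated {α : ℕ} (hG : G.Connected) (hB : ConnectedSet G B)
    (hv : v ∉ B) (h : IsBagGuess α G B v S) :
    ConnectedSet G (separated G (outerNbrs G B ∪ S) v) := by
  obtain ⟨c, hc, b, hb, hbc⟩ := outerNbrs_nonempty hG hB.nonempty hv
  have := hB.union_of_adj (h.connectedSet_diff hG) hb
    ⟨subset_separated (Or.inl ⟨hc, b, hb, hbc⟩), hc⟩ hbc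
  rwa [Set.union_sdiff_cancel (bag_subset_separated hv)] at this

/-! ### Merging and splitting the first bags -/

namespace IsPathRank

variable {k : ℕ} {r : V → ℕ}

theorem lip' (hr : IsPathRank k G B v r) {x y : V} (h : G.Adj x y) :
    r x ≤ r y + 1 ∧ r y ≤ r x + 1 := ⟨hr.lip x y h, hr.lip y x h.symm⟩

theorem last_eq (hr : IsPathRank k G B v r) : r v + 1 = k := (hr.last v).2 rfl

theorem eq_one_of_mem_outerNbrs (hr : IsPathRank k G B v r) {x : V} (hx : x ∈ outerNbrs G B) :
    r x = 1 := by
  obtain ⟨hxB, b, hb, hbx⟩ := hx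
  have h1 := (hr.first b).2 hb
  have h2 : r x ≠ 0 := fun h => hxB ((hr.first x).1 h)
  have h3 := hr.lip' hbx
  omega

theorem notMem_bag (hr : IsPathRank k G B v r) (hk : 2 ≤ k) : v ∉ B := fun h => by
  have := (hr.first v).2 h
  have := hr.last_eq
  omega

theorem notMem_outerNbrs (hr : IsPathRank k G B v r) (hk : 3 ≤ k) : v ∉ outerNbrs G B :=
  fun h => by
  have := hr.eq_one_of_mem_outerNbrs h
  have := hr.last_eq
  omega

/-- A walk from bag `i` to `v` leaves the ranks up to `i`, and by `lip` it does so into bag `i + 1`.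
-/
theorem exists_step_up (hG : G.Connected) (hr : IsPathRank k G B v r) {i : ℕ} (hi : i + 1 < k) :
    ∃ a b, r a = i ∧ r b = i + 1 ∧ G.Adj a b := by
  obtain ⟨x, hx⟩ := (hr.connected i (by omega)).nonempty
  obtain ⟨a, b, ha, -, hb, hab⟩ := (ReachIn.univ_of_connected hG x v).exists_exit
    (P := {y | r y ≤ i}) (by simpa using le_of_eq hx)
    (by have := hr.last_eq; simp only [Set.mem_ofPred_eq]; omega)
  have h1 : r a ≤ i := ha.right_mem.2
  have h2 : ¬ r b ≤ i := hb
  have := hr.lip' hab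
  exact ⟨a, b, by omega, by omega, hab⟩

/-- Climb bag by bag: inside the connected current bag walk to an edge that leads one bag up. The
induction is on the number of bags still ahead. -/
theorem reachIn_last (hG : G.Connected) (hr : IsPathRank k G B v r) {i : ℕ} {x : V}
    (hx : i ≤ r x) : ReachIn G {y | i ≤ r y} x v := by
  obtain ⟨m, hm⟩ : ∃ m, m = k - 1 - r x := ⟨_, rfl⟩
  induction m generalizing x with
  | zero =>
    have h1 := hr.lt x
    obtain rfl := (hr.last x).1 (by omega)
    exact .refl hx
  | succ m ih =>
    have h1 := hr.lt x
    obtain ⟨a, b, ha, hb, hab⟩ := hr.exists_step_up hG (i := r x) (by omega)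
    have hsub : {y | r y = r x} ⊆ {y | i ≤ r y} := fun y hy => by
      have : r y = r x := hy
      simp only [Set.mem_ofPred_eq]; omega
    have hxa := ((hr.connected (r x) h1).reachIn (x := x) (y := a) rfl ha).mono hsub
    have hib : i ≤ r b := by omega
    exact (hxa.tail hab hib).trans (ih hib (by omega))

/-- From rank two or more, `v` is reached through ranks at least two, hence off `C`. -/
theorem separated_le_one (hG : G.Connected) (hr : IsPathRank k G B v r)
    (hC : C ⊆ {x | r x = 1}) {x : V} (hx : x ∈ separated G C v) : r x ≤ 1 := by
  by_contra hlt
  refine hx ((hr.reachIn_last hG (i := 2) (by omega)).mono fun y hy hyC => ?_)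
  have h1 : r y = 1 := hC hyC
  have h2 : 2 ≤ r y := hy
  omega

/-- The first two bags can be merged into the vertices that `C` separates from `v`. -/
theorem contract_first (hG : G.Connected) (hk : 3 ≤ k) (hr : IsPathRank (k + 1) G B v r)
    (hconn : ConnectedSet G (separated G C v))
    (hC : C ⊆ {x | r x = 1}) :
    BagSuitable k G (separated G C v) v := by
  classical
  have hsep := fun x => hr.separated_le_one hG hC (x := x)
  -- The maximum sends the unseparated vertices of rank at most one to the new bag 1, where they
  -- join the old bag 2.
  let r' : V → ℕ := fun x => if x ∈ separated G C v then 0 else max (r x - 1) 1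
  have hin : ∀ x ∈ separated G C v, r' x = 0 := fun x hx => if_pos hx
  have hout : ∀ x ∉ separated G C v, r' x = max (r x - 1) 1 := fun x hx => if_neg hx
  have hle : ∀ x, r' x ≤ max (r x - 1) 1 := fun x => by
    by_cases hx : x ∈ separated G C v
    · rw [hin x hx]; omega
    · exact (hout x hx).le
  have hbig : ∀ x, 2 ≤ r x → r' x = r x - 1 := fun x hx => by
    rw [hout x (fun h => by have := hsep x h; omega)]; omega
  refine ⟨r', fun x => ?_, fun x y hxy => ?_, fun i hi => ?_, fun x => ?_, fun x => ?_⟩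
  · have := hle x
    have := hr.lt x
    omega
  · have h3 := hr.lip' hxy
    have h4 := hle x
    by_cases hy : y ∈ separated G C v
    · have := hsep y hy
      omega
    · have := hout y hy
      omega
  · rcases Nat.lt_or_ge 1 i with hi1 | hi1
    · have : {x | r' x = i} = {x | r x = i + 1} := by
        ext x
        simp only [Set.mem_ofPred_eq]
        have := hle x
        constructor
        · intro h
          have := hbig x (by omega)
          omega
        · intro h
          rw [hbig x (by omega)]; omega
      rw [this]
      exact hr.connected _ (by omega)
    obtain rfl | rfl : i = 0 ∨ i = 1 := by omega
    · have : {x | r' x = 0} = separated G C v := by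
        ext x
        simp only [Set.mem_ofPred_eq]
        by_cases hx : x ∈ separated G C v
        · simp [hx, hin x hx]
        · simp only [hx, iff_false]; rw [hout x hx]; omega
      rwa [this]
    · have hmem : ∀ x, r' x = 1 ↔ x ∉ separated G C v ∧ r x ≤ 2 := by
        intro x
        by_cases hx : x ∈ separated G C v
        · simp [hx, hin x hx]
        · simp only [hx, not_false_eq_true, true_and]; rw [hout x hx]; omega
      have hsub : {x | r x = 2} ⊆ {x | r' x = 1} := fun x hx => by
        have hx : r x = 2 := hx
        exact (hmem x).2 ⟨fun h => by have := hsep x h; omega, by omega⟩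
      refine (hr.connected 2 (by omega)).of_subset hsub fun x hx => ?_
      obtain ⟨hxs, hx2⟩ := (hmem x).1 hx
      rcases Nat.lt_or_ge (r x) 2 with hlt | hge
      -- A leftover vertex reaches `v` off `C`. Until this walk enters the old bag 2, its vertices
      -- have rank at most one and are unseparated too, so they belong to the same new bag.
      · have hxv : ReachIn G Cᶜ x v := not_not.1 hxs
        obtain ⟨a, b, ha, hbC, hb, hab⟩ := hxv.exists_exit (P := {y | r y ≤ 1})
          (by simp only [Set.mem_ofPred_eq]; omega)
          (by have := hr.last_eq; simp only [Set.mem_ofPred_eq]; omega)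
        have ha1 : r a ≤ 1 := ha.right_mem.2
        have hb1 : ¬ r b ≤ 1 := hb
        have := hr.lip' hab
        have hb2 : r b = 2 := by omega
        have hsub' : ReachIn G {x | r' x = 1} x a := by
          refine (ha.closed (P := fun y => ReachIn G {x | r' x = 1} x y ∧ ReachIn G Cᶜ x y)
            ⟨.refl hx, .refl hxv.left_mem⟩ ?_).1.1
          rintro c d - hd ⟨h1, h2⟩ hcd
          have h3 := h2.tail hcd hd.1
          have h4 : r d ≤ 1 := hd.2
          refine ⟨h1.tail hcd ((hmem d).2 ⟨fun h => ?_, by omega⟩), h3⟩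
          exact h (h3.symm.trans hxv)
        exact ⟨b, hb2, hsub'.tail hab (hsub hb2)⟩
      · exact ⟨x, le_antisymm hx2 hge, .refl hx⟩
  · by_cases hx : x ∈ separated G C v
    · simp [hx, hin x hx]
    · simp only [hx, iff_false]; rw [hout x hx]; omega
  · rw [← hr.last x]
    have := hle x
    constructor
    · intro h
      have := hbig x (by omega)
      omega
    · intro h
      have := hbig x (by omega)
      omega

/-- The first bag `B'` can be split into `B` and `B' \ B`. -/
theorem split_first {B' : Set V} (hr : IsPathRank k G B' v r) (hk : 2 ≤ k) (hBB' : B ⊆ B')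
    (hB : ConnectedSet G B) (hdiff : ConnectedSet G (B' \ B)) (hN : outerNbrs G B ⊆ B') :
    BagSuitable (k + 1) G B v := by
  classical
  let r' : V → ℕ := fun x => if x ∈ B then 0 else r x + 1
  have hin : ∀ x ∈ B, r' x = 0 := fun x hx => if_pos hx
  have hout : ∀ x ∉ B, r' x = r x + 1 := fun x hx => if_neg hx
  refine ⟨r', fun x => ?_, fun x y hxy => ?_, fun i hi => ?_, fun x => ?_, fun x => ?_⟩
  · have := hr.lt x
    by_cases hx : x ∈ B
    · rw [hin x hx]; omega
    · rw [hout x hx]; omega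
  · have := hr.lip x y hxy
    by_cases hx : x ∈ B
    · rw [hin x hx]; omega
    · rw [hout x hx]
      by_cases hy : y ∈ B
      -- A neighbour of `B` outside `B` lies in the old first bag, so its new rank is exactly one.
      · have := (hr.first x).2 (hN ⟨hx, y, hy, hxy.symm⟩)
        omega
      · rw [hout y hy]; omega
  · rcases i with _ | _ | i
    · have : {x | r' x = 0} = B := by
        ext x
        by_cases hx : x ∈ B
        · simp [hx, hin x hx]
        · simp [hx, hout x hx]
      rwa [this]
    · have : {x | r' x = 0 + 1} = B' \ B := by
        ext x
        by_cases hx : x ∈ B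
        · simp [hx, hin x hx]
        · simp [hx, hout x hx, hr.first]
      rwa [this]
    · have : {x | r' x = i + 1 + 1} = {x | r x = i + 1} := by
        ext x
        by_cases hx : x ∈ B
        · have := (hr.first x).2 (hBB' hx)
          simp only [Set.mem_ofPred_eq, hin x hx]
          omega
        · simp [hout x hx]
      rw [this]
      exact hr.connected _ (by omega)
  · by_cases hx : x ∈ B
    · simp [hx, hin x hx]
    · simp [hx, hout x hx]
  · rw [← hr.last x]
    by_cases hx : x ∈ B
    · have := (hr.first x).2 (hBB' hx)
      rw [hin x hx]; omega
    · rw [hout x hx]; omega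

/-- This is the connector of the outer neighbours inside the second bag. With at least four bags,
`v` has rank at least three and therefore no neighbour in that bag. -/
theorem exists_guess [Finite V] {s : ℕ} (hf : HFree (sP1P4 s) G)
    (hk : 4 ≤ k) (hr : IsPathRank k G B v r) :
    ∃ S ⊆ {x | r x = 1} \ outerNbrs G B, IsBagGuess ((s + 2) * (2 * s + 4)) G B v S := by
  obtain ⟨S, hS, hfin, hcard, hconn⟩ := exists_connector hf (hr.connected 1 (by omega))
    (A := outerNbrs G B) fun x hx => hr.eq_one_of_mem_outerNbrs hx
  refine ⟨S, hS, fun x hx => ?_, hfin, hcard, hconn⟩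
  have h1 : r x = 1 := (hS hx).1
  have h2 := hr.last_eq
  refine ⟨fun h => ?_, (hS hx).2, ?_, fun h => ?_⟩
  · have := (hr.first x).2 h
    omega
  · rintro rfl
    omega
  · have := hr.lip' h
    omega

end IsPathRank

/-- Forwards, `exists_guess` finds a guess inside the second bag, and the first two bags are merged.
Backwards any guess works, because the separated set minus `B` is always connected and can serve as
second bag. -/
theorem bagSuitable_succ_iff [Finite V] {s k : ℕ} (hk : 3 ≤ k) (hG : G.Connected)
    (hf : HFree (sP1P4 s) G) (hB : ConnectedSet G B) :
    BagSuitable (k + 1) G B v ↔ v ∉ B ∧ v ∉ outerNbrs G B ∧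
      ∃ S, IsBagGuess ((s + 2) * (2 * s + 4)) G B v S ∧
        BagSuitable k G (separated G (outerNbrs G B ∪ S) v) v := by
  constructor
  · rintro ⟨r, hr⟩
    have hvB := hr.notMem_bag (by omega)
    obtain ⟨S, hS, hg⟩ := hr.exists_guess hf (by omega)
    refine ⟨hvB, hr.notMem_outerNbrs (by omega), S, hg, hr.contract_first hG hk
      (hg.connectedSet_separated hG hB hvB) ?_⟩
    rintro x (hx | hx)
    · exact hr.eq_one_of_mem_outerNbrs hx
    · exact (hS hx).1
  · rintro ⟨hvB, hvN, S, hg, r, hr⟩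
    exact hr.split_first (by omega) (bag_subset_separated hvB) hB (hg.connectedSet_diff hG)
      (Set.subset_union_left.trans subset_separated)

/-- The middle bag is forced: it is everything outside `B` and `v`. This is the end of the chain of
reductions. -/
theorem bagSuitable_three_iff (hB : ConnectedSet G B) :
    BagSuitable 3 G B v ↔ v ∉ B ∧ v ∉ outerNbrs G B ∧ ConnectedSet G {x | x ∉ B ∧ x ≠ v} := by
  classical
  constructor
  · rintro ⟨r, hr⟩
    refine ⟨hr.notMem_bag (by omega), hr.notMem_outerNbrs le_rfl, ?_⟩
    have : {x | x ∉ B ∧ x ≠ v} = {x | r x = 1} := by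
      ext x
      have h1 := hr.first x
      have h2 := hr.last x
      have h3 := hr.lt x
      simp only [Set.mem_ofPred_eq, ne_eq, ← h1, ← h2]
      omega
    rw [this]
    exact hr.connected 1 (by omega)
  · rintro ⟨hvB, hvN, hc⟩
    let r : V → ℕ := fun x => if x ∈ B then 0 else if x = v then 2 else 1
    have h0 : ∀ x, r x = 0 ↔ x ∈ B := fun x => by simp only [r]; split_ifs <;> simp_all
    have h2 : ∀ x, r x = 2 ↔ x = v := fun x => by
      simp only [r]; split_ifs with h1 h2 <;> simp_all
      rintro rfl; exact hvB h1
    have hlt : ∀ x, r x < 3 := fun x => by simp only [r]; split_ifs <;> simp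
    have h1 : ∀ x, r x = 1 ↔ x ∉ B ∧ x ≠ v := fun x => by
      have h3 := hlt x
      rw [← h0, ne_eq, ← h2]
      omega
    refine ⟨r, hlt, fun x y hxy => ?_, fun i hi => ?_, h0, fun x => ?_⟩
    · have h3 := hlt x
      by_contra hlt
      have hx : x = v := (h2 x).1 (by omega)
      have hy : y ∈ B := (h0 y).1 (by omega)
      subst hx
      exact hvN ⟨hvB, y, hy, hxy.symm⟩
    · obtain rfl | rfl | rfl : i = 0 ∨ i = 1 ∨ i = 2 := by omega
      · have : {x | r x = 0} = B := Set.ext h0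
        rwa [this]
      · have : {x | r x = 1} = {x | x ∉ B ∧ x ≠ v} := Set.ext h1
        rwa [this]
      · have : {x | r x = 2} = {v} := Set.ext h2
        rw [this]
        exact connectedSet_singleton v
    · rw [← h2 x]; omega

end Bags

/-! ### Witness structures of paths and numberings of the bags -/

section Ranks

variable {V : Type} {G : SimpleGraph V} {k : ℕ}

theorem IsWitnessStructure.exists_rank {W : Fin k → Set V}
    (hW : IsWitnessStructure G (SimpleGraph.pathGraph k) W) :
    ∃ r : V → ℕ, (∀ x, r x < k) ∧ (∀ x y, G.Adj x y → r x ≤ r y + 1) ∧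
      ∀ i, W i = {x | r x = i} := by
  choose r hr using hW.cover
  have huniq : ∀ x i, x ∈ W i → r x = i := fun x i hx => by
    by_contra hne
    exact Set.disjoint_left.1 (hW.disjoint _ _ hne) (hr x) hx
  refine ⟨fun x => r x, fun x => (r x).2, fun x y hxy => ?_, fun i => Set.ext fun x => ?_⟩
  · by_cases hne : r x = r y
    · simp only [hne]; omega
    · have := SimpleGraph.pathGraph_adj.1
        ((hW.adj_iff _ _ hne).1 ⟨x, hr x, y, hr y, hxy⟩)
      dsimp only
      omega
  · exact ⟨fun hx => congrArg Fin.val (huniq x i hx), fun hx => Fin.ext hx ▸ hr x⟩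

/-- Edges between consecutive bags come for free: a walk from bag `i` to bag `i + 1` leaves the
ranks up to `i`, and ranks change by at most one along an edge. -/
theorem isWitnessStructure_of_rank (hG : G.Connected) {r : V → ℕ} (hlt : ∀ x, r x < k)
    (hlip : ∀ x y, G.Adj x y → r x ≤ r y + 1) (hconn : ∀ i < k, ConnectedSet G {x | r x = i}) :
    IsWitnessStructure G (SimpleGraph.pathGraph k) (fun i => {x | r x = i}) := by
  have hstep : ∀ i, i + 1 < k → ∃ a b, r a = i ∧ r b = i + 1 ∧ G.Adj a b := by
    intro i hi
    obtain ⟨x, hx⟩ := (hconn i (by omega)).nonempty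
    obtain ⟨y, hy⟩ := (hconn (i + 1) hi).nonempty
    have hx : r x = i := hx
    have hy : r y = i + 1 := hy
    obtain ⟨a, b, ha, -, hb, hab⟩ := (ReachIn.univ_of_connected hG x y).exists_exit
      (P := {z | r z ≤ i}) (by simp [hx]) (by simp [hy])
    have h1 : r a ≤ i := ha.right_mem.2
    have h2 : ¬ r b ≤ i := hb
    have := hlip b a hab.symm
    exact ⟨a, b, by omega, by omega, hab⟩
  refine ⟨fun i => hconn i i.2, fun i j hij => ?_, fun a => ⟨⟨r a, hlt a⟩, rfl⟩,
    fun i j hij => ?_⟩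
  · rw [Set.disjoint_left]
    intro x hx hy
    have hx : r x = i := hx
    have hy : r x = j := hy
    exact hij (Fin.ext (hx.symm.trans hy))
  · rw [SimpleGraph.pathGraph_adj]
    constructor
    · rintro ⟨a, ha, b, hb, hab⟩
      have ha : r a = i := ha
      have hb : r b = j := hb
      have h1 := hlip a b hab
      have h2 := hlip b a hab.symm
      have : i.val ≠ j.val := fun h => hij (Fin.ext h)
      omega
    · rintro (h | h)
      · obtain ⟨a, b, ha, hb, hab⟩ := hstep i (by omega)
        exact ⟨a, ha, b, hb.trans h, hab⟩
      · obtain ⟨a, b, ha, hb, hab⟩ := hstep j (by omega)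
        exact ⟨b, hb.trans h, a, ha, hab.symm⟩

theorem IsPathRank.isSolution {u v : V} {r : V → ℕ} (hG : G.Connected)
    (hr : IsPathRank k G {u} v r) : IsSolution k G u v (fun i => {x | r x = i}) := by
  refine ⟨isWitnessStructure_of_rank hG hr.lt hr.lip hr.connected, fun i hi => ?_, fun i hi => ?_⟩
  · ext x
    simpa [hi] using hr.first x
  · ext x
    have := hr.last x
    simp only [Set.mem_ofPred_eq, Set.mem_singleton_iff, ← this]
    omega

theorem suitable_iff_bagSuitable {u v : V} (hG : G.Connected) (hk : 0 < k) :
    Suitable k G u v ↔ BagSuitable k G {u} v := by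
  constructor
  · rintro ⟨W, hW, h0, hl⟩
    obtain ⟨r, hlt, hlip, hr⟩ := hW.exists_rank
    refine ⟨r, hlt, hlip, fun i hi => ?_, fun x => ?_, fun x => ?_⟩
    · rw [← hr ⟨i, hi⟩]
      exact hW.connected _
    · rw [← h0 ⟨0, hk⟩ rfl, hr]
      rfl
    · rw [← Set.mem_singleton_iff (b := v), ← hl ⟨k - 1, by omega⟩ (by simp; omega), hr]
      simp only [Set.mem_ofPred_eq]
      omega
  · rintro ⟨r, hr⟩
    exact ⟨_, hr.isSolution hG⟩

/-- No solution has to be modified: the connector already lies in the bag of rank one, so the first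
of the two alternatives holds. -/
theorem exists_constant_solution [Finite V] {s : ℕ} {u v : V} (hk : 4 ≤ k) (hG : G.Connected)
    (hf : HFree (sP1P4 s) G) (h : Suitable k G u v) :
    ∃ W : Fin k → Set V, IsConstantSolution ((s + 2) * (2 * s + 4)) k G u v W := by
  obtain ⟨r, hr⟩ := (suitable_iff_bagSuitable hG (by omega)).1 h
  obtain ⟨S, hS, -, hfin, hcard, hconn⟩ := hr.exists_guess hf hk
  rw [outerNbrs_singleton] at hS hconn
  exact ⟨_, hr.isSolution hG, Or.inl ⟨⟨1, by omega⟩, rfl, S, hS, hfin, hcard, hconn⟩⟩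

end Ranks

/-! ### Contraction of a connected set -/

section Contraction

variable {V : Type} {G : SimpleGraph V} {B : Set V}

theorem toContracted_eq_iff {x y : V} :
    toContracted B x = toContracted B y ↔ x = y ∨ (x ∈ B ∧ y ∈ B) :=
  Quotient.eq (r := contractSetoid B)

theorem toContracted_surjective : Function.Surjective (toContracted B) := Quotient.mk_surjective

theorem toContracted_adj {x y : V} (h : G.Adj x y) :
    toContracted B x = toContracted B y ∨
      (contractSet G B).Adj (toContracted B x) (toContracted B y) := by
  by_cases hxy : toContracted B x = toContracted B y
  · exact Or.inl hxy
  · exact Or.inr ⟨hxy, x, y, rfl, rfl, h⟩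

theorem ReachIn.toContracted {Y : Set (ContractedVertex B)} {x y : V}
    (h : ReachIn G (toContracted B ⁻¹' Y) x y) :
    ReachIn (contractSet G B) Y (toContracted B x) (toContracted B y) := by
  refine (h.closed (P := fun y => ReachIn (contractSet G B) Y (_root_.toContracted B x)
    (_root_.toContracted B y)) (.refl h.left_mem) ?_).1
  intro a b _ hb h hab
  rcases toContracted_adj (B := B) hab with heq | hadj
  · rwa [← heq]
  · exact h.tail hadj hb

/-- Each edge of the contracted graph lifts to an edge of `G`; different representatives of the
contracted vertex are joined inside the connected set `B`. -/
theorem ReachIn.of_toContracted (hB : ConnectedSet G B) {Y : Set (ContractedVertex B)} {x y : V}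
    (h : ReachIn (contractSet G B) Y (_root_.toContracted B x) (_root_.toContracted B y)) :
    ReachIn G (_root_.toContracted B ⁻¹' Y) x y := by
  have heq : ∀ a b, _root_.toContracted B a = _root_.toContracted B b →
      _root_.toContracted B a ∈ Y → ReachIn G (_root_.toContracted B ⁻¹' Y) a b := by
    intro a b hab ha
    rcases toContracted_eq_iff.1 hab with rfl | ⟨haB, hbB⟩
    · exact .refl ha
    · refine (hB.reachIn haB hbB).mono fun c hc => ?_
      change _root_.toContracted B c ∈ Y
      rwa [← toContracted_eq_iff.2 (Or.inr ⟨haB, hc⟩)]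
  refine (h.closed (P := fun q => ∀ y, _root_.toContracted B y = q →
    ReachIn G (_root_.toContracted B ⁻¹' Y) x y)
    (fun y hy => heq x y hy.symm h.left_mem) ?_).1 y rfl
  rintro p q hp hq hx ⟨-, a, b, rfl, rfl, hab⟩ y hy
  exact ((hx a rfl).tail hab hq).trans (heq b y hy.symm hq)

theorem connectedSet_preimage_iff (hB : ConnectedSet G B) {Y : Set (ContractedVertex B)} :
    ConnectedSet G (toContracted B ⁻¹' Y) ↔ ConnectedSet (contractSet G B) Y := by
  rw [connectedSet_iff, connectedSet_iff]
  refine and_congr ⟨?_, ?_⟩ ⟨fun h p hp q hq => ?_, fun h x hx y hy => ?_⟩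
  · rintro ⟨x, hx⟩
    exact ⟨_, hx⟩
  · rintro ⟨p, hp⟩
    obtain ⟨x, rfl⟩ := toContracted_surjective p
    exact ⟨x, hp⟩
  · obtain ⟨x, rfl⟩ := toContracted_surjective p
    obtain ⟨y, rfl⟩ := toContracted_surjective q
    exact (h x hp y hq).toContracted
  · exact (h _ hx _ hy).of_toContracted hB

theorem contractSet_connected (hG : G.Connected) (hB : ConnectedSet G B) :
    (contractSet G B).Connected :=
  connected_of_connectedSet_univ ((connectedSet_preimage_iff hB).1 (connectedSet_univ hG))

theorem exists_adj_preimage_iff {Y Z : Set (ContractedVertex B)} (hYZ : Disjoint Y Z) :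
    (∃ a ∈ toContracted B ⁻¹' Y, ∃ b ∈ toContracted B ⁻¹' Z, G.Adj a b) ↔
      ∃ p ∈ Y, ∃ q ∈ Z, (contractSet G B).Adj p q := by
  constructor
  · rintro ⟨a, ha, b, hb, hab⟩
    refine ⟨_, ha, _, hb, fun h => ?_, a, b, rfl, rfl, hab⟩
    exact Set.disjoint_left.1 hYZ ha (by rw [h]; exact hb)
  · rintro ⟨_, hp, _, hq, -, a, b, rfl, rfl, hab⟩
    exact ⟨a, hp, b, hq, hab⟩

/-- With `B` the two ends of an edge, this carries witness structures across a single edge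
contraction in both directions. -/
theorem isWitnessStructure_preimage_iff {X : Type} {H : SimpleGraph X} (hB : ConnectedSet G B)
    {W : X → Set (ContractedVertex B)} :
    IsWitnessStructure G H (fun x => toContracted B ⁻¹' W x) ↔
      IsWitnessStructure (contractSet G B) H W := by
  have hdisj : ∀ x y, Disjoint (toContracted B ⁻¹' W x) (toContracted B ⁻¹' W y) ↔
      Disjoint (W x) (W y) := fun x y =>
    Set.disjoint_preimage_iff toContracted_surjective
  constructor
  · rintro ⟨h1, h2, h3, h4⟩
    refine ⟨fun x => (connectedSet_preimage_iff hB).1 (h1 x), fun x y h => (hdisj x y).1 (h2 x y h),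
      fun q => ?_, fun x y h => ?_⟩
    · obtain ⟨a, rfl⟩ := toContracted_surjective q
      exact h3 a
    · rw [← exists_adj_preimage_iff ((hdisj x y).1 (h2 x y h)), h4 x y h]
  · rintro ⟨h1, h2, h3, h4⟩
    refine ⟨fun x => (connectedSet_preimage_iff hB).2 (h1 x), fun x y h => (hdisj x y).2 (h2 x y h),
      fun a => h3 (toContracted B a), fun x y h => ?_⟩
    rw [exists_adj_preimage_iff (h2 x y h), h4 x y h]

theorem isPathRank_comp_iff {k : ℕ} {b v : V} (hB : ConnectedSet G B) (hb : b ∈ B) (hv : v ∉ B)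
    {r : ContractedVertex B → ℕ} :
    IsPathRank k (contractSet G B) {toContracted B b} (toContracted B v) r ↔
      IsPathRank k G B v (fun x => r (toContracted B x)) := by
  have h0 : ∀ x, toContracted B x = toContracted B b ↔ x ∈ B := fun x => by
    rw [toContracted_eq_iff]
    exact ⟨fun h => h.elim (fun h => h ▸ hb) And.left, fun h => Or.inr ⟨h, hb⟩⟩
  have hl : ∀ x, toContracted B x = toContracted B v ↔ x = v := fun x => by
    rw [toContracted_eq_iff]
    exact ⟨fun h => h.elim id fun h => absurd h.2 hv, Or.inl⟩
  constructor
  · intro hr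
    refine ⟨fun x => hr.lt _, fun x y hxy => ?_, fun i hi => ?_, fun x => ?_, fun x => ?_⟩
    · rcases toContracted_adj (B := B) hxy with h | h
      · simp only [h]; omega
      · exact hr.lip _ _ h
    · exact (connectedSet_preimage_iff hB).2 (hr.connected i hi)
    · rw [hr.first, Set.mem_singleton_iff, h0]
    · rw [hr.last, hl]
  · intro hr
    refine ⟨fun q => ?_, ?_, fun i hi => ?_, fun q => ?_, fun q => ?_⟩
    · obtain ⟨x, rfl⟩ := toContracted_surjective q
      exact hr.lt x
    · rintro _ _ ⟨-, a, b, rfl, rfl, hab⟩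
      exact hr.lip a b hab
    · exact (connectedSet_preimage_iff hB).1 (hr.connected i hi)
    · obtain ⟨x, rfl⟩ := toContracted_surjective q
      rw [Set.mem_singleton_iff, h0, ← hr.first]
    · obtain ⟨x, rfl⟩ := toContracted_surjective q
      rw [hl, ← hr.last]

theorem suitable_contractSet_iff {k : ℕ} {b v : V} (hG : G.Connected) (hB : ConnectedSet G B)
    (hb : b ∈ B) (hv : v ∉ B) (hk : 0 < k) :
    Suitable k (contractSet G B) (toContracted B b) (toContracted B v) ↔ BagSuitable k G B v := by
  rw [suitable_iff_bagSuitable (contractSet_connected hG hB) hk]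
  constructor
  · rintro ⟨r, hr⟩
    exact ⟨_, (isPathRank_comp_iff hB hb hv).1 hr⟩
  · rintro ⟨r, hr⟩
    -- The numbering descends to the quotient because it is constantly zero on `B`.
    refine ⟨Quotient.lift r ?_, (isPathRank_comp_iff hB hb hv).2 hr⟩
    rintro x y (rfl | ⟨hx, hy⟩)
    · rfl
    · rw [(hr.first x).2 hx, (hr.first y).2 hy]

/-- Isolated vertices lift to arbitrary representatives. The preimage of the P₄ contains a walk
between representatives of its two ends, which stay at distance at least three within that preimage,
so it contains an induced P₄ of `G`. -/
theorem HFree.contractSet {s : ℕ} (hf : HFree (sP1P4 s) G) (hB : ConnectedSet G B) :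
    HFree (sP1P4 s) (contractSet G B) := by
  intro h
  obtain ⟨f, e, hinj, hff, hfe⟩ := sP1P4_isIndContained_iff.1 h
  choose g hg using toContracted_surjective (B := B)
  set P : Set (ContractedVertex B) := Set.range e with hP
  have heP : ∀ i, e i ∈ P := fun i => ⟨i, rfl⟩
  have hstep : ∀ i j : Fin 4, i.val + 1 = j.val → ReachIn (_root_.contractSet G B) P (e i) (e j) :=
    fun i j hij => .adj (heP i)
      (e.map_adj_iff.2 (SimpleGraph.pathGraph_adj.2 (Or.inl hij))) (heP j)
  have hreach : ReachIn G (toContracted B ⁻¹' P) (g (e 0)) (g (e 3)) := by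
    apply ReachIn.of_toContracted hB
    rw [hg, hg]
    exact ((hstep 0 1 rfl).trans (hstep 1 2 rfl)).trans (hstep 2 3 rfl)
  have hnadj : ∀ i j : Fin 4, ¬ (SimpleGraph.pathGraph 4).Adj i j → i ≠ j →
      ∀ a b, toContracted B a = e i → toContracted B b = e j → ¬ G.Adj a b := by
    intro i j hij hne a b ha hb hab
    refine hij (e.map_adj_iff.1 ⟨fun h => hne (e.injective h), a, b, ha, hb, hab⟩)
  have h03 : ¬ (SimpleGraph.pathGraph 4).Adj 0 3 := by simp [SimpleGraph.pathGraph_adj]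
  obtain ⟨e', he'⟩ := exists_induced_P4 hreach
    (fun h => absurd (e.injective (by rw [← hg (e 0), ← hg (e 3), h])) (by decide : (0 : Fin 4) ≠ 3))
    (hnadj 0 3 h03 (by decide) _ _ (hg _) (hg _)) (by
      rintro z ⟨i, hi⟩ ⟨h1, h2⟩
      have h1' : i = 0 ∨ (SimpleGraph.pathGraph 4).Adj 0 i := by
        by_contra! h
        exact hnadj 0 i h.2 h.1.symm _ _ (hg _) hi.symm h1
      have h2' : i = 3 ∨ (SimpleGraph.pathGraph 4).Adj i 3 := by
        by_contra! h
        exact hnadj i 3 h.2 h.1 _ _ hi.symm (hg _) h2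
      simp only [SimpleGraph.pathGraph_adj] at h1' h2'
      fin_cases i <;> simp at h1' h2')
  refine hf (sP1P4_isIndContained_iff.2 ⟨fun i => g (f i), e', fun i j h => ?_, fun i j h => ?_,
    fun i j => ?_⟩)
  · exact hinj (by rw [← hg (f i), ← hg (f j)]; exact congrArg _ h)
  · rcases toContracted_adj (B := B) h with h' | h'
    · rw [hg, hg] at h'
      simp only [h'] at h
      exact G.loopless.irrefl _ h
    · rw [hg, hg] at h'
      exact hff i j h'
  · obtain ⟨l, hl⟩ := he' j
    have := hfe i l
    refine ⟨fun h => this.1 ?_, fun h => ?_⟩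
    · rw [hl, ← h, hg]
    · rcases toContracted_adj (B := B) h with h' | h'
      · rw [hg, ← hl] at h'
        exact this.1 h'
      · rw [hg, ← hl] at h'
        exact this.2 h'

/-- A separated vertex outside `{u} ∪ N(u)` automatically lies in `T`: it differs from `v`, and if
it were adjacent to `v`, that edge would reach `v` off `N(u) ∪ S`, as `S` contains no neighbour of
`v`. -/
theorem guessBlock_eq {u v : V} {S : Set V} (huv : u ≠ v) (hadj : ¬ G.Adj u v)
    (hS : S ⊆ restSet G u v) :
    guessBlock G u v S = separated G (outerNbrs G {u} ∪ S) v := by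
  rw [outerNbrs_singleton]
  have hiff : ∀ x, x ∈ separated G (G.neighborSet u ∪ S) v ↔
      ∀ p : G.Walk x v, ∃ y ∈ p.support, y ∈ G.neighborSet u ∪ S := by
    intro x
    change ¬ ReachIn _ _ _ _ ↔ _
    rw [ReachIn.iff_walk]
    simp only [not_exists, not_forall, Set.mem_compl_iff, not_not, exists_prop]
  ext x
  constructor
  · rintro ((hx | hx) | hx)
    · rw [← outerNbrs_singleton]
      exact bag_subset_separated (fun h => huv h.symm) hx
    · exact subset_separated (Or.inl hx)
    · exact (hiff x).2 hx.2
  · intro hx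
    by_cases hxu : x = u
    · exact Or.inl (Or.inl hxu)
    by_cases hxN : x ∈ G.neighborSet u
    · exact Or.inl (Or.inr hxN)
    refine Or.inr ⟨⟨hxu, ?_, hxN, ?_⟩, (hiff x).1 hx⟩
    · rintro rfl
      refine notMem_separated ?_ hx
      rintro (h | h)
      · exact hadj h
      · exact (hS h).2.1 rfl
    · intro hvx
      have hvC : v ∉ G.neighborSet u ∪ S := by
        rintro (h | h)
        · exact hadj h
        · exact (hS h).2.1 rfl
      refine hx (.adj ?_ hvx.symm hvC)
      rintro (h | h)
      · exact hxN h
      · exact (hS h).2.2.2 hvx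

theorem isGuess_iff {α : ℕ} {u v : V} {S : Set V} :
    IsGuess α G u v S ↔ IsBagGuess α G {u} v S := by
  have : restSet G u v = outerRest G {u} v := by
    ext x
    simp only [restSet, outerRest, outerNbrs_singleton, Set.mem_ofPred_eq, Set.mem_singleton_iff,
      SimpleGraph.mem_neighborSet, ne_eq]
    tauto
  rw [IsGuess, IsBagGuess, this, outerNbrs_singleton]

theorem suitable_iff_exists_guess [Finite V] {s k : ℕ} {u v : V} (hk : 4 ≤ k)
    (hi : IsSuitabilityInstance G u v) (hf : HFree (sP1P4 s) G) :
    Suitable k G u v ↔ ∃ S : Set V, IsGuess ((s + 2) * (2 * s + 4)) G u v S ∧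
      Suitable (k - 1) (_root_.contractSet G (guessBlock G u v S))
        (toContracted _ u) (toContracted _ v) := by
  obtain ⟨hG, huv, hadj⟩ := hi
  obtain ⟨k, rfl⟩ : ∃ l, k = l + 1 := ⟨k - 1, by omega⟩
  have hvB : v ∉ ({u} : Set V) := fun h => huv h.symm
  have hvN : v ∉ outerNbrs G {u} := by rwa [outerNbrs_singleton]
  rw [suitable_iff_bagSuitable hG (by omega),
    bagSuitable_succ_iff (by omega) hG hf (connectedSet_singleton u), and_iff_right hvB,
    and_iff_right hvN]
  refine exists_congr fun S => ?_
  rw [isGuess_iff]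
  refine and_congr_right fun hg => ?_
  rw [guessBlock_eq huv hadj (isGuess_iff.2 hg).1, Nat.add_sub_cancel,
    suitable_contractSet_iff hG (hg.connectedSet_separated hG (connectedSet_singleton u) hvB)
      (bag_subset_separated hvB rfl) (notMem_separated (hg.notMem hvN)) (by omega)]

end Contraction

/-! ### Contracting a graph to a path -/

section WitnessStructures

variable {X : Type} {H : SimpleGraph X}

theorem connectedSet_pair {V : Type} {G : SimpleGraph V} {a b : V} (hab : G.Adj a b) :
    ConnectedSet G {a, b} := by
  have := (connectedSet_singleton (G := G) a).union_of_adj (connectedSet_singleton b) rfl rfl hab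
  rwa [Set.singleton_union] at this

theorem ContractsTo.exists_witness {V : Type} {G : SimpleGraph V} (h : ContractsTo H G) :
    ∃ W : X → Set V, IsWitnessStructure G H W := by
  induction h with
  | iso φ =>
    refine ⟨fun x => {φ.symm x}, fun x => connectedSet_singleton _, fun x y hxy => ?_,
      fun a => ⟨φ a, by simp⟩, fun x y _ => ?_⟩
    · simpa using hxy
    · simp only [Set.mem_singleton_iff, exists_eq_left]
      exact φ.symm.map_adj_iff
  | step u v huv _ ih =>
    obtain ⟨W, hW⟩ := ih
    exact ⟨_, (isWitnessStructure_preimage_iff (connectedSet_pair huv)).2 hW⟩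

/-- Induction on the number of vertices. If all bags are singletons, `G` is a copy of `H`; otherwise
some bag contains an edge, and contracting it keeps the witness structure. -/
theorem IsWitnessStructure.contractsTo {V : Type} [Finite V] {G : SimpleGraph V} {W : X → Set V}
    (hW : IsWitnessStructure G H W) : ContractsTo H G := by
  obtain ⟨n, hn⟩ : ∃ n, n = Nat.card V := ⟨_, rfl⟩
  induction n using Nat.strong_induction_on generalizing V with
  | _ n ih =>
  by_cases hsub : ∀ x, (W x).Subsingleton
  · choose r hr using hW.cover
    choose a ha using fun x => (hW.connected x).nonempty
    have hra : ∀ x, r (a x) = x := fun x => by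
      by_contra hne
      exact Set.disjoint_left.1 (hW.disjoint _ _ hne) (hr (a x)) (ha x)
    have har : ∀ b, a (r b) = b := fun b => hsub _ (ha _) (hr b)
    refine .iso ⟨⟨r, a, har, hra⟩, ?_⟩
    intro b c
    change H.Adj (r b) (r c) ↔ _
    by_cases hne : r b = r c
    · have : b = c := by rw [← har b, ← har c, hne]
      simp [this]
    · rw [← hW.adj_iff _ _ hne]
      constructor
      · rintro ⟨b', hb', c', hc', h⟩
        rwa [hsub _ hb' (hr b), hsub _ hc' (hr c)] at h
      · exact fun h => ⟨b, hr b, c, hr c, h⟩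
  · push Not at hsub
    obtain ⟨x, a, ha, b, hb, hne⟩ := hsub
    obtain ⟨a', c, ha', hc, -, hac⟩ := ((hW.connected x).reachIn ha hb).exists_exit
      (P := {a}) rfl (Ne.symm hne)
    obtain rfl : a' = a := ha'.right_mem.2
    -- Both ends of the edge lie in one bag, so every bag is a union of fibres of the contraction.
    have hpre : ∀ y, toContracted {a', c} ⁻¹' (toContracted {a', c} '' W y) = W y := by
      intro y
      refine Set.Subset.antisymm ?_ (Set.subset_preimage_image _ _)
      rintro z ⟨z', hz', hzz⟩
      rcases toContracted_eq_iff.1 hzz with rfl | ⟨h1, h2⟩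
      · exact hz'
      · have hsub : ({a', c} : Set V) ⊆ W x := by
          rintro _ (rfl | rfl)
          exacts [ha, hc]
        have hyx : y = x := by
          by_contra h
          exact Set.disjoint_left.1 (hW.disjoint _ _ h) hz' (hsub h1)
        rw [hyx]
        exact hsub h2
    have hW' : IsWitnessStructure (contractSet G {a', c}) H
        (fun y => toContracted {a', c} '' W y) := by
      rw [← isWitnessStructure_preimage_iff (connectedSet_pair hac)]
      simpa only [hpre] using hW
    refine .step a' c hac (ih _ ?_ hW' rfl)
    rw [hn]
    refine lt_of_le_of_ne (Nat.card_le_card_of_surjective _ toContracted_surjective) fun heq => ?_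
    have hinj : Function.Injective (toContracted ({a', c} : Set V)) :=
      ((Nat.bijective_iff_surjective_and_card _).2 ⟨toContracted_surjective, heq.symm⟩).1
    exact hac.ne (hinj (toContracted_eq_iff.2 (Or.inr ⟨Or.inl rfl, Or.inr rfl⟩)))

theorem contractsTo_iff {V : Type} [Finite V] {G : SimpleGraph V} :
    ContractsTo H G ↔ ∃ W : X → Set V, IsWitnessStructure G H W :=
  ⟨ContractsTo.exists_witness, fun ⟨_, hW⟩ => hW.contractsTo⟩

end WitnessStructures

section PathContraction

variable {V : Type} {G : SimpleGraph V} {k : ℕ}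

/-- A numbering of the bags of a `P_k`-witness structure. -/
structure IsPathNumbering (k : ℕ) (G : SimpleGraph V) (r : V → ℕ) : Prop where
  lt : ∀ x, r x < k
  lip : ∀ x y, G.Adj x y → r x ≤ r y + 1
  connected : ∀ i < k, ConnectedSet G {x | r x = i}

theorem contractsTo_pathGraph_iff [Finite V] (hG : G.Connected) :
    ContractsTo (SimpleGraph.pathGraph k) G ↔ ∃ r, IsPathNumbering k G r := by
  rw [contractsTo_iff]
  constructor
  · rintro ⟨W, hW⟩
    obtain ⟨r, hlt, hlip, hr⟩ := hW.exists_rank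
    refine ⟨r, hlt, hlip, fun i hi => ?_⟩
    rw [← hr ⟨i, hi⟩]
    exact hW.connected _
  · rintro ⟨r, hr⟩
    exact ⟨_, isWitnessStructure_of_rank hG hr.lt hr.lip hr.connected⟩

/-- Let `E` be a maximal connected set with `C ⊆ E ⊂ D`. Adding the end of an edge that leaves `E`
inside `D` must give all of `D`, so that end can be removed. -/
theorem ConnectedSet.exists_connectedSet_diff_singleton [Finite V] {C D : Set V}
    (hD : ConnectedSet G D) (hC : ConnectedSet G C) (hCD : C ⊂ D) :
    ∃ u ∈ D, u ∉ C ∧ ConnectedSet G (D \ {u}) := by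
  obtain ⟨E, ⟨hCE, hED, hE⟩, hmax⟩ :=
    (Set.toFinite {E | C ⊆ E ∧ E ⊂ D ∧ ConnectedSet G E}).exists_maximal ⟨C, subset_rfl, hCD, hC⟩
  obtain ⟨x, hx⟩ := hE.nonempty
  obtain ⟨y, hyD, hyE⟩ := Set.exists_of_ssubset hED
  obtain ⟨a, b, ha, hbD, hbE, hab⟩ := (hD.reachIn (hED.1 hx) hyD).exists_exit hx hyE
  have hEb : E ∪ {b} = D := by
    by_contra hne
    refine hbE (hmax (y := E ∪ {b}) ⟨hCE.trans Set.subset_union_left, ?_, ?_⟩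
      Set.subset_union_left (Or.inr rfl))
    · exact (Set.union_subset hED.1 (by simpa using hbD)).ssubset_of_ne hne
    · exact hE.union_of_adj (connectedSet_singleton b) ha.right_mem.2 rfl hab
  refine ⟨b, hbD, fun h => hbE (hCE h), ?_⟩
  rw [← hEb, Set.union_sdiff_right, Set.sdiff_singleton_eq_self hbE]
  exact hE

namespace IsPathNumbering

variable {r : V → ℕ}

/-- The union of the first two bags is connected and loses a vertex of the first bag without
becoming disconnected. That vertex becomes the first bag, and the rest of the union the second. -/
theorem exists_first_singleton [Finite V] (hG : G.Connected) (hk : 2 ≤ k)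
    (hr : IsPathNumbering k G r) :
    ∃ (u : V) (r' : V → ℕ), IsPathNumbering k G r' ∧ (∀ x, r' x = 0 ↔ x = u) ∧
      ∀ x i, 2 ≤ i → (r' x = i ↔ r x = i) := by
  classical
  obtain ⟨x, hx⟩ := (hr.connected 0 (by omega)).nonempty
  obtain ⟨y, hy⟩ := (hr.connected 1 (by omega)).nonempty
  have hx : r x = 0 := hx
  have hy : r y = 1 := hy
  obtain ⟨a, b, ha, -, hb, hab⟩ := (ReachIn.univ_of_connected hG x y).exists_exit
    (P := {z | r z = 0}) hx (by simp [hy])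
  have ha : r a = 0 := ha.right_mem.2
  have hb : r b ≠ 0 := hb
  have hb1 : r b = 1 := by have := hr.lip b a hab.symm; omega
  have hD := (hr.connected 0 (by omega)).union_of_adj (hr.connected 1 (by omega)) ha hb1 hab
  obtain ⟨u, huD, hu1, hconn⟩ := hD.exists_connectedSet_diff_singleton
    (hr.connected 1 (by omega)) (Set.ssubset_iff_of_subset Set.subset_union_right |>.2
      ⟨x, Or.inl hx, by simp [hx]⟩)
  have hu : r u = 0 := huD.resolve_right hu1
  let r' : V → ℕ := fun x => if r x = 0 ∧ x ≠ u then 1 else r x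
  have hr' : ∀ x, (r x = 0 ∧ x ≠ u ∧ r' x = 1) ∨ ((x = u ∨ r x ≠ 0) ∧ r' x = r x) := by
    intro x
    by_cases h : r x = 0 ∧ x ≠ u
    · exact Or.inl ⟨h.1, h.2, if_pos h⟩
    · refine Or.inr ⟨?_, if_neg h⟩
      by_cases h' : x = u
      · exact Or.inl h'
      · exact Or.inr fun h0 => h ⟨h0, h'⟩
  have h0 : ∀ x, r' x = 0 ↔ x = u := by
    intro x
    rcases hr' x with ⟨h1, h2, h3⟩ | ⟨h1, h2⟩
    · simp [h3, h2]
    · rw [h2]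
      exact ⟨fun h => h1.resolve_right (not_not.2 h), fun h => h ▸ hu⟩
  have hbig : ∀ x i, 2 ≤ i → (r' x = i ↔ r x = i) := by
    intro x i hi
    rcases hr' x with ⟨h1, h2, h3⟩ | ⟨h1, h2⟩
    · omega
    · rw [h2]
  refine ⟨u, r', ⟨fun x => ?_, fun x y hxy => ?_, fun i hi => ?_⟩, h0, hbig⟩
  · have := hr.lt x
    rcases hr' x with ⟨h1, h2, h3⟩ | ⟨h1, h2⟩ <;> omega
  · have := hr.lip x y hxy
    rcases hr' x with ⟨h1, h2, h3⟩ | ⟨h1, h2⟩ <;>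
      rcases hr' y with ⟨h4, h5, h6⟩ | ⟨h4, h5⟩ <;> omega
  · rcases i with _ | _ | i
    · have : {x | r' x = 0} = {u} := Set.ext h0
      rw [this]
      exact connectedSet_singleton u
    · have : {x | r' x = 0 + 1} = ({x | r x = 0} ∪ {x | r x = 1}) \ {u} := by
        ext x
        simp only [Set.mem_ofPred_eq, Set.mem_sdiff, Set.mem_union, Set.mem_singleton_iff, zero_add]
        rcases hr' x with ⟨h1, h2, h3⟩ | ⟨rfl | h1, h2⟩
        · simp [h1, h2, h3]
        · simp [h2, hu]
        · rw [h2]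
          have : x ≠ u := by rintro rfl; exact h1 hu
          simp [this, h1]
      rwa [this]
    · have : {x | r' x = i + 1 + 1} = {x | r x = i + 1 + 1} :=
        Set.ext fun x => hbig x _ (by omega)
      rw [this]
      exact hr.connected _ hi

theorem reverse (hr : IsPathNumbering k G r) : IsPathNumbering k G (fun x => k - 1 - r x) := by
  refine ⟨fun x => ?_, fun x y hxy => ?_, fun i hi => ?_⟩
  · have := hr.lt x
    omega
  · have := hr.lip y x hxy.symm
    have := hr.lt x
    omega
  · have : {x | k - 1 - r x = i} = {x | r x = k - 1 - i} := by
      ext x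
      have := hr.lt x
      simp only [Set.mem_ofPred_eq]
      omega
    rw [this]
    exact hr.connected _ (by omega)

theorem exists_isPathRank [Finite V] (hG : G.Connected) (hk : 3 ≤ k)
    (hr : IsPathNumbering k G r) : ∃ u v, BagSuitable k G {u} v := by
  obtain ⟨v, r₁, hr₁, hv, -⟩ := hr.exists_first_singleton hG (by omega)
  obtain ⟨u, r₂, hr₂, hu, hbig⟩ := hr₁.reverse.exists_first_singleton hG (by omega)
  refine ⟨u, v, r₂, hr₂.lt, hr₂.lip, hr₂.connected, hu, fun x => ?_⟩
  -- Since `k - 1 ≥ 2`, shrinking the bag at the second end does not disturb the singleton already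
  -- obtained at the first.
  have h1 := hbig x (k - 1) (by omega)
  have h2 := hr₁.lt x
  rw [← hv x]
  omega

/-- Along an induced path from the first bag to the last, the rank rises by at most one per step, so
this path has at least `k` vertices. -/
theorem lt_of_hFree {s : ℕ} (hG : G.Connected) (hf : HFree (sP1P4 s) G) (hk : 1 ≤ k)
    (hr : IsPathNumbering k G r) : k < 2 * s + 4 := by
  obtain ⟨x, hx⟩ := (hr.connected 0 (by omega)).nonempty
  obtain ⟨y, hy⟩ := (hr.connected (k - 1) (by omega)).nonempty
  have hx : r x = 0 := hx
  have hy : r y = k - 1 := hy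
  obtain ⟨l, f, h0, hl, -, hinj, hadj⟩ := (ReachIn.univ_of_connected hG x y).exists_induced_path
  have hle : ∀ i ≤ l, r (f i) ≤ i := by
    intro i
    induction i with
    | zero => intro _; rw [h0, hx]
    | succ i ih =>
      intro hi
      have := ih (by omega)
      have := hr.lip _ _ ((hadj (i + 1) hi i (by omega)).2 (Or.inr rfl))
      omega
  have h1 := hle l le_rfl
  have h2 := hf.length_lt hinj hadj
  rw [hl, hy] at h1
  omega

end IsPathNumbering

theorem contractsTo_pathGraph_one [Finite V] (hG : G.Connected) :
    ContractsTo (SimpleGraph.pathGraph 1) G := by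
  refine (contractsTo_pathGraph_iff hG).2 ⟨fun _ => 0, by simp, by simp, fun i hi => ?_⟩
  obtain rfl : i = 0 := by omega
  have : {x : V | (0 : ℕ) = 0} = Set.univ := by simp
  rw [this]
  exact connectedSet_univ hG

/-- The first bag is a vertex whose removal leaves the graph connected. -/
theorem contractsTo_pathGraph_two_iff [Finite V] (hG : G.Connected) :
    ContractsTo (SimpleGraph.pathGraph 2) G ↔ ∃ x y : V, x ≠ y := by
  classical
  rw [contractsTo_pathGraph_iff hG]
  constructor
  · rintro ⟨r, hr⟩
    obtain ⟨x, hx⟩ := (hr.connected 0 (by omega)).nonempty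
    obtain ⟨y, hy⟩ := (hr.connected 1 (by omega)).nonempty
    refine ⟨x, y, ?_⟩
    rintro rfl
    have hx : r x = 0 := hx
    have hy : r x = 1 := hy
    omega
  · rintro ⟨x, y, hxy⟩
    obtain ⟨u, -, -, hu⟩ := (connectedSet_univ hG).exists_connectedSet_diff_singleton
      (connectedSet_singleton x) (Set.ssubset_univ_iff.2 fun h => hxy.symm
        (show y ∈ ({x} : Set V) from h ▸ Set.mem_univ y))
    refine ⟨fun x => if x = u then 0 else 1, fun x => ?_, fun x y _ => ?_, fun i hi => ?_⟩
    · split_ifs <;> simp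
    · split_ifs <;> simp
    · obtain rfl | rfl : i = 0 ∨ i = 1 := by omega
      · have : {x | (if x = u then 0 else 1) = 0} = {u} := by ext x; simp
        rw [this]
        exact connectedSet_singleton u
      · have : {x | (if x = u then 0 else 1) = 1} = Set.univ \ {u} := by ext x; simp
        rwa [this]

theorem contractsTo_pathGraph_iff_bagSuitable [Finite V] (hG : G.Connected) (hk : 3 ≤ k) :
    ContractsTo (SimpleGraph.pathGraph k) G ↔ ∃ u v, BagSuitable k G {u} v := by
  rw [contractsTo_pathGraph_iff hG]
  constructor
  · rintro ⟨r, hr⟩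
    exact hr.exists_isPathRank hG hk
  · rintro ⟨u, v, r, hr⟩
    exact ⟨r, hr.lt, hr.lip, hr.connected⟩

theorem not_contractsTo_pathGraph [Finite V] {s : ℕ} (hG : G.Connected)
    (hf : HFree (sP1P4 s) G) (hk : 2 * s + 4 ≤ k) :
    ¬ ContractsTo (SimpleGraph.pathGraph k) G := by
  rw [contractsTo_pathGraph_iff hG]
  rintro ⟨r, hr⟩
  have := hr.lt_of_hFree hG hf (by omega)
  omega

end PathContraction

/-! ### Reasoning about programs -/

section Programs

/-- Started in `σ`, the program `p` halts within `T` steps in a state satisfying `Q`. -/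
def Exec (p : RamProg) (σ : RamState) (T : ℕ) (Q : RamState → Prop) : Prop :=
  ∃ t τ, Runs p σ t τ ∧ t ≤ T ∧ Q τ

@[simp] theorem RamState.setReg_reg (σ : RamState) (r x a : ℕ) :
    (σ.setReg r x).reg a = if a = r then x else σ.reg a := by
  simp [RamState.setReg, Function.update_apply]

@[simp] theorem RamState.setReg_mem (σ : RamState) (r x : ℕ) : (σ.setReg r x).mem = σ.mem := rfl

@[simp] theorem RamState.setMem_reg (σ : RamState) (r x : ℕ) : (σ.setMem r x).reg = σ.reg := rfl

@[simp] theorem RamState.setMem_mem (σ : RamState) (r x a : ℕ) :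
    (σ.setMem r x).mem a = if a = r then x else σ.mem a := by
  simp [RamState.setMem, Function.update_apply]

namespace Exec

variable {p q : RamProg} {σ : RamState} {T T' : ℕ} {Q Q' : RamState → Prop} {r a b c : ℕ}

theorem mono (h : Exec p σ T Q) (hT : T ≤ T') (hQ : ∀ τ, Q τ → Q' τ) : Exec p σ T' Q' := by
  obtain ⟨t, τ, h1, h2, h3⟩ := h
  exact ⟨t, τ, h1, h2.trans hT, hQ τ h3⟩

theorem imp (h : Exec p σ T Q) (hQ : ∀ τ, Q τ → Q' τ) : Exec p σ T Q' := h.mono le_rfl hQ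

theorem le (h : Exec p σ T Q) (hT : T ≤ T') : Exec p σ T' Q := h.mono hT fun _ => id

theorem const (h : Q (σ.setReg r c)) : Exec (.const r c) σ 1 Q := ⟨_, _, .const r c σ, le_rfl, h⟩

theorem move (h : Q (σ.setReg r (σ.reg a))) : Exec (.move r a) σ 1 Q :=
  ⟨_, _, .move r a σ, le_rfl, h⟩

theorem add (h : Q (σ.setReg r (σ.reg a + σ.reg b))) : Exec (.add r a b) σ 1 Q :=
  ⟨_, _, .add r a b σ, le_rfl, h⟩

theorem sub (h : Q (σ.setReg r (σ.reg a - σ.reg b))) : Exec (.sub r a b) σ 1 Q :=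
  ⟨_, _, .sub r a b σ, le_rfl, h⟩

theorem load (h : Q (σ.setReg r (σ.mem (σ.reg a)))) : Exec (.load r a) σ 1 Q :=
  ⟨_, _, .load r a σ, le_rfl, h⟩

theorem store (h : Q (σ.setMem (σ.reg a) (σ.reg b))) : Exec (.store a b) σ 1 Q :=
  ⟨_, _, .store a b σ, le_rfl, h⟩

theorem seq (h : Exec p σ T fun τ => Exec q τ T' Q) : Exec (.seq p q) σ (T + T') Q := by
  obtain ⟨t, τ, h1, h2, t', τ', h3, h4, h5⟩ := h
  exact ⟨_, _, .seq h1 h3, Nat.add_le_add h2 h4, h5⟩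

theorem cond (hp : σ.reg a ≠ 0 → Exec p σ T Q) (hq : σ.reg a = 0 → Exec q σ T Q) :
    Exec (.cond a p q) σ (T + 1) Q := by
  by_cases h : σ.reg a = 0
  · obtain ⟨t, τ, h1, h2, h3⟩ := hq h
    exact ⟨_, _, .condZero h h1, by omega, h3⟩
  · obtain ⟨t, τ, h1, h2, h3⟩ := hp h
    exact ⟨_, _, .condPos h h1, by omega, h3⟩

end Exec

/-- Run `p` with `R[x] = 0, …, R[2] - 1`, where register `3` holds `1`. -/
def forLoop (c x : ℕ) (p : RamProg) : RamProg :=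
  .seq (.move c 2) (.loop c (.seq (.sub x 2 c) (.seq p (.sub c c 3))))

/-- Each round pays for the test, two subtractions and the body; the `2` covers the initial move and
the final test. -/
def forCost (n T : ℕ) : ℕ := n * (T + 3) + 2

/-- `I k` is the invariant after `k` rounds. The counter `c` runs down while `x` runs up, so the
invariant must survive changes of both registers, and the body must leave `c` intact. -/
theorem Exec.forLoop {n c x T : ℕ} {p : RamProg} {σ : RamState} {Q : RamState → Prop}
    (I : ℕ → RamState → Prop) (hcx : c ≠ x)
    (hI : ∀ k τ, I k τ → τ.reg 2 = n ∧ τ.reg 3 = 1)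
    (hIc : ∀ k τ a, I k τ → I k (τ.setReg c a)) (hIx : ∀ k τ a, I k τ → I k (τ.setReg x a))
    (h0 : I 0 σ)
    (hbody : ∀ k < n, ∀ τ, I k τ → τ.reg x = k →
      Exec p τ T fun τ' => I (k + 1) τ' ∧ τ'.reg c = τ.reg c)
    (hQ : ∀ τ, I n τ → Q τ) :
    Exec (forLoop c x p) σ (forCost n T) Q := by
  have hloop : ∀ m k τ, m + k = n → I k τ → τ.reg c = m →
      Exec (.loop c (.seq (.sub x 2 c) (.seq p (.sub c c 3)))) τ (m * (T + 3) + 1) Q := by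
    intro m
    induction m with
    | zero =>
      intro k τ hk hIk hc
      obtain rfl : k = n := by omega
      exact ⟨_, _, .loopStop hc, by omega, hQ τ hIk⟩
    | succ m ih =>
      intro k τ hk hIk hc
      have hb : Exec (.seq (.sub x 2 c) (.seq p (.sub c c 3))) τ (1 + (T + 1))
          fun τ' => I (k + 1) τ' ∧ τ'.reg c = m := by
        refine .seq (.sub (.seq ?_))
        refine (hbody k (by omega) _ (hIx _ _ _ hIk) ?_).imp ?_
        · simp [(hI _ _ hIk).1, hc]; omega
        · rintro τ' ⟨h1, h2⟩
          refine .sub ⟨hIc _ _ _ h1, ?_⟩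
          simp [(hI _ _ h1).2, h2, hcx, hc]
      obtain ⟨t, τ', h1, h2, h3, h4⟩ := hb
      obtain ⟨t', τ'', h5, h6, h7⟩ := ih (k + 1) τ' (by omega) h3 h4
      refine ⟨_, _, .loopStep (by omega) h1 h5, ?_, h7⟩
      rw [Nat.succ_mul]
      omega
  refine (Exec.seq (T' := n * (T + 3) + 1) (.move ?_)).le (by unfold forCost; omega)
  refine hloop n 0 _ (by omega) (hIc _ _ _ h0) ?_
  simp [(hI _ _ h0).1]

/-- Registers below `d` and memory cells below `H` are the same in `σ` and `τ`. -/
def Frame (d H : ℕ) (σ τ : RamState) : Prop :=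
  (∀ r < d, τ.reg r = σ.reg r) ∧ ∀ a < H, τ.mem a = σ.mem a

namespace Frame

variable {d d' H H' r a x : ℕ} {σ τ υ : RamState}

theorem refl (d H : ℕ) (σ : RamState) : Frame d H σ σ := ⟨fun _ _ => rfl, fun _ _ => rfl⟩

theorem trans (h : Frame d H σ τ) (h' : Frame d H τ υ) : Frame d H σ υ :=
  ⟨fun r hr => (h'.1 r hr).trans (h.1 r hr), fun a ha => (h'.2 a ha).trans (h.2 a ha)⟩

theorem mono (h : Frame d H σ τ) (hd : d' ≤ d) (hH : H' ≤ H) : Frame d' H' σ τ :=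
  ⟨fun r hr => h.1 r (by omega), fun a ha => h.2 a (by omega)⟩

theorem setReg (h : Frame d H σ τ) (hr : d ≤ r) : Frame d H σ (τ.setReg r x) :=
  ⟨fun b hb => by rw [RamState.setReg_reg, if_neg (by omega), h.1 b hb], h.2⟩

theorem setMem (h : Frame d H σ τ) (ha : H ≤ a) : Frame d H σ (τ.setMem a x) :=
  ⟨h.1, fun b hb => by rw [RamState.setMem_mem, if_neg (by omega), h.2 b hb]⟩

end Frame

end Programs

/-! ### Polynomially bounded functions -/

section PolynomialBounds

/-- One constant serves as factor and exponent, as in `PolyTimeRealizable`. -/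
def PolyBounded (f : ℕ → ℕ) : Prop := ∃ c, ∀ n, f n ≤ c * (n + 1) ^ c

namespace PolyBounded

variable {f g : ℕ → ℕ}

theorem of_le {c d : ℕ} (h : ∀ n, f n ≤ c * (n + 1) ^ d) : PolyBounded f := by
  refine ⟨c + d, fun n => (h n).trans (Nat.mul_le_mul (by omega) ?_)⟩
  exact Nat.pow_le_pow_right (by omega) (by omega)

theorem const (c : ℕ) : PolyBounded fun _ => c := of_le (c := c) (d := 0) (by simp)

theorem id : PolyBounded fun n => n := of_le (c := 1) (d := 1) (by intro n; simp)

theorem add (hf : PolyBounded f) (hg : PolyBounded g) : PolyBounded fun n => f n + g n := by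
  obtain ⟨c, hc⟩ := hf
  obtain ⟨d, hd⟩ := hg
  refine of_le (c := c + d) (d := c + d) fun n => ?_
  rw [Nat.add_mul]
  refine Nat.add_le_add ((hc n).trans (Nat.mul_le_mul_left _ ?_))
    ((hd n).trans (Nat.mul_le_mul_left _ ?_)) <;>
  exact Nat.pow_le_pow_right (by omega) (by omega)

theorem mul (hf : PolyBounded f) (hg : PolyBounded g) : PolyBounded fun n => f n * g n := by
  obtain ⟨c, hc⟩ := hf
  obtain ⟨d, hd⟩ := hg
  refine of_le (c := c * d) (d := c + d) fun n => (Nat.mul_le_mul (hc n) (hd n)).trans ?_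
  rw [pow_add]
  exact le_of_eq (by ring)

theorem forCost (hf : PolyBounded f) : PolyBounded fun n => forCost n (f n) :=
  ((id.mul (hf.add (const 3))).add (const 2))

/-- Costs are computed in the number of vertices, but the time bound is in the length of the input,
which is at least as large. -/
theorem exists_bound (hf : PolyBounded f) : ∃ c, ∀ n m, n ≤ m → f n ≤ c * (m + 1) ^ c := by
  obtain ⟨c, hc⟩ := hf
  exact ⟨c, fun n m h => (hc n).trans
    (Nat.mul_le_mul_left _ (Nat.pow_le_pow_left (by omega) _))⟩

end PolyBounded

end PolynomialBounds

/-! ### A query language for graphs -/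

section Formulas

def scons {α : Type} (x : α) (e : ℕ → α) : ℕ → α
  | 0 => x
  | i + 1 => e i

/-- Formulas on graphs with vertex set `Fin n`; variables are de Bruijn indices. The formula
`reach i j φ` says that some walk from `i` to `j` has only vertices satisfying `φ`. -/
inductive Fml where
  | adj (i j : ℕ)
  | eq (i j : ℕ)
  | lt (i j : ℕ)
  | neg (φ : Fml)
  | and (φ ψ : Fml)
  | ex (φ : Fml)
  | reach (i j : ℕ) (φ : Fml)

def Sat {n : ℕ} (G : SimpleGraph (Fin n)) : Fml → (ℕ → Fin n) → Prop
  | .adj i j, e => G.Adj (e i) (e j)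
  | .eq i j, e => e i = e j
  | .lt i j, e => e i < e j
  | .neg φ, e => ¬ Sat G φ e
  | .and φ ψ, e => Sat G φ e ∧ Sat G ψ e
  | .ex φ, e => ∃ x, Sat G φ (scons x e)
  | .reach i j φ, e => ReachIn G {x | Sat G φ (scons x e)} (e i) (e j)

/-- `R[d] := 1` if the vertices in the registers `a` and `b` are adjacent, and `0` otherwise. -/
def adjProg (a b d : ℕ) : RamProg :=
  .seq (.move d 4) (.seq (forLoop (d + 1) (d + 2) (.add d d a)) (.seq (.add d d b) (.load d d)))

/-- One step of the search from vertex `R[d + 5]` to vertex `R[d + 7]`. -/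
def reachStep (h d : ℕ) (p : RamProg) : RamProg :=
  .seq (adjProg (d + 5) (d + 7) (d + 9))
    (.cond (d + 9)
      (.seq p (.cond (d + 9) (.seq (.add (d + 8) h (d + 7)) (.store (d + 8) (d + 9)))
        (.const (d + 9) 0)))
      (.const (d + 9) 0))

/-- The `n` cells from `R[h]` on mark the vertices found so far, and `R[d + 1]` is where the work
space of the subformula begins. `p` tests the start vertex, `q` the vertex in `R[d + 7]`, both into
`R[d + 9]`. After that, `n` rounds follow all edges out of marked vertices. -/
def reachProg (a b h d : ℕ) (p q : RamProg) : RamProg :=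
  .seq (.add (d + 1) h 2) (.seq
    (forLoop (d + 4) (d + 5)
      (.seq (.add (d + 8) h (d + 5)) (.seq (.const (d + 9) 0) (.store (d + 8) (d + 9))))) (.seq
    p (.seq
    (.add (d + 8) h a) (.seq
    (.store (d + 8) (d + 9)) (.seq
    (forLoop (d + 2) (d + 3) (forLoop (d + 4) (d + 5)
      (.seq (.add (d + 8) h (d + 5)) (.seq (.load (d + 8) (d + 8))
        (.cond (d + 8) (forLoop (d + 6) (d + 7) (reachStep h d q)) (.const (d + 9) 0)))))) (.seq
    (.add d h b)
    (.load d d)))))))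

/-- Evaluates a formula into register `d`. The variable `i` is in register `ρ i`, the registers
from `d` on and the memory cells from `R[h]` on are used as work space. -/
def Fml.prog : Fml → (ℕ → ℕ) → ℕ → ℕ → RamProg
  | .adj i j, ρ, _, d => adjProg (ρ i) (ρ j) d
  | .eq i j, ρ, _, d => .seq (.sub d (ρ i) (ρ j)) (.seq (.sub (d + 1) (ρ j) (ρ i))
      (.seq (.add d d (d + 1)) (.cond d (.const d 0) (.const d 1))))
  | .lt i j, ρ, _, d => .seq (.sub d (ρ j) (ρ i)) (.cond d (.const d 1) (.const d 0))
  | .neg φ, ρ, h, d => .seq (φ.prog ρ h d) (.cond d (.const d 0) (.const d 1))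
  | .and φ ψ, ρ, h, d => .seq (φ.prog ρ h d) (.cond d (ψ.prog ρ h d) (.const d 0))
  | .ex φ, ρ, h, d => .seq (.const d 0) (forLoop (d + 1) (d + 2)
      (.seq (φ.prog (scons (d + 2) ρ) h (d + 3))
        (.cond (d + 3) (.const d 1) (.const (d + 3) 0))))
  | .reach i j φ, ρ, h, d => reachProg (ρ i) (ρ j) h d (φ.prog (scons (ρ i) ρ) (d + 1) (d + 9))
      (φ.prog (scons (d + 7) ρ) (d + 1) (d + 9))

def reachCost (n T : ℕ) : ℕ :=
  8 + forCost n 3 + T + forCost n (forCost n (forCost n (forCost n 1 + T + 8) + 3))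

def Fml.cost : Fml → ℕ → ℕ
  | .adj _ _, n => forCost n 1 + 3
  | .eq _ _, _ => 5
  | .lt _ _, _ => 3
  | .neg φ, n => φ.cost n + 2
  | .and φ ψ, n => φ.cost n + ψ.cost n + 2
  | .ex φ, n => 1 + forCost n (φ.cost n + 2)
  | .reach _ _ φ, n => reachCost n (φ.cost n)

theorem Fml.polyBounded_cost (φ : Fml) : PolyBounded φ.cost := by
  induction φ with
  | adj => exact (PolyBounded.const 1).forCost.add (.const 3)
  | eq => exact .const 5
  | lt => exact .const 3
  | neg φ ih => exact ih.add (.const 2)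
  | and φ ψ ih1 ih2 => exact (ih1.add ih2).add (.const 2)
  | ex φ ih => exact (PolyBounded.const 1).add (ih.add (.const 2)).forCost
  | reach i j φ ih =>
    refine (((PolyBounded.const 8).add (PolyBounded.const 3).forCost).add ih).add ?_
    exact ((((PolyBounded.const 1).forCost.add ih).add (.const 8)).forCost.add
      (.const 3)).forCost.forCost

/-- The state is ready to evaluate a formula at `e` with variables `ρ` and work space from
register `d` and memory cell `R[h]` on. -/
structure Ready {n : ℕ} (G : SimpleGraph (Fin n)) (hdr : ℕ) (e : ℕ → Fin n) (ρ : ℕ → ℕ) (h d : ℕ)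
    (σ : RamState) : Prop where
  size : σ.reg 2 = n
  one : σ.reg 3 = 1
  header : σ.reg 4 = hdr
  adj : ∀ i j : Fin n, (G.Adj i j ∧ σ.mem (hdr + i * n + j) = 1) ∨
    (¬ G.Adj i j ∧ σ.mem (hdr + i * n + j) = 0)
  heap : hdr + n * n ≤ σ.reg h
  five_le : 5 ≤ d
  heap_lt : h < d
  var_lt : ∀ i, ρ i < d
  var : ∀ i, σ.reg (ρ i) = e i

namespace Ready

variable {n : ℕ} {G : SimpleGraph (Fin n)} {hdr : ℕ} {e : ℕ → Fin n} {ρ : ℕ → ℕ} {h d : ℕ}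
  {σ τ : RamState}

theorem address_lt (i j : Fin n) : (i : ℕ) * n + j < n * n := by
  have h1 : (i : ℕ) * n + n ≤ n * n := by
    rw [← Nat.succ_mul]; exact Nat.mul_le_mul_right n i.2
  omega

theorem frame (hr : Ready G hdr e ρ h d σ) {H : ℕ} (hH : hdr + n * n ≤ H) (hf : Frame d H σ τ) :
    Ready G hdr e ρ h d τ := by
  have h5 := hr.five_le
  refine ⟨?_, ?_, ?_, fun i j => ?_, ?_, h5, hr.heap_lt, hr.var_lt, fun i => ?_⟩
  · rw [hf.1 2 (by omega), hr.size]
  · rw [hf.1 3 (by omega), hr.one]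
  · rw [hf.1 4 (by omega), hr.header]
  · have := address_lt i j
    rw [hf.2 _ (by omega)]
    exact hr.adj i j
  · rw [hf.1 h hr.heap_lt]
    exact hr.heap
  · rw [hf.1 _ (hr.var_lt i), hr.var]

theorem bind (hr : Ready G hdr e ρ h d σ) {h' d' r : ℕ} {x : Fin n} (hd : d ≤ d') (hrd : r < d')
    (hx : σ.reg r = x) (hh : h' < d') (hle : σ.reg h ≤ σ.reg h') :
    Ready G hdr (scons x e) (scons r ρ) h' d' σ := by
  refine ⟨hr.size, hr.one, hr.header, hr.adj, hr.heap.trans hle, hr.five_le.trans hd, hh, ?_, ?_⟩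
  · rintro (_ | i)
    · exact hrd
    · exact (hr.var_lt i).trans_le hd
  · rintro (_ | i)
    · exact hx
    · exact hr.var i

end Ready

/-- Afterwards register `d` holds the truth value of `P`. -/
def Decides (d H : ℕ) (σ : RamState) (P : Prop) (τ : RamState) : Prop :=
  Frame d H σ τ ∧ ((P ∧ τ.reg d = 1) ∨ (¬ P ∧ τ.reg d = 0))

/-! ### Correctness of the compiled formulas -/

section Correctness

variable {n : ℕ} {G : SimpleGraph (Fin n)} {hdr : ℕ}

/-- The row offset is a product, obtained by `n` additions because the machine cannot multiply. -/
theorem exec_adjProg {e : ℕ → Fin n} {ρ : ℕ → ℕ} {h d a b H : ℕ}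
    {σ : RamState} (hr : Ready G hdr e ρ h d σ) {x y : Fin n} (ha : a < d) (hb : b < d)
    (hx : σ.reg a = x) (hy : σ.reg b = y) :
    Exec (adjProg a b d) σ (forCost n 1 + 3) (Decides d H σ (G.Adj x y)) := by
  have h5 := hr.five_le
  refine (Exec.seq (T := 1) (T' := forCost n 1 + 2) (.move (.seq (T' := 2) ?_))).le (by omega)
  refine Exec.forLoop (n := n) (fun k τ => Frame d H σ τ ∧ τ.mem = σ.mem ∧ τ.reg d = hdr + k * x)
    (by omega) ?_ ?_ ?_ ?_ ?_ ?_
  · rintro k τ ⟨hf, -⟩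
    exact ⟨by rw [hf.1 2 (by omega), hr.size], by rw [hf.1 3 (by omega), hr.one]⟩
  · rintro k τ c ⟨hf, hm, hd⟩
    exact ⟨hf.setReg (by omega), hm, by simpa using hd⟩
  · rintro k τ c ⟨hf, hm, hd⟩
    exact ⟨hf.setReg (by omega), hm, by simpa using hd⟩
  · exact ⟨(Frame.refl _ _ _).setReg le_rfl, rfl, by simp [hr.header]⟩
  · rintro k hk τ ⟨hf, hm, hd⟩ -
    refine .add ⟨⟨hf.setReg le_rfl, hm, ?_⟩, by simp⟩
    simp [hd, hf.1 a ha, hx]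
    ring
  · rintro τ ⟨hf, hm, hd⟩
    refine (Exec.seq (T := 1) (T' := 1) (.add (.load ⟨(hf.setReg le_rfl).setReg le_rfl, ?_⟩)))
    have : hdr + n * x + y = hdr + x * n + y := by ring
    simpa [hd, hm, hf.1 b hb, hy, this] using hr.adj x y

/-- The cells from `H` on hold the characteristic function of `M`. -/
def Marks {n : ℕ} (H : ℕ) (M : Set (Fin n)) (σ : RamState) : Prop :=
  ∀ x : Fin n, (x ∈ M ∧ σ.mem (H + x) = 1) ∨ (x ∉ M ∧ σ.mem (H + x) = 0)

theorem Marks.of_mem_eq {H : ℕ} {M : Set (Fin n)} {σ τ : RamState} (h : Marks H M σ)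
    (hm : ∀ x : Fin n, τ.mem (H + x) = σ.mem (H + x)) : Marks H M τ := fun x => by
  rw [hm]; exact h x

/-- The vertices reachable from `x` by a walk of length at most `k` in `S`. -/
def reachLayer (G : SimpleGraph (Fin n)) (S : Set (Fin n)) (x : Fin n) : ℕ → Set (Fin n)
  | 0 => {y | y = x ∧ x ∈ S}
  | k + 1 => reachLayer G S x k ∪ {b | b ∈ S ∧ ∃ a ∈ reachLayer G S x k, G.Adj a b}

/-- An induced path repeats no vertex and so has fewer than `n` edges; hence `n` rounds suffice. -/
theorem ReachIn.mem_reachLayer {S : Set (Fin n)} {x y : Fin n} (h : ReachIn G S x y) :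
    y ∈ reachLayer G S x n := by
  obtain ⟨l, f, h0, hl, hS, hinj, hadj⟩ := h.exists_induced_path
  have hmem : ∀ i ≤ l, f i ∈ reachLayer G S x i := by
    intro i
    induction i with
    | zero => exact fun _ => ⟨h0, h.left_mem⟩
    | succ i ih =>
      exact fun hi => Or.inr ⟨hS _ hi, f i, ih (by omega),
        (hadj i (by omega) (i + 1) hi).2 (Or.inl rfl)⟩
  have hmono : ∀ i j, i ≤ j → reachLayer G S x i ⊆ reachLayer G S x j := by
    intro i j hij
    induction hij with
    | refl => exact subset_rfl
    | step _ ih => exact ih.trans Set.subset_union_left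
  have hcard : l + 1 ≤ n := by
    have := Fintype.card_le_of_injective (fun i : Fin (l + 1) => f i)
      fun i j hij => Fin.ext (hinj i (by omega) j (by omega) hij)
    simpa using this
  exact hl ▸ hmono l n (by omega) (hmem l le_rfl)

/-- The invariant of the search: everything marked is reachable. -/
structure Searching (G : SimpleGraph (Fin n)) (S : Set (Fin n)) (s : Fin n) (d h H : ℕ)
    (σ : RamState) (M : Set (Fin n)) (τ : RamState) : Prop where
  frame : Frame d H σ τ
  heap : τ.reg (d + 1) = H + n
  marks : Marks H M τ
  sound : ∀ x ∈ M, ReachIn G S s x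

theorem Searching.setReg {S : Set (Fin n)} {s : Fin n} {d h H r a : ℕ} {σ τ : RamState}
    {M : Set (Fin n)} (hs : Searching G S s d h H σ M τ) (hr : d + 2 ≤ r) :
    Searching G S s d h H σ M (τ.setReg r a) :=
  ⟨hs.frame.setReg (by omega), by
    rw [RamState.setReg_reg, if_neg (by omega), hs.heap], hs.marks, hs.sound⟩

theorem Searching.of_frame {S : Set (Fin n)} {s : Fin n} {d h H d' : ℕ} {σ τ υ : RamState}
    {M : Set (Fin n)} (hs : Searching G S s d h H σ M τ) (hf : Frame d' (H + n) τ υ)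
    (hd : d + 2 ≤ d') : Searching G S s d h H σ M υ :=
  ⟨hs.frame.trans (hf.mono (by omega) (by omega)), by rw [hf.1 _ (by omega), hs.heap],
    hs.marks.of_mem_eq fun x => hf.2 _ (by omega), hs.sound⟩

variable {e : ℕ → Fin n} {ρ : ℕ → ℕ} {h d H : ℕ} {σ : RamState}

theorem exec_reachStep {S : Set (Fin n)} {s : Fin n} {T : ℕ} {q : RamProg}
    (hr : Ready G hdr e ρ h d σ) (hH : σ.reg h = H)
    (hq : ∀ (x : Fin n) τ, Frame d H σ τ → τ.reg (d + 1) = H + n → τ.reg (d + 7) = x →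
      Exec q τ T (Decides (d + 9) (H + n) τ (x ∈ S)))
    {M : Set (Fin n)} {τ : RamState} (hs : Searching G S s d h H σ M τ) {a b : Fin n}
    (ha : τ.reg (d + 5) = a) (hb : τ.reg (d + 7) = b) (haM : a ∈ M) :
    Exec (reachStep h d q) τ (forCost n 1 + T + 8) fun τ' =>
      (∃ M', M ⊆ M' ∧ (b ∈ S → G.Adj a b → b ∈ M') ∧ Searching G S s d h H σ M' τ') ∧
        ∀ r < d + 8, τ'.reg r = τ.reg r := by
  have hhd := hr.heap_lt
  have hHle : hdr + n * n ≤ H := hH ▸ hr.heap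
  have hready : Ready G hdr e ρ h d τ := hr.frame hHle hs.frame
  have hready' : Ready G hdr (scons b e) (scons (d + 7) ρ) h (d + 9) τ :=
    hready.bind (by omega) (by omega) hb (by omega) le_rfl
  refine (Exec.seq (T := forCost n 1 + 3) (T' := T + 5) ?_).le (by omega)
  refine (exec_adjProg (H := H + n) hready' (x := a) (y := b) (by omega) (by omega) ha hb).imp ?_
  rintro τ₁ ⟨hf₁, hadj⟩
  have hs₁ := hs.of_frame hf₁ (by omega)
  refine (Exec.cond (T := T + 4) (fun h1 => ?_) (fun h1 => ?_))
  · have hab : G.Adj a b := by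
      rcases hadj with h | h
      · exact h.1
      · exact absurd h.2 h1
    refine (Exec.seq (T := T) (T' := 4) ?_)
    refine (hq b τ₁ hs₁.frame hs₁.heap (by rw [hf₁.1 _ (by omega), hb])).imp ?_
    rintro τ₂ ⟨hf₂, hbS⟩
    have hs₂ := hs₁.of_frame hf₂ (by omega)
    have hreg : ∀ r < d + 8, τ₂.reg r = τ.reg r := fun r hr => by
      rw [hf₂.1 r (by omega), hf₁.1 r (by omega)]
    have hh₂ : τ₂.reg h = H := by rw [hs₂.frame.1 h hhd, hH]
    refine (Exec.cond (T := 2) (fun h2 => ?_) (fun h2 => ?_)).le (by omega)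
    · have hbS' : b ∈ S ∧ τ₂.reg (d + 9) = 1 := by
        rcases hbS with h | h
        · exact h
        · exact absurd h.2 h2
      refine (Exec.seq (T := 1) (T' := 1) (.add (.store ⟨⟨M ∪ {b}, Set.subset_union_left,
        fun _ _ => Or.inr rfl, ?_⟩, fun r hr => ?_⟩)))
      · have hb₂ : τ₂.reg (d + 7) = b := by rw [hreg _ (by omega), hb]
        refine ⟨?_, ?_, fun x => ?_, ?_⟩
        · refine (hs₂.frame.setReg (by omega)).setMem ?_
          simp [hh₂]
        · simp [hs₂.heap]
        · have hm := hs₂.marks x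
          by_cases hxb : x = b
          · subst hxb
            exact Or.inl ⟨Or.inr rfl, by simp [hh₂, hb₂, hbS'.2]⟩
          · have hne : (x : ℕ) ≠ b := fun h => hxb (Fin.ext h)
            simpa [hh₂, hb₂, hne, hxb] using hm
        · rintro x (hx | rfl)
          · exact hs₂.sound x hx
          · exact (hs₂.sound a haM).tail hab hbS'.1
      · simp only [RamState.setMem_reg, RamState.setReg_reg]
        rw [if_neg (by omega), hreg r hr]
    · have hbS' : b ∉ S := by
        rcases hbS with h | h
        · exact absurd (h.2.symm.trans h2) (by simp)
        · exact h.1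
      refine (Exec.const ⟨⟨M, subset_rfl, fun h => absurd h hbS', hs₂.setReg (by omega)⟩,
        fun r hr => ?_⟩).le (by omega)
      rw [RamState.setReg_reg, if_neg (by omega), hreg r hr]
  · have hab : ¬ G.Adj a b := by
      rcases hadj with h | h
      · exact absurd (h.2.symm.trans h1) (by simp)
      · exact h.1
    refine (Exec.const ⟨⟨M, subset_rfl, fun _ h => absurd h hab, hs₁.setReg (by omega)⟩,
      fun r hr => ?_⟩).le (by omega)
    rw [RamState.setReg_reg, if_neg (by omega), hf₁.1 r (by omega)]

theorem exec_reachRow {S : Set (Fin n)} {s : Fin n} {T : ℕ} {q : RamProg}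
    (hr : Ready G hdr e ρ h d σ) (hH : σ.reg h = H)
    (hq : ∀ (x : Fin n) τ, Frame d H σ τ → τ.reg (d + 1) = H + n → τ.reg (d + 7) = x →
      Exec q τ T (Decides (d + 9) (H + n) τ (x ∈ S)))
    {M : Set (Fin n)} {τ : RamState} (hs : Searching G S s d h H σ M τ) {a : Fin n}
    (ha : τ.reg (d + 5) = a) (haM : a ∈ M) :
    Exec (forLoop (d + 6) (d + 7) (reachStep h d q)) τ (forCost n (forCost n 1 + T + 8)) fun τ' =>
      (∃ M', M ⊆ M' ∧ (∀ b ∈ S, G.Adj a b → b ∈ M') ∧ Searching G S s d h H σ M' τ') ∧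
        ∀ r < d + 6, τ'.reg r = τ.reg r := by
  have h5 := hr.five_le
  refine Exec.forLoop (n := n) (fun k τ' =>
      (∃ M', M ⊆ M' ∧ (∀ b ∈ S, b.1 < k → G.Adj a b → b ∈ M') ∧ Searching G S s d h H σ M' τ') ∧
        ∀ r < d + 6, τ'.reg r = τ.reg r) (by omega) ?_ ?_ ?_ ?_ ?_ ?_
  · rintro k τ' ⟨⟨M', -, -, hs'⟩, -⟩
    exact ⟨by rw [hs'.frame.1 2 (by omega), hr.size], by rw [hs'.frame.1 3 (by omega), hr.one]⟩
  · rintro k τ' c ⟨⟨M', h1, h2, hs'⟩, h3⟩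
    refine ⟨⟨M', h1, h2, hs'.setReg (by omega)⟩, fun r hr => ?_⟩
    rw [RamState.setReg_reg, if_neg (by omega), h3 r hr]
  · rintro k τ' c ⟨⟨M', h1, h2, hs'⟩, h3⟩
    refine ⟨⟨M', h1, h2, hs'.setReg (by omega)⟩, fun r hr => ?_⟩
    rw [RamState.setReg_reg, if_neg (by omega), h3 r hr]
  · exact ⟨⟨M, subset_rfl, fun b _ hb => absurd hb (Nat.not_lt_zero _), hs⟩, fun _ _ => rfl⟩
  · rintro k hk τ' ⟨⟨M', h1, h2, hs'⟩, h3⟩ hx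
    refine (exec_reachStep hr hH hq hs' (a := a) (b := ⟨k, hk⟩) (by rw [h3 _ (by omega), ha]) hx
      (h1 haM)).imp ?_
    rintro τ'' ⟨⟨M'', h4, h5, hs''⟩, h6⟩
    refine ⟨⟨⟨M'', h1.trans h4, fun b hb hbk hab => ?_, hs''⟩, fun r hr => ?_⟩, h6 _ (by omega)⟩
    · rcases Nat.lt_succ_iff_lt_or_eq.1 hbk with hlt | heq
      · exact h4 (h2 b hb hlt hab)
      · obtain rfl : b = ⟨k, hk⟩ := Fin.ext heq
        exact h5 hb hab
    · rw [h6 r (by omega), h3 r hr]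
  · rintro τ' ⟨⟨M', h1, h2, hs'⟩, h3⟩
    exact ⟨⟨M', h1, fun b hb => h2 b hb b.2, hs'⟩, h3⟩

/-- Marks are updated in place, so one round may advance by more than one layer. Only a lower bound
for the new marks is needed; the upper bound is the field `sound`. -/
theorem exec_reachRound {S : Set (Fin n)} {s : Fin n} {T : ℕ} {q : RamProg}
    (hr : Ready G hdr e ρ h d σ) (hH : σ.reg h = H)
    (hq : ∀ (x : Fin n) τ, Frame d H σ τ → τ.reg (d + 1) = H + n → τ.reg (d + 7) = x →
      Exec q τ T (Decides (d + 9) (H + n) τ (x ∈ S)))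
    {M : Set (Fin n)} {τ : RamState} (hs : Searching G S s d h H σ M τ) :
    Exec (forLoop (d + 4) (d + 5) (.seq (.add (d + 8) h (d + 5)) (.seq (.load (d + 8) (d + 8))
        (.cond (d + 8) (forLoop (d + 6) (d + 7) (reachStep h d q)) (.const (d + 9) 0))))) τ
      (forCost n (forCost n (forCost n 1 + T + 8) + 3)) fun τ' =>
      (∃ M', M ⊆ M' ∧ (∀ a ∈ M, ∀ b ∈ S, G.Adj a b → b ∈ M') ∧
        Searching G S s d h H σ M' τ') ∧ ∀ r < d + 4, τ'.reg r = τ.reg r := by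
  have hd5 := hr.five_le
  have hhd := hr.heap_lt
  refine Exec.forLoop (n := n) (fun k τ' =>
      (∃ M', M ⊆ M' ∧ (∀ a ∈ M, a.1 < k → ∀ b ∈ S, G.Adj a b → b ∈ M') ∧
        Searching G S s d h H σ M' τ') ∧
        ∀ r < d + 4, τ'.reg r = τ.reg r) (by omega) ?_ ?_ ?_ ?_ ?_ ?_
  · rintro k τ' ⟨⟨M', -, -, hs'⟩, -⟩
    exact ⟨by rw [hs'.frame.1 2 (by omega), hr.size], by rw [hs'.frame.1 3 (by omega), hr.one]⟩
  · rintro k τ' c ⟨⟨M', h1, h2, hs'⟩, h3⟩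
    refine ⟨⟨M', h1, h2, hs'.setReg (by omega)⟩, fun r hr => ?_⟩
    rw [RamState.setReg_reg, if_neg (by omega), h3 r hr]
  · rintro k τ' c ⟨⟨M', h1, h2, hs'⟩, h3⟩
    refine ⟨⟨M', h1, h2, hs'.setReg (by omega)⟩, fun r hr => ?_⟩
    rw [RamState.setReg_reg, if_neg (by omega), h3 r hr]
  · exact ⟨⟨M, subset_rfl, fun b _ hb => absurd hb (Nat.not_lt_zero _), hs⟩, fun _ _ => rfl⟩
  · rintro k hk τ' ⟨⟨M', h1, h2, hs'⟩, h3⟩ hx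
    have hH' : τ'.reg h = H := by rw [hs'.frame.1 h hhd, hH]
    refine (Exec.seq (T := 1) (.add (.seq (T := 1) (.load (.cond
      (T := forCost n (forCost n 1 + T + 8)) ?_ ?_))))).le (by omega)
    · intro hmk
      have hkM : (⟨k, hk⟩ : Fin n) ∈ M' := by
        rcases hs'.marks ⟨k, hk⟩ with h | h
        · exact h.1
        · simp [hH', hx, h.2] at hmk
      refine (exec_reachRow hr hH hq ((hs'.setReg (r := d + 8) (by omega)).setReg
        (r := d + 8) (by omega)) (a := ⟨k, hk⟩) (by simp [hx]) hkM).imp ?_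
      rintro τ'' ⟨⟨M'', h4, h5, hs''⟩, h6⟩
      refine ⟨⟨⟨M'', h1.trans h4, fun a ha hak => ?_, hs''⟩, fun r hr => ?_⟩, ?_⟩
      · rcases Nat.lt_succ_iff_lt_or_eq.1 hak with hlt | heq
        · exact fun b hb hab => h4 (h2 a ha hlt b hb hab)
        · obtain rfl : a = ⟨k, hk⟩ := Fin.ext heq
          exact h5
      · rw [h6 r (by omega), RamState.setReg_reg, if_neg (by omega), RamState.setReg_reg,
          if_neg (by omega), h3 r hr]
      · rw [h6 _ (by omega), RamState.setReg_reg, if_neg (by omega), RamState.setReg_reg,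
          if_neg (by omega)]
    · intro hmk
      have hkM : (⟨k, hk⟩ : Fin n) ∉ M' := by
        rcases hs'.marks ⟨k, hk⟩ with h | h
        · simp [hH', hx, h.2] at hmk
        · exact h.1
      refine (Exec.const ⟨⟨⟨M', h1, fun a ha hak => ?_, ((hs'.setReg (by omega)).setReg
        (by omega)).setReg (by omega)⟩, fun r hr => ?_⟩, by simp⟩).le (by unfold forCost; omega)
      · rcases Nat.lt_succ_iff_lt_or_eq.1 hak with hlt | heq
        · exact h2 a ha hlt
        · obtain rfl : a = ⟨k, hk⟩ := Fin.ext heq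
          exact absurd (h1 ha) hkM
      · rw [RamState.setReg_reg, if_neg (by omega), RamState.setReg_reg, if_neg (by omega),
          RamState.setReg_reg, if_neg (by omega), h3 r hr]
  · rintro τ' ⟨⟨M', h1, h2, hs'⟩, h3⟩
    exact ⟨⟨M', h1, fun a ha => h2 a ha a.2, hs'⟩, h3⟩

theorem exec_reachProg {S : Set (Fin n)} {s t : Fin n} {T a b : ℕ} {p q : RamProg}
    (hr : Ready G hdr e ρ h d σ) (hH : σ.reg h = H) (ha : a < d) (hb : b < d)
    (hs : σ.reg a = s) (ht : σ.reg b = t)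
    (hp : ∀ τ, Frame d H σ τ → τ.reg (d + 1) = H + n →
      Exec p τ T (Decides (d + 9) (H + n) τ (s ∈ S)))
    (hq : ∀ (x : Fin n) τ, Frame d H σ τ → τ.reg (d + 1) = H + n → τ.reg (d + 7) = x →
      Exec q τ T (Decides (d + 9) (H + n) τ (x ∈ S))) :
    Exec (reachProg a b h d p q) σ (reachCost n T) (Decides d H σ (ReachIn G S s t)) := by
  have hd5 := hr.five_le
  have hhd := hr.heap_lt
  refine (Exec.seq (T := 1) (T' := forCost n 3 + T +
    forCost n (forCost n (forCost n (forCost n 1 + T + 8) + 3)) + 4) (.add ?_)).le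
    (by unfold reachCost; omega)
  refine (Exec.seq (T := forCost n 3) (T' := T +
    forCost n (forCost n (forCost n (forCost n 1 + T + 8) + 3)) + 4) ?_).le (by omega)
  refine Exec.forLoop (n := n) (fun k τ => Frame d H σ τ ∧ τ.reg (d + 1) = H + n ∧
    ∀ x < k, τ.mem (H + x) = 0) (by omega) ?_ ?_ ?_ ?_ ?_ ?_
  · rintro k τ ⟨hf, -⟩
    exact ⟨by rw [hf.1 2 (by omega), hr.size], by rw [hf.1 3 (by omega), hr.one]⟩
  · rintro k τ c ⟨hf, h1, h2⟩
    exact ⟨hf.setReg (by omega), by simp [h1], h2⟩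
  · rintro k τ c ⟨hf, h1, h2⟩
    exact ⟨hf.setReg (by omega), by simp [h1], h2⟩
  · exact ⟨(Frame.refl _ _ _).setReg (by omega), by simp [hH, hr.size], by simp⟩
  · rintro k hk τ ⟨hf, h1, h2⟩ hx
    have hH' : τ.reg h = H := by rw [hf.1 h hhd, hH]
    refine Exec.seq (T := 1) (T' := 2) (.add (.seq (T := 1) (T' := 1) (.const (.store
      ⟨⟨((hf.setReg (by omega)).setReg (by omega)).setMem ?_, by simp [h1], fun x hxk => ?_⟩,
        by simp⟩))))
    · simp [hH', hx]
    · simp only [RamState.setMem_mem, RamState.setReg_mem, RamState.setReg_reg, hH', hx]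
      by_cases hxk' : x = k
      · simp [hxk']
      · simp [hxk', h2 x (by omega)]
  rintro τ ⟨hf, h1, h2⟩
  refine (Exec.seq (T := T) (T' :=
    forCost n (forCost n (forCost n (forCost n 1 + T + 8) + 3)) + 4) ?_).le (by omega)
  refine (hp τ hf h1).imp ?_
  rintro τ₁ ⟨hf₁, hsS⟩
  have hh₁ : τ₁.reg h = H := by rw [hf₁.1 h (by omega), hf.1 h hhd, hH]
  have ha₁ : τ₁.reg a = s := by rw [hf₁.1 a (by omega), hf.1 a ha, hs]
  refine (Exec.seq (T := 1) (.add (.seq (T := 1)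
    (T' := forCost n (forCost n (forCost n (forCost n 1 + T + 8) + 3)) + 2)
    (.store (.seq (T' := 2) ?_))))).le (by omega)
  refine Exec.forLoop (n := n) (fun k τ' => ∃ M, reachLayer G S s k ⊆ M ∧
    Searching G S s d h H σ M τ') (by omega) ?_ ?_ ?_ ?_ ?_ ?_
  · rintro k τ' ⟨M', -, hs'⟩
    exact ⟨by rw [hs'.frame.1 2 (by omega), hr.size], by rw [hs'.frame.1 3 (by omega), hr.one]⟩
  · rintro k τ' c ⟨M', h1, hs'⟩
    exact ⟨M', h1, hs'.setReg (by omega)⟩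
  · rintro k τ' c ⟨M', h1, hs'⟩
    exact ⟨M', h1, hs'.setReg (by omega)⟩
  · refine ⟨{y | y = s ∧ s ∈ S}, subset_rfl, ?_, ?_, fun x => ?_, ?_⟩
    · refine (((hf.trans (hf₁.mono (by omega) (by omega))).setReg (by omega)).setMem ?_)
      simp [hh₁]
    · simp [hf₁.1 (d + 1) (by omega), h1]
    · simp only [RamState.setMem_mem, RamState.setReg_reg, RamState.setReg_mem, hh₁, ha₁]
      by_cases hxs : x = s
      · subst hxs
        simpa using hsS
      · have hne : (x : ℕ) ≠ s := fun h => hxs (Fin.ext h)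
        simp [hxs, hne, hf₁.2 (H + x) (by omega), h2 x x.2]
    · rintro x ⟨rfl, hx⟩
      exact .refl hx
  · rintro k hk τ' ⟨M', h1, hs'⟩ -
    refine (exec_reachRound hr hH hq hs').imp ?_
    rintro τ'' ⟨⟨M'', h3, h4, hs''⟩, h5⟩
    refine ⟨⟨M'', ?_, hs''⟩, h5 _ (by omega)⟩
    rintro b (hb | ⟨hb, a, ha, hab⟩)
    · exact h3 (h1 hb)
    · exact h4 a (h1 ha) b hb hab
  · rintro τ' ⟨M', h1, hs'⟩
    have hh' : τ'.reg h = H := by rw [hs'.frame.1 h hhd, hH]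
    have hb' : τ'.reg b = t := by rw [hs'.frame.1 b hb, ht]
    refine Exec.seq (T := 1) (T' := 1) (.add (.load ⟨(hs'.frame.setReg le_rfl).setReg le_rfl, ?_⟩))
    simp only [RamState.setReg_reg, if_true, RamState.setReg_mem, hh', hb']
    rcases hs'.marks t with h | h
    · exact Or.inl ⟨hs'.sound t h.1, h.2⟩
    · exact Or.inr ⟨fun hr => h.1 (h1 hr.mem_reachLayer), h.2⟩

/-- Structural induction: a subformula works above all registers and memory cells that its parent
still needs, and `Frame` records that these are preserved. -/
theorem Fml.exec_prog (φ : Fml) {e : ℕ → Fin n} {ρ : ℕ → ℕ} {h d H : ℕ} {σ : RamState}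
    (hr : Ready G hdr e ρ h d σ) (hH : σ.reg h = H) :
    Exec (φ.prog ρ h d) σ (φ.cost n) (Decides d H σ (Sat G φ e)) := by
  induction φ generalizing e ρ h d H σ with
  | adj i j => exact exec_adjProg hr (hr.var_lt i) (hr.var_lt j) (hr.var i) (hr.var j)
  | eq i j =>
    have hi := hr.var_lt i
    have hj := hr.var_lt j
    -- With truncated subtraction, both differences vanish exactly when the two numbers are equal.
    refine Exec.seq (T := 1) (T' := 4) (.sub (.seq (T := 1) (T' := 3) (.sub (.seq (T := 1)
      (T' := 2) (.add (.cond (T := 1) (fun h => .const ⟨?_, ?_⟩) fun h => .const ⟨?_, ?_⟩))))))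
    · exact (((((Frame.refl _ _ _).setReg le_rfl).setReg (by omega)).setReg le_rfl).setReg le_rfl)
    · simp [hr.var, hi.ne, hj.ne, Nat.sub_eq_zero_iff_le] at h
      refine Or.inr ⟨fun heq : e i = e j => ?_, by simp⟩
      rw [heq] at h
      omega
    · exact (((((Frame.refl _ _ _).setReg le_rfl).setReg (by omega)).setReg le_rfl).setReg le_rfl)
    · simp [hr.var, hi.ne, hj.ne, Nat.sub_eq_zero_iff_le] at h
      exact Or.inl ⟨Fin.ext (by omega), by simp⟩
  | lt i j =>
    refine Exec.seq (T := 1) (T' := 2) (.sub (.cond (T := 1) (fun h => .const ⟨?_, ?_⟩)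
      fun h => .const ⟨?_, ?_⟩))
    · exact ((Frame.refl _ _ _).setReg le_rfl).setReg le_rfl
    · simp [hr.var] at h
      refine Or.inl ⟨(show (e i : ℕ) < e j by omega), by simp⟩
    · exact ((Frame.refl _ _ _).setReg le_rfl).setReg le_rfl
    · simp [hr.var] at h
      refine Or.inr ⟨fun hlt : (e i : ℕ) < e j => by omega, by simp⟩
  | neg φ ih =>
    refine Exec.seq (T' := 2) ((ih hr hH).imp ?_)
    rintro τ ⟨hf, hd⟩
    refine .cond (T := 1) (fun h => .const ⟨hf.setReg le_rfl, ?_⟩)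
      fun h => .const ⟨hf.setReg le_rfl, ?_⟩
    · exact Or.inr ⟨not_not.2 (hd.resolve_right fun h' => h h'.2).1, by simp⟩
    · exact Or.inl ⟨(hd.resolve_left fun h' => by omega).1, by simp⟩
  | and φ ψ ih1 ih2 =>
    refine (Exec.seq (T' := ψ.cost n + 2) ((ih1 hr hH).imp ?_)).le
      (by simp only [Fml.cost]; omega)
    rintro τ ⟨hf, hd⟩
    refine .cond (T := ψ.cost n + 1) (fun h => ?_)
      fun h => (Exec.const ⟨hf.setReg le_rfl, ?_⟩).le (by omega)
    · refine (ih2 (hr.frame (hH ▸ hr.heap) hf) (by rw [hf.1 _ hr.heap_lt, hH])).mono (by omega) ?_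
      rintro τ' ⟨hf', hd'⟩
      have hφ := (hd.resolve_right fun h' => h h'.2).1
      refine ⟨hf.trans hf', ?_⟩
      rcases hd' with ⟨h1, h2⟩ | ⟨h1, h2⟩
      · exact Or.inl ⟨⟨hφ, h1⟩, h2⟩
      · exact Or.inr ⟨fun h => h1 h.2, h2⟩
    · exact Or.inr ⟨fun h' => (hd.resolve_left fun h' => by omega).1 h'.1, by simp⟩
  | ex φ ih =>
    have h5 := hr.five_le
    have hhd := hr.heap_lt
    refine Exec.seq (T := 1) (.const ?_)
    refine Exec.forLoop (n := n) (fun k τ => Frame d H σ τ ∧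
      (((∃ x : Fin n, x.1 < k ∧ Sat G φ (scons x e)) ∧ τ.reg d = 1) ∨
        ((¬ ∃ x : Fin n, x.1 < k ∧ Sat G φ (scons x e)) ∧ τ.reg d = 0)))
      (by omega) ?_ ?_ ?_ ?_ ?_ ?_
    · rintro k τ ⟨hf, -⟩
      exact ⟨by rw [hf.1 2 (by omega), hr.size], by rw [hf.1 3 (by omega), hr.one]⟩
    · rintro k τ c ⟨hf, hd⟩
      exact ⟨hf.setReg (by omega), by simpa using hd⟩
    · rintro k τ c ⟨hf, hd⟩
      exact ⟨hf.setReg (by omega), by simpa using hd⟩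
    · exact ⟨(Frame.refl _ _ _).setReg (by omega), by simp⟩
    · rintro k hk τ ⟨hf, hd⟩ hx
      have hr' : Ready G hdr (scons ⟨k, hk⟩ e) (scons (d + 2) ρ) h (d + 3) τ :=
        (hr.frame (hH ▸ hr.heap) hf).bind (by omega) (by omega) hx (by omega) le_rfl
      refine Exec.seq (T' := 2) ((ih hr' (by rw [hf.1 _ hhd, hH])).imp ?_)
      rintro τ' ⟨hf', hd'⟩
      have hff : Frame d H σ τ' := hf.trans (hf'.mono (by omega) le_rfl)
      refine .cond (T := 1) (fun h => .const ⟨⟨hff.setReg le_rfl, Or.inl ⟨⟨⟨k, hk⟩,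
        Nat.lt_succ_self k, ?_⟩, by simp⟩⟩, ?_⟩) fun h => .const ⟨⟨hff.setReg (by omega), ?_⟩, ?_⟩
      · exact (hd'.resolve_right fun h' => h h'.2).1
      · simp [hf'.1 (d + 1) (by omega)]
      · have hk' := (hd'.resolve_left fun h' => by omega).1
        have hiff : (∃ x : Fin n, x.1 < k + 1 ∧ Sat G φ (scons x e)) ↔
            ∃ x : Fin n, x.1 < k ∧ Sat G φ (scons x e) := by
          constructor
          · rintro ⟨x, hxk, hx⟩
            rcases Nat.lt_succ_iff_lt_or_eq.1 hxk with hlt | heq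
            · exact ⟨x, hlt, hx⟩
            · obtain rfl : x = ⟨k, hk⟩ := Fin.ext heq
              exact absurd hx hk'
          · rintro ⟨x, hxk, hx⟩
            exact ⟨x, by omega, hx⟩
        rw [hiff, RamState.setReg_reg, if_neg (by omega), hf'.1 d (by omega)]
        exact hd
      · simp [hf'.1 (d + 1) (by omega)]
    · rintro τ ⟨hf, hd⟩
      refine ⟨hf, ?_⟩
      simpa [Sat] using hd
  | reach i j φ ih =>
    have h5 := hr.five_le
    have hHle : hdr + n * n ≤ H := hH ▸ hr.heap
    have key : ∀ (x : Fin n) τ r, Frame d H σ τ → τ.reg (d + 1) = H + n → r < d + 9 →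
        τ.reg r = x → Exec (φ.prog (scons r ρ) (d + 1) (d + 9)) τ (φ.cost n)
          (Decides (d + 9) (H + n) τ (x ∈ {x | Sat G φ (scons x e)})) := by
      intro x τ r hf h1 hrd hx
      refine ih ((hr.frame hHle hf).bind (by omega) hrd hx (by omega) ?_) h1
      rw [hf.1 h hr.heap_lt, hH, h1]
      omega
    refine exec_reachProg hr hH (hr.var_lt i) (hr.var_lt j) (hr.var i) (hr.var j)
      (fun τ hf h1 => key _ τ _ hf h1 ?_ ?_) fun x τ hf h1 h7 => key x τ _ hf h1 (by omega) h7
    · have := hr.var_lt i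
      omega
    · rw [hf.1 _ (hr.var_lt i), hr.var]

end Correctness

end Formulas

/-! ### Definable predicates -/

section Definability

abbrev Query := ∀ n : ℕ, SimpleGraph (Fin n) → (ℕ → Fin n) → Prop

abbrev Family := ∀ n : ℕ, SimpleGraph (Fin n) → (ℕ → Fin n) → Set (Fin n)

def Definable (P : Query) : Prop := ∃ φ : Fml, ∀ n (G : SimpleGraph (Fin n)) e, Sat G φ e ↔ P n G e

/-- Variable `0` is the candidate element; the parameters of the family follow from index `1` on. -/
def DefinableSet (S : Family) : Prop := Definable fun n G e => e 0 ∈ S n G fun j => e (j + 1)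

def Fml.rename : Fml → (ℕ → ℕ) → Fml
  | .adj i j, f => .adj (f i) (f j)
  | .eq i j, f => .eq (f i) (f j)
  | .lt i j, f => .lt (f i) (f j)
  | .neg φ, f => .neg (φ.rename f)
  | .and φ ψ, f => .and (φ.rename f) (ψ.rename f)
  | .ex φ, f => .ex (φ.rename (scons 0 fun i => f i + 1))
  | .reach i j φ, f => .reach (f i) (f j) (φ.rename (scons 0 fun i => f i + 1))

theorem sat_rename {n : ℕ} (G : SimpleGraph (Fin n)) (φ : Fml) (f : ℕ → ℕ) (e : ℕ → Fin n) :
    Sat G (φ.rename f) e ↔ Sat G φ fun i => e (f i) := by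
  have hcons : ∀ (f : ℕ → ℕ) (e : ℕ → Fin n) x,
      (fun i => scons x e (scons 0 (fun i => f i + 1) i)) = scons x fun i => e (f i) := by
    intro f e x
    funext i
    cases i <;> rfl
  induction φ generalizing f e with
  | adj => rfl
  | eq => rfl
  | lt => rfl
  | neg φ ih => exact not_congr (ih f e)
  | and φ ψ ih1 ih2 => exact and_congr (ih1 f e) (ih2 f e)
  | ex φ ih =>
    refine exists_congr fun x => (ih _ _).trans ?_
    rw [hcons]
  | reach i j φ ih =>
    have : {x | Sat G (φ.rename (scons 0 fun i => f i + 1)) (scons x e)} =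
        {x | Sat G φ (scons x fun i => e (f i))} := by
      ext x
      refine (ih _ _).trans ?_
      rw [hcons]
      rfl
    simp only [Fml.rename, Sat, this]

namespace Definable

variable {P Q : Query}

theorem congr (hP : Definable P) (h : ∀ n G e, P n G e ↔ Q n G e) : Definable Q := by
  obtain ⟨φ, hφ⟩ := hP
  exact ⟨φ, fun n G e => (hφ n G e).trans (h n G e)⟩

theorem adj (i j : ℕ) : Definable fun _ G e => G.Adj (e i) (e j) := ⟨.adj i j, fun _ _ _ => Iff.rfl⟩

theorem eq (i j : ℕ) : Definable fun _ _ e => e i = e j := ⟨.eq i j, fun _ _ _ => Iff.rfl⟩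

theorem lt (i j : ℕ) : Definable fun _ _ e => e i < e j := ⟨.lt i j, fun _ _ _ => Iff.rfl⟩

theorem not (hP : Definable P) : Definable fun n G e => ¬ P n G e := by
  obtain ⟨φ, hφ⟩ := hP
  exact ⟨.neg φ, fun n G e => not_congr (hφ n G e)⟩

theorem and (hP : Definable P) (hQ : Definable Q) : Definable fun n G e => P n G e ∧ Q n G e := by
  obtain ⟨φ, hφ⟩ := hP
  obtain ⟨ψ, hψ⟩ := hQ
  exact ⟨.and φ ψ, fun n G e => and_congr (hφ n G e) (hψ n G e)⟩

theorem or (hP : Definable P) (hQ : Definable Q) : Definable fun n G e => P n G e ∨ Q n G e :=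
  (hP.not.and hQ.not).not.congr fun n G e => by tauto

theorem imp (hP : Definable P) (hQ : Definable Q) : Definable fun n G e => P n G e → Q n G e :=
  (hP.and hQ.not).not.congr fun n G e => by tauto

theorem ex (hP : Definable P) : Definable fun n G e => ∃ x, P n G (scons x e) := by
  obtain ⟨φ, hφ⟩ := hP
  exact ⟨.ex φ, fun n G e => exists_congr fun x => hφ n G _⟩

theorem all (hP : Definable P) : Definable fun n G e => ∀ x, P n G (scons x e) :=
  hP.not.ex.not.congr fun n G e => by simp

theorem reindex (hP : Definable P) (f : ℕ → ℕ) : Definable fun n G e => P n G fun i => e (f i) := by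
  obtain ⟨φ, hφ⟩ := hP
  exact ⟨φ.rename f, fun n G e => (sat_rename G φ f e).trans (hφ n G _)⟩

theorem false : Definable fun _ _ _ => False := ((eq 0 0).and (eq 0 0).not).congr fun _ _ _ => by tauto

/-- Quantification over `m` vertices at once. -/
theorem exists_extension (hP : Definable P) (m : ℕ) :
    Definable fun n G e => ∃ e' : ℕ → Fin n, (∀ j, e' (j + m) = e j) ∧ P n G e' := by
  induction m with
  | zero =>
    refine hP.congr fun n G e => ⟨fun h => ⟨e, fun _ => rfl, h⟩, ?_⟩
    rintro ⟨e', h1, h2⟩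
    obtain rfl : e' = e := funext h1
    exact h2
  | succ m ih =>
    refine ih.ex.congr fun n G e => ⟨?_, ?_⟩
    · rintro ⟨x, e', h1, h2⟩
      exact ⟨e', fun j => by rw [show j + (m + 1) = (j + 1) + m by omega, h1]; rfl, h2⟩
    · rintro ⟨e', h1, h2⟩
      refine ⟨e' m, e', fun j => ?_, h2⟩
      rcases j with _ | j
      · rw [Nat.zero_add]; rfl
      · rw [show j + 1 + m = j + (m + 1) by omega, h1]; rfl

end Definable

namespace DefinableSet

variable {S T : Family}

theorem mem (hS : DefinableSet S) (f : ℕ → ℕ) (i : ℕ) :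
    Definable fun n G e => e i ∈ S n G fun j => e (f j) :=
  Definable.reindex hS (scons i f)

theorem mem' (hS : DefinableSet S) (i : ℕ) : Definable fun n G e => e i ∈ S n G e := hS.mem id i

theorem reindex (hS : DefinableSet S) (f : ℕ → ℕ) :
    DefinableSet fun n G e => S n G fun j => e (f j) :=
  hS.mem (fun j => f j + 1) 0

theorem union (hS : DefinableSet S) (hT : DefinableSet T) :
    DefinableSet fun n G e => S n G e ∪ T n G e := Definable.or hS hT

theorem inter (hS : DefinableSet S) (hT : DefinableSet T) :
    DefinableSet fun n G e => S n G e ∩ T n G e := Definable.and hS hT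

theorem compl (hS : DefinableSet S) : DefinableSet fun n G e => (S n G e)ᶜ := Definable.not hS

theorem singleton (i : ℕ) : DefinableSet fun _ _ e => {e i} := Definable.eq 0 (i + 1)

theorem reachIn (hS : DefinableSet S) (i j : ℕ) :
    Definable fun n G e => ReachIn G (S n G e) (e i) (e j) := by
  obtain ⟨φ, hφ⟩ := hS
  refine ⟨.reach i j φ, fun n G e => ?_⟩
  have : {x | Sat G φ (scons x e)} = S n G e := Set.ext fun x => hφ n G (scons x e)
  simp only [Sat, this]

theorem outerNbrs (hS : DefinableSet S) :
    DefinableSet fun n G e => outerNbrs G (S n G e) :=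
  (hS.mem (fun j => j + 1) 0).not.and
    (((hS.mem (fun j => j + 2) 0).and (Definable.adj 0 1)).ex)

theorem outerRest (hS : DefinableSet S) (i : ℕ) :
    DefinableSet fun n G e => outerRest G (S n G e) (e i) :=
  (hS.mem (fun j => j + 1) 0).not.and ((hS.outerNbrs.mem (fun j => j + 1) 0).not.and
    ((Definable.eq 0 (i + 1)).not.and (Definable.adj (i + 1) 0).not))

theorem separated (hS : DefinableSet S) (i : ℕ) :
    DefinableSet fun n G e => separated G (S n G e) (e i) :=
  ((hS.compl.reindex (fun j => j + 1)).reachIn 0 (i + 1)).not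

theorem connectedSet (hS : DefinableSet S) : Definable fun n G e => ConnectedSet G (S n G e) := by
  refine Definable.congr (P := fun n G e => (∃ x, x ∈ S n G e) ∧ ∀ x, ∀ y, x ∈ S n G e →
    y ∈ S n G e → ReachIn G (S n G e) x y) ?_ fun n G e => ?_
  · exact (hS.mem (fun j => j + 1) 0).ex.and (((hS.mem (fun j => j + 2) 1).imp
      ((hS.mem (fun j => j + 2) 0).imp ((hS.reindex (fun j => j + 2)).reachIn 1 0))).all.all)
  · rw [connectedSet_iff]
    exact and_congr Iff.rfl ⟨fun h x hx y hy => h x y hx hy, fun h x y hx hy => h x hx y hy⟩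

end DefinableSet

/-- The admissible vertices among the first `m` variables. -/
def picked {n : ℕ} (m : ℕ) (G : SimpleGraph (Fin n)) (B : Set (Fin n)) (v : Fin n)
    (e : ℕ → Fin n) : Set (Fin n) := {x | ∃ j < m, x = e j} ∩ outerRest G B v

theorem definableSet_range (m : ℕ) : DefinableSet fun _ _ e => {x | ∃ j < m, x = e j} := by
  induction m with
  | zero => exact Definable.false.congr fun n G e => by simp
  | succ m ih =>
    refine Definable.congr (Definable.or ih (Definable.eq 0 (m + 1))) fun n G e => ?_
    simp only [Set.mem_ofPred_eq, Nat.lt_succ_iff_lt_or_eq]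
    constructor
    · rintro (⟨j, hj, h⟩ | h)
      exacts [⟨j, Or.inl hj, h⟩, ⟨m, Or.inr rfl, h⟩]
    · rintro ⟨j, hj | rfl, h⟩
      exacts [Or.inl ⟨j, hj, h⟩, Or.inr h]

theorem DefinableSet.picked {B : Family} (hB : DefinableSet B) (m i : ℕ) :
    DefinableSet fun n G e => picked m G (B n G e) (e i) e :=
  (definableSet_range m).inter (hB.outerRest i)

/-- Quantifying over small sets becomes quantifying over `m` vertices. Intersecting with `outerRest`
turns every tuple into a legitimate candidate, so only connectedness remains to be tested. -/
theorem exists_bagGuess_iff {n m : ℕ} {G : SimpleGraph (Fin n)} {B : Set (Fin n)} {v : Fin n}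
    (e : ℕ → Fin n) {P : Set (Fin n) → Prop} :
    (∃ S, IsBagGuess m G B v S ∧ P S) ↔ ∃ e' : ℕ → Fin n, (∀ j, e' (j + m) = e j) ∧
      ConnectedSet G (outerNbrs G B ∪ picked m G B v e') ∧ P (picked m G B v e') := by
  classical
  constructor
  · rintro ⟨S, ⟨hS, hfin, hcard, hconn⟩, hP⟩
    suffices ∃ e' : ℕ → Fin n, (∀ j, e' (j + m) = e j) ∧ picked m G B v e' = S by
      obtain ⟨e', h1, rfl⟩ := this
      exact ⟨e', h1, hconn, hP⟩
    obtain ⟨F, rfl⟩ : ∃ F : Finset (Fin n), S = F := ⟨hfin.toFinset, by simp⟩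
    rw [Set.ncard_coe_finset] at hcard
    have hvr : v ∉ outerRest G B v := fun h => h.2.2.1 rfl
    -- Places not needed for `S` are filled with `v`, which `picked` discards.
    refine ⟨fun j => if h : j < F.card then (F.equivFin.symm ⟨j, h⟩).1 else
      if j < m then v else e (j - m), fun j => ?_, ?_⟩
    · dsimp only
      rw [dif_neg (by omega), if_neg (by omega), Nat.add_sub_cancel]
    · ext x
      constructor
      · rintro ⟨⟨j, hj, hx⟩, hxr⟩
        dsimp only at hx
        by_cases h : j < F.card
        · rw [dif_pos h] at hx
          rw [hx]
          exact (F.equivFin.symm ⟨j, h⟩).2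
        · rw [dif_neg h, if_pos hj] at hx
          subst hx
          exact absurd hxr hvr
      · intro hx
        refine ⟨⟨F.equivFin ⟨x, hx⟩, by omega, ?_⟩, hS hx⟩
        simp
  · rintro ⟨e', h1, h2, h3⟩
    refine ⟨_, ⟨Set.inter_subset_right, Set.toFinite _, ?_, h2⟩, h3⟩
    have hsub : picked m G B v e' ⊆ ((Finset.range m).image e' : Finset (Fin n)) := by
      rintro x ⟨⟨j, hj, rfl⟩, -⟩
      simpa using ⟨j, hj, rfl⟩
    refine (Set.ncard_le_ncard hsub (Set.toFinite _)).trans ?_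
    rw [Set.ncard_coe_finset]
    exact Finset.card_image_le.trans (by simp)

/-- Suitability of `G`, `B` and `v` for the path on `m + 3` vertices, with the successive first bags
found by guessing. -/
def ChainSuitable {V : Type} (α : ℕ) (G : SimpleGraph V) : ℕ → Set V → V → Prop
  | 0, B, v => v ∉ B ∧ v ∉ outerNbrs G B ∧ ConnectedSet G {x | x ∉ B ∧ x ≠ v}
  | m + 1, B, v => v ∉ B ∧ v ∉ outerNbrs G B ∧ ∃ S, IsBagGuess α G B v S ∧
      ChainSuitable α G m (separated G (outerNbrs G B ∪ S) v) v

theorem bagSuitable_iff_chainSuitable {V : Type} [Finite V] {G : SimpleGraph V} {s : ℕ}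
    (hG : G.Connected) (hf : HFree (sP1P4 s) G) (m : ℕ) {B : Set V} (hB : ConnectedSet G B)
    {v : V} : BagSuitable (m + 3) G B v ↔ ChainSuitable ((s + 2) * (2 * s + 4)) G m B v := by
  induction m generalizing B with
  | zero => exact bagSuitable_three_iff hB
  | succ m ih =>
    rw [show m + 1 + 3 = (m + 3) + 1 by omega, bagSuitable_succ_iff (by omega) hG hf hB]
    refine and_congr_right fun hvB => and_congr_right fun _ => exists_congr fun S =>
      and_congr_right fun hg => ih (hg.connectedSet_separated hG hB hvB)

/-- The induction needs an arbitrary definable family `B`: the next first bag is again definable,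
from the old parameters and `α` new variables, which shift all indices by `α`. -/
theorem definable_chainSuitable (α m : ℕ) {B : Family} (hB : DefinableSet B) (i : ℕ) :
    Definable fun n G e => ChainSuitable α G m (B n G e) (e i) := by
  induction m generalizing B i with
  | zero =>
    exact (hB.mem' i).not.and ((hB.outerNbrs.mem' i).not.and
      (hB.compl.inter (DefinableSet.singleton i).compl).connectedSet)
  | succ m ih =>
    refine Definable.congr ((hB.mem' i).not.and ((hB.outerNbrs.mem' i).not.and
      (Definable.exists_extension (P := fun n G e =>
        ConnectedSet G (outerNbrs G (B n G fun j => e (j + α)) ∪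
          picked α G (B n G fun j => e (j + α)) (e (i + α)) e) ∧
        ChainSuitable α G m (separated G (outerNbrs G (B n G fun j => e (j + α)) ∪
          picked α G (B n G fun j => e (j + α)) (e (i + α)) e) (e (i + α))) (e (i + α))) ?_ α)))
      fun n G e => ?_
    · have hC := (hB.reindex (fun j => j + α)).outerNbrs.union
        ((hB.reindex (fun j => j + α)).picked α (i + α))
      exact hC.connectedSet.and (ih (hC.separated (i + α)) (i + α))
    · rw [ChainSuitable]
      refine and_congr_right fun _ => and_congr_right fun _ => ?_
      rw [exists_bagGuess_iff e]
      refine exists_congr fun e' => and_congr_right fun he => ?_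
      have : (fun j => e' (j + α)) = e := funext he
      rw [this, he]

theorem exists_fml_contractsTo (s k : ℕ) (hk : 1 ≤ k) :
    ∃ φ : Fml, ∀ n (G : SimpleGraph (Fin n)) e, G.Connected → HFree (sP1P4 s) G →
      (Sat G φ e ↔ ContractsTo (SimpleGraph.pathGraph k) G) := by
  obtain rfl | rfl | ⟨m, rfl⟩ : k = 1 ∨ k = 2 ∨ ∃ m, k = m + 3 := by
    by_cases h : 3 ≤ k
    · exact Or.inr (Or.inr ⟨k - 3, by omega⟩)
    · omega
  · obtain ⟨φ, hφ⟩ := Definable.eq 0 0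
    exact ⟨φ, fun n G e hG _ => iff_of_true ((hφ n G e).2 rfl) (contractsTo_pathGraph_one hG)⟩
  · obtain ⟨φ, hφ⟩ := (Definable.eq 1 0).not.ex.ex
    exact ⟨φ, fun n G e hG _ => (hφ n G e).trans (contractsTo_pathGraph_two_iff hG).symm⟩
  · obtain ⟨φ, hφ⟩ := (definable_chainSuitable ((s + 2) * (2 * s + 4)) m
      (DefinableSet.singleton 1) 0).ex.ex
    refine ⟨φ, fun n G e hG hf => ?_⟩
    rw [hφ, contractsTo_pathGraph_iff_bagSuitable hG (by omega)]
    exact exists_congr fun u => exists_congr fun v =>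
      (bagSuitable_iff_chainSuitable hG hf m (connectedSet_singleton u)).symm

end Definability

/-! ### Reading the input -/

section Input

theorem List.getD_flatMap_of_length {α : Type} {m j d : ℕ} (hj : j < m) {f : α → List ℕ} (l : List α)
    (hf : ∀ a, (f a).length = m) (i : ℕ) (hi : i < l.length) :
    (l.flatMap f).getD (i * m + j) d = (f l[i]).getD j d := by
  induction l generalizing i with
  | nil => simp at hi
  | cons a l ih =>
    rw [List.flatMap_cons]
    rcases i with _ | i
    · rw [List.getD_append _ _ _ _ (by rw [hf]; omega)]
      simp
    · rw [List.getD_append_right _ _ _ _ (by rw [hf, Nat.succ_mul]; omega), hf,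
        show (i + 1) * m + j - m = i * m + j by rw [Nat.succ_mul]; omega,
        ih i (by simpa using hi)]
      rfl

theorem adjacencyWord_length {n : ℕ} (G : SimpleGraph (Fin n)) :
    (adjacencyWord G).length = n * n := by
  simp [adjacencyWord, List.length_flatMap]

open Classical in
theorem adjacencyWord_getD {n : ℕ} (G : SimpleGraph (Fin n)) (i j : Fin n) :
    (adjacencyWord G).getD (i * n + j) 0 = if G.Adj i j then 1 else 0 := by
  rw [adjacencyWord, List.getD_flatMap_of_length j.2 _ (by simp) i (by simp)]
  simp

/-- Puts `n`, `1`, the position of the adjacency matrix and the end of the input in the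
registers `2`, `3`, `4` and `6`. -/
def setupProg (hdr : ℕ) : RamProg :=
  .seq (.load 2 5) (.seq (.const 3 1) (.seq (.const 4 hdr) (.seq (.move 6 4)
    (forLoop 8 9 (.add 6 6 2)))))

structure IsSetUp {n : ℕ} (G : SimpleGraph (Fin n)) (w : List ℕ) (hdr : ℕ) (σ : RamState) :
    Prop where
  mem : σ.mem = (inputState w).mem
  size : σ.reg 2 = n
  one : σ.reg 3 = 1
  header : σ.reg 4 = hdr
  zero : σ.reg 5 = 0
  heap : σ.reg 6 = hdr + n * n
  ticks : σ.reg 0 = 0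
  adj : ∀ i j : Fin n, (G.Adj i j ∧ σ.mem (hdr + i * n + j) = 1) ∨
    (¬ G.Adj i j ∧ σ.mem (hdr + i * n + j) = 0)

theorem IsSetUp.setReg {n : ℕ} {G : SimpleGraph (Fin n)} {w : List ℕ} {hdr r x : ℕ} {σ : RamState}
    (h : IsSetUp G w hdr σ) (hr : 7 ≤ r ∨ r = 1) : IsSetUp G w hdr (σ.setReg r x) := by
  have hne : ∀ a, a ≠ 1 → a < 7 → (σ.setReg r x).reg a = σ.reg a := fun a h1 h7 => by
    rw [RamState.setReg_reg, if_neg (by omega)]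
  exact ⟨h.mem, by rw [hne 2 (by omega) (by omega), h.size],
    by rw [hne 3 (by omega) (by omega), h.one], by rw [hne 4 (by omega) (by omega), h.header],
    by rw [hne 5 (by omega) (by omega), h.zero], by rw [hne 6 (by omega) (by omega), h.heap],
    by rw [hne 0 (by omega) (by omega), h.ticks], h.adj⟩

theorem exec_setupProg {n : ℕ} (G : SimpleGraph (Fin n)) (header : List ℕ) {w : List ℕ}
    (hw : w = header ++ adjacencyWord G) (h0 : w.getD 0 0 = n) :
    Exec (setupProg header.length) (inputState w) (forCost n 1 + 4)
      (IsSetUp G w header.length) := by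
  -- Register 5 is still `0`, so the first load reads `n` from cell `0`.
  refine (Exec.seq (T := 1) (.load (.seq (T := 1) (.const (.seq (T := 1) (.const (.seq (T := 1)
    (T' := forCost n 1) (.move ?_)))))))).le (by omega)
  refine Exec.forLoop (n := n) (fun k τ => τ.mem = (inputState w).mem ∧ τ.reg 2 = n ∧ τ.reg 3 = 1 ∧
    τ.reg 4 = header.length ∧ τ.reg 5 = 0 ∧ τ.reg 6 = header.length + k * n ∧ τ.reg 0 = 0)
    (by omega) ?_ ?_ ?_ ?_ ?_ ?_
  · exact fun k τ h => ⟨h.2.1, h.2.2.1⟩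
  · exact fun k τ a h => by simpa using h
  · exact fun k τ a h => by simpa using h
  · refine ⟨rfl, ?_, ?_, ?_, ?_, ?_, ?_⟩ <;> simp [inputState, ← h0]
  · rintro k hk τ ⟨h1, h2, h3, h4, h5, h6, h7⟩ hx
    refine .add ⟨⟨h1, ?_⟩, by simp⟩
    simp only [RamState.setReg_reg]
    refine ⟨h2, h3, h4, h5, ?_, h7⟩
    rw [if_pos trivial, h6, h2]
    ring
  · rintro τ ⟨h1, h2, h3, h4, h5, h6, h7⟩
    refine ⟨h1, h2, h3, h4, h5, h6, h7, fun i j => ?_⟩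
    have : τ.mem (header.length + i * n + j) = (adjacencyWord G).getD (i * n + j) 0 := by
      rw [h1, hw, add_assoc]
      change (header ++ adjacencyWord G).getD _ _ = _
      rw [List.getD_append_right _ _ _ _ (by omega), Nat.add_sub_cancel_left]
    rw [this, adjacencyWord_getD]
    by_cases h : G.Adj i j <;> simp [h]

end Input

/-! ### Longest Path Contractibility -/

section LongestPath

/-- Evaluates the formula whose position in the list is `R[7] - 1`, if there is one. -/
def selectProg : List Fml → RamProg
  | [] => .const 0 0
  | φ :: l => .seq (.sub 7 7 3)
      (.cond 7 (selectProg l) (.seq (φ.prog (fun _ => 5) 6 8) (.move 0 8)))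

def selectCost : List Fml → ℕ → ℕ
  | [], _ => 1
  | φ :: l, n => selectCost l n + φ.cost n + 3

theorem polyBounded_selectCost (l : List Fml) : PolyBounded (selectCost l) := by
  induction l with
  | nil => exact .const 1
  | cons φ l ih => exact (ih.add φ.polyBounded_cost).add (.const 3)

theorem exec_selectProg {n : ℕ} {G : SimpleGraph (Fin n)} {w : List ℕ} {hdr : ℕ} (z : Fin n)
    (hz : z.val = 0) (l : List Fml) {k : ℕ} {σ : RamState} (hσ : IsSetUp G w hdr σ)
    (hk : σ.reg 7 = k + 1) :
    Exec (selectProg l) σ (selectCost l n) fun τ =>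
      τ.reg 0 ≠ 0 ↔ ∃ φ ∈ l[k]?, Sat G φ fun _ => z := by
  induction l generalizing k σ with
  | nil => exact .const (by simp)
  | cons φ l ih =>
    refine (Exec.seq (T := 1) (T' := selectCost l n + φ.cost n + 2) (.sub (.cond
      (T := selectCost l n + φ.cost n + 1) (fun h => ?_) fun h => ?_))).le
      (by simp only [selectCost]; omega)
    · simp only [RamState.setReg_reg, if_true, hk, hσ.one, Nat.add_sub_cancel] at h ⊢
      obtain ⟨k, rfl⟩ : ∃ k', k = k' + 1 := ⟨k - 1, by omega⟩
      refine (ih (hσ.setReg (by omega)) (k := k) (by simp)).mono (by omega) ?_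
      intro τ hτ
      simpa using hτ
    · simp only [RamState.setReg_reg, if_true, hk, hσ.one, Nat.add_sub_cancel] at h ⊢
      subst h
      have hσ' := hσ.setReg (r := 7) (x := 0) (by omega)
      -- A formula needs values for all variables; the dummy vertex `0` is used throughout, read
      -- from register 5.
      have hr : Ready G hdr (fun _ => z) (fun _ => 5) 6 8 (σ.setReg 7 0) :=
        ⟨hσ'.size, hσ'.one, hσ'.header, hσ'.adj, hσ'.heap.ge, by omega, by omega,
          fun _ => by omega, fun _ => by rw [hσ'.zero, hz]⟩
      refine (Exec.seq (T' := 1) ((φ.exec_prog hr hσ'.heap).imp ?_)).le (by omega)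
      rintro τ ⟨-, hd⟩
      refine .move ?_
      rcases hd with ⟨h1, h2⟩ | ⟨h1, h2⟩
      · simp [h1, h2]
      · simp [h1, h2]

theorem longestPathContractibility_polyTime (s : ℕ) :
    LongestPathContractibilityPolyTime (sP1P4 s) := by
  choose f hf using fun k => exists_fml_contractsTo s (k + 1) (by omega)
  -- Entry `k` treats the path on `k + 1` vertices. Longer paths than those listed are never
  -- contractions, and `selectProg` answers no when the list is exhausted.
  set l : List Fml := (List.range (2 * s + 3)).map f with hl
  obtain ⟨c, hc⟩ := (((PolyBounded.const 1).forCost.add (.const 5)).add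
    (polyBounded_selectCost l)).exists_bound
  -- `R[3] = 1` doubles as the address of the input cell that holds `k`.
  refine ⟨.seq (setupProg 2) (.seq (.load 7 3) (selectProg l)), c, fun x hx => ?_⟩
  obtain ⟨hG, hfree, hk⟩ := hx
  have hword : x.word = [x.n, x.k] ++ adjacencyWord x.graph := rfl
  have hlen : x.n ≤ x.word.length := by
    have := Nat.le_mul_self x.n
    rw [hword, List.length_append, adjacencyWord_length]
    omega
  have hn : 0 < x.n := by
    obtain ⟨v⟩ := hG.nonempty
    exact v.pos
  obtain ⟨k, hk'⟩ : ∃ k, x.k = k + 1 := ⟨x.k - 1, by omega⟩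
  have main : Exec (.seq (setupProg 2) (.seq (.load 7 3) (selectProg l))) (inputState x.word)
      (forCost x.n 1 + 5 + selectCost l x.n)
      fun τ => τ.reg 0 ≠ 0 ↔ ContractsTo (SimpleGraph.pathGraph x.k) x.graph := by
    refine (Exec.seq (T := forCost x.n 1 + 4) (T' := 1 + selectCost l x.n) ?_).le (by omega)
    refine (exec_setupProg x.graph [x.n, x.k] hword (by simp [hword])).imp ?_
    intro σ hσ
    refine Exec.seq (.load ?_)
    have h7 : (σ.setReg 7 (σ.mem (σ.reg 3))).reg 7 = k + 1 := by
      simp [hσ.one, hσ.mem, inputState, hword, hk']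
    refine (exec_selectProg ⟨0, hn⟩ rfl l (hσ.setReg (by omega)) h7).imp ?_
    intro τ hτ
    rw [hτ, hk']
    by_cases hlt : k < 2 * s + 3
    · have : l[k]? = some (f k) := by simp [hl, hlt]
      simp only [this, Option.mem_some_iff, exists_eq_left']
      exact hf k x.n x.graph _ hG hfree
    · have : l[k]? = none := by simp [hl]; omega
      simp only [this, Option.not_mem_none, false_and, exists_false, false_iff]
      exact not_contractsTo_pathGraph hG hfree (by omega)
  obtain ⟨t, τ, h1, h2, h3⟩ := main
  exact ⟨t, τ, h1, h2.trans (hc _ _ hlen), h3⟩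

end LongestPath

/-! ### Writing lists -/

section Transducers

/-- Programs that write a list: `emit φ` writes a truth value, `count φ` the number of vertices
satisfying `φ`, `tick` increases a counter and `all t` runs `t` for all vertices. -/
inductive Emitter where
  | emit (φ : Fml)
  | count (φ : Fml)
  | tick
  | seq (t t' : Emitter)
  | guard (φ : Fml) (t : Emitter)
  | all (t : Emitter)

open Classical in
noncomputable def Emitter.out {n : ℕ} (G : SimpleGraph (Fin n)) : Emitter → (ℕ → Fin n) → List ℕ
  | .emit φ, e => [if Sat G φ e then 1 else 0]
  | .count φ, e => [(List.finRange n).countP fun x => Sat G φ (scons x e)]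
  | .tick, _ => []
  | .seq t t', e => t.out G e ++ t'.out G e
  | .guard φ t, e => if Sat G φ e then t.out G e else []
  | .all t, e => (List.finRange n).flatMap fun x => t.out G (scons x e)

open Classical in
noncomputable def Emitter.ticks {n : ℕ} (G : SimpleGraph (Fin n)) : Emitter → (ℕ → Fin n) → ℕ
  | .emit _, _ => 0
  | .count _, _ => 0
  | .tick, _ => 1
  | .seq t t', e => t.ticks G e + t'.ticks G e
  | .guard φ t, e => if Sat G φ e then t.ticks G e else 0
  | .all t, e => ((List.finRange n).map fun x => t.ticks G (scons x e)).sum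

/-- Register `6` points to the end of the output, register `0` is the counter. -/
def Emitter.prog : Emitter → (ℕ → ℕ) → ℕ → RamProg
  | .emit φ, ρ, d => .seq (φ.prog ρ 6 d) (.seq (.store 6 d) (.add 6 6 3))
  | .count φ, ρ, d => .seq (.const d 0) (.seq
      (forLoop (d + 1) (d + 2) (.seq (φ.prog (scons (d + 2) ρ) 6 (d + 3)) (.add d d (d + 3))))
      (.seq (.store 6 d) (.add 6 6 3)))
  | .tick, _, _ => .add 0 0 3
  | .seq t t', ρ, d => .seq (t.prog ρ d) (t'.prog ρ d)
  | .guard φ t, ρ, d => .seq (φ.prog ρ 6 d) (.cond d (t.prog ρ d) (.const d 0))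
  | .all t, ρ, d => forLoop d (d + 1) (t.prog (scons (d + 1) ρ) (d + 2))

def Emitter.cost : Emitter → ℕ → ℕ
  | .emit φ, n => φ.cost n + 2
  | .count φ, n => forCost n (φ.cost n + 1) + 3
  | .tick, _ => 1
  | .seq t t', n => t.cost n + t'.cost n
  | .guard φ t, n => φ.cost n + t.cost n + 2
  | .all t, n => forCost n (t.cost n)

theorem Emitter.polyBounded_cost (t : Emitter) : PolyBounded t.cost := by
  induction t with
  | emit φ => exact φ.polyBounded_cost.add (.const 2)
  | count φ => exact (φ.polyBounded_cost.add (.const 1)).forCost.add (.const 3)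
  | tick => exact .const 1
  | seq _ _ h h' => exact h.add h'
  | guard φ _ h => exact (φ.polyBounded_cost.add h).add (.const 2)
  | all _ h => exact h.forCost

/-- Between `σ` and `τ` the list `l` was written and the counter was increased by `k`. -/
structure Writes (d : ℕ) (σ : RamState) (l : List ℕ) (k : ℕ) (τ : RamState) : Prop where
  reg : ∀ r < d, r ≠ 0 → r ≠ 6 → τ.reg r = σ.reg r
  mem : ∀ a < σ.reg 6, τ.mem a = σ.mem a
  pointer : τ.reg 6 = σ.reg 6 + l.length
  ticks : τ.reg 0 = σ.reg 0 + k
  out : ∀ i (hi : i < l.length), τ.mem (σ.reg 6 + i) = l[i]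

namespace Writes

variable {d d' k k' r x : ℕ} {σ τ υ : RamState} {l l' : List ℕ}

theorem refl (d : ℕ) (σ : RamState) : Writes d σ [] 0 σ :=
  ⟨fun _ _ _ _ => rfl, fun _ _ => rfl, rfl, rfl, by simp⟩

theorem trans (h : Writes d σ l k τ) (h' : Writes d τ l' k' υ) :
    Writes d σ (l ++ l') (k + k') υ := by
  refine ⟨fun r hr h0 h6 => (h'.reg r hr h0 h6).trans (h.reg r hr h0 h6), fun a ha => ?_, ?_, ?_,
    fun i hi => ?_⟩
  · rw [h'.mem a (by rw [h.pointer]; omega), h.mem a ha]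
  · rw [h'.pointer, h.pointer, List.length_append, add_assoc]
  · rw [h'.ticks, h.ticks, add_assoc]
  · by_cases hil : i < l.length
    · rw [h'.mem _ (by rw [h.pointer]; omega), h.out i hil, List.getElem_append_left hil]
    · have hi' : i - l.length < l'.length := by
        rw [List.length_append] at hi
        omega
      rw [List.getElem_append_right (by omega), ← h'.out _ hi', h.pointer]
      congr 1
      omega

theorem mono (h : Writes d σ l k τ) (hd : d' ≤ d) : Writes d' σ l k τ :=
  ⟨fun r hr => h.reg r (by omega), h.mem, h.pointer, h.ticks, h.out⟩

theorem setReg (h : Writes d σ l k τ) (hr : d ≤ r) (hd : 7 ≤ d) :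
    Writes d σ l k (τ.setReg r x) := by
  have : ∀ a < d, (τ.setReg r x).reg a = τ.reg a := fun a ha => by
    rw [RamState.setReg_reg, if_neg (by omega)]
  refine ⟨fun a ha h0 h6 => ?_, h.mem, ?_, ?_, h.out⟩
  · rw [this a ha, h.reg a ha h0 h6]
  · rw [this 6 (by omega), h.pointer]
  · rw [this 0 (by omega), h.ticks]

theorem of_frame (h : Frame d (σ.reg 6) σ τ) (hd : 7 ≤ d) : Writes d σ [] 0 τ :=
  ⟨fun r hr _ _ => h.1 r hr, h.2, h.1 6 (by omega), h.1 0 (by omega), by simp⟩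

end Writes

/-! ### Correctness of the emitters -/

section Correctness

variable {n : ℕ} {G : SimpleGraph (Fin n)} {hdr : ℕ} {e : ℕ → Fin n} {ρ : ℕ → ℕ} {d k : ℕ}
  {σ τ : RamState} {l : List ℕ}

/-- Register 6 is both the end of the output and the start of the scratch memory; it only grows, so
the matrix stays untouched. Variables must avoid registers 0 and 6, which writing changes. -/
theorem Ready.writes (hr : Ready G hdr e ρ 6 d σ) (hρ : ∀ i, ρ i ≠ 0 ∧ ρ i ≠ 6)
    (hw : Writes d σ l k τ) : Ready G hdr e ρ 6 d τ := by
  have h5 := hr.five_le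
  have hheap := hr.heap
  refine ⟨?_, ?_, ?_, fun i j => ?_, ?_, h5, hr.heap_lt, hr.var_lt, fun i => ?_⟩
  · rw [hw.reg 2 (by omega) (by omega) (by omega), hr.size]
  · rw [hw.reg 3 (by omega) (by omega) (by omega), hr.one]
  · rw [hw.reg 4 (by omega) (by omega) (by omega), hr.header]
  · have := Ready.address_lt i j
    rw [hw.mem _ (by omega)]
    exact hr.adj i j
  · rw [hw.pointer]
    omega
  · rw [hw.reg _ (hr.var_lt i) (hρ i).1 (hρ i).2, hr.var]

theorem exec_append {x : ℕ} (hd : 7 ≤ d) (hw : Writes d σ [] 0 τ) (h3 : σ.reg 3 = 1)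
    (hx : τ.reg d = x) :
    Exec (.seq (.store 6 d) (.add 6 6 3)) τ 2 (Writes d σ [x] 0) := by
  refine Exec.seq (T := 1) (T' := 1) (.store (.add ?_))
  have h6 : τ.reg 6 = σ.reg 6 := hw.pointer
  have h3' : τ.reg 3 = 1 := by rw [hw.reg 3 (by omega) (by omega) (by omega), h3]
  refine ⟨fun r hr h0 h6' => ?_, fun a ha => ?_, ?_, ?_, fun i hi => ?_⟩
  · simpa [h6'] using hw.reg r hr h0 h6'
  · simpa [h6, ha.ne] using hw.mem a ha
  · simp [h6, h3']
  · simpa using hw.ticks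
  · obtain rfl : i = 0 := by simpa using hi
    simp [h6, hx]

theorem finRange_take_succ {n k : ℕ} (hk : k < n) :
    (List.finRange n).take (k + 1) = (List.finRange n).take k ++ [⟨k, hk⟩] := by
  rw [List.take_add_one, List.getElem?_eq_getElem (by simpa using hk)]
  simp

/-- Formulas compute above the output written so far, and later output simply overwrites their
scratch cells. -/
theorem Emitter.exec_prog (t : Emitter) (hr : Ready G hdr e ρ 6 d σ)
    (hρ : ∀ i, ρ i ≠ 0 ∧ ρ i ≠ 6) :
    Exec (t.prog ρ d) σ (t.cost n) (Writes d σ (t.out G e) (t.ticks G e)) := by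
  classical
  induction t generalizing e ρ d σ with
  | emit φ =>
    have hd : 7 ≤ d := hr.heap_lt
    refine Exec.seq (T' := 2) ((φ.exec_prog hr rfl).imp ?_)
    rintro τ ⟨hf, hb⟩
    refine exec_append hd (.of_frame hf hd) hr.one ?_
    rcases hb with ⟨h1, h2⟩ | ⟨h1, h2⟩ <;> simp [h1, h2]
  | count φ =>
    have hd : 7 ≤ d := hr.heap_lt
    refine (Exec.seq (T := 1) (T' := forCost n (φ.cost n + 1) + 2) (.const (.seq (T' := 2) ?_))).le
      (by simp only [Emitter.cost]; omega)
    refine Exec.forLoop (n := n) (fun k τ => Frame d (σ.reg 6) σ τ ∧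
      τ.reg d = ((List.finRange n).take k).countP fun x => Sat G φ (scons x e))
      (by omega) ?_ ?_ ?_ ?_ ?_ ?_
    · rintro k τ ⟨hf, -⟩
      exact ⟨by rw [hf.1 2 (by omega), hr.size], by rw [hf.1 3 (by omega), hr.one]⟩
    · rintro k τ c ⟨hf, hd⟩
      exact ⟨hf.setReg (by omega), by simpa using hd⟩
    · rintro k τ c ⟨hf, hd⟩
      exact ⟨hf.setReg (by omega), by simpa using hd⟩
    · exact ⟨(Frame.refl _ _ _).setReg le_rfl, by simp⟩
    · rintro k hk τ ⟨hf, hcount⟩ hx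
      have hr' : Ready G hdr (scons ⟨k, hk⟩ e) (scons (d + 2) ρ) 6 (d + 3) τ :=
        (hr.frame hr.heap hf).bind (by omega) (by omega) hx (by omega) le_rfl
      refine Exec.seq (T' := 1) ((φ.exec_prog hr' (hf.1 6 (by omega))).imp ?_)
      rintro τ' ⟨hf', hb⟩
      refine .add ⟨⟨(hf.trans (hf'.mono (by omega) le_rfl)).setReg le_rfl, ?_⟩, ?_⟩
      · rw [RamState.setReg_reg, if_pos rfl, hf'.1 d (by omega), hcount, finRange_take_succ hk,
          List.countP_append]
        rcases hb with ⟨h1, h2⟩ | ⟨h1, h2⟩ <;> simp [h1, h2]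
      · simp [hf'.1 (d + 1) (by omega)]
    · rintro τ ⟨hf, hcount⟩
      refine exec_append hd (.of_frame hf hd) hr.one ?_
      rw [hcount, List.take_of_length_le (by simp)]
  | tick =>
    have hd : 7 ≤ d := hr.heap_lt
    refine .add ⟨fun r _ h0 _ => by simp [h0], fun _ _ => rfl, by simp [Emitter.out],
      by simp [hr.one, Emitter.ticks], by simp [Emitter.out]⟩
  | seq t t' ih ih' =>
    refine Exec.seq ((ih hr hρ).imp fun τ hτ => ?_)
    exact (ih' (hr.writes hρ hτ) hρ).imp fun υ hυ => hτ.trans hυ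
  | guard φ t ih =>
    have hd : 7 ≤ d := hr.heap_lt
    refine (Exec.seq (T' := t.cost n + 2) ((φ.exec_prog hr rfl).imp ?_)).le
      (by simp only [Emitter.cost]; omega)
    rintro τ ⟨hf, hb⟩
    have hw := Writes.of_frame hf hd
    refine .cond (T := t.cost n + 1) (fun h => ?_) fun h => (Exec.const ?_).le (by omega)
    · have hφ := (hb.resolve_right fun h' => h h'.2).1
      refine (ih (hr.writes hρ hw) hρ).mono (by omega) fun υ hυ => ?_
      simpa [Emitter.out, Emitter.ticks, hφ] using hw.trans hυ
    · have hφ := (hb.resolve_left fun h' => by omega).1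
      simpa [Emitter.out, Emitter.ticks, hφ] using hw.setReg le_rfl hd
  | all t ih =>
    have hd : 7 ≤ d := hr.heap_lt
    refine Exec.forLoop (n := n) (fun k τ => Writes d σ
      (((List.finRange n).take k).flatMap fun x => t.out G (scons x e))
      (((List.finRange n).take k).map fun x => t.ticks G (scons x e)).sum τ)
      (by omega) ?_ ?_ ?_ ?_ ?_ ?_
    · intro k τ hw
      exact ⟨by rw [hw.reg 2 (by omega) (by omega) (by omega), hr.size],
        by rw [hw.reg 3 (by omega) (by omega) (by omega), hr.one]⟩
    · exact fun k τ c hw => hw.setReg le_rfl hd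
    · exact fun k τ c hw => hw.setReg (by omega) hd
    · simpa using Writes.refl d σ
    · intro k hk τ hw hx
      have hr' : Ready G hdr (scons ⟨k, hk⟩ e) (scons (d + 1) ρ) 6 (d + 2) τ :=
        (hr.writes hρ hw).bind (by omega) (by omega) hx (by omega) le_rfl
      refine (ih hr' ?_).imp fun υ hυ => ⟨?_, hυ.reg d (by omega) (by omega) (by omega)⟩
      · rintro (_ | i)
        · change d + 1 ≠ 0 ∧ d + 1 ≠ 6
          omega
        · exact hρ i
      · rw [finRange_take_succ hk]
        simpa using hw.trans (hυ.mono (by omega))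
    · intro τ hw
      rw [List.take_of_length_le (by simp)] at hw
      exact hw

end Correctness

/-- Nested loops over `m` vertices. -/
def Emitter.allN : ℕ → Emitter → Emitter
  | 0, t => t
  | m + 1, t => .all (t.allN m)

/-- The list of instances written by nested loops. -/
theorem exists_list_allN {n : ℕ} {G : SimpleGraph (Fin n)} {t : Emitter}
    {P : (ℕ → Fin n) → Prop} {R : (ℕ → Fin n) → PairInput → Prop} (m : ℕ) (e : ℕ → Fin n)
    (ht : ∀ e', (∀ j, e' (j + m) = e j) → ∃ L : List PairInput,
      t.out G e' = L.flatMap PairInput.word ∧ t.ticks G e' = L.length ∧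
        (∀ y ∈ L, P e' ∧ R e' y) ∧ (P e' → ∃ y ∈ L, R e' y)) :
    ∃ L : List PairInput, (t.allN m).out G e = L.flatMap PairInput.word ∧
      (t.allN m).ticks G e = L.length ∧
      (∀ y ∈ L, ∃ e', (∀ j, e' (j + m) = e j) ∧ P e' ∧ R e' y) ∧
      ∀ e', (∀ j, e' (j + m) = e j) → P e' → ∃ y ∈ L, R e' y := by
  induction m generalizing e with
  | zero =>
    obtain ⟨L, h1, h2, h3, h4⟩ := ht e fun _ => rfl
    refine ⟨L, h1, h2, fun y hy => ⟨e, fun _ => rfl, h3 y hy⟩, fun e' he => ?_⟩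
    obtain rfl : e' = e := funext he
    exact h4
  | succ m ih =>
    have hext : ∀ x (e' : ℕ → Fin n), (∀ j, e' (j + m) = scons x e j) →
        ∀ j, e' (j + (m + 1)) = e j := fun x e' he j => by
      rw [show j + (m + 1) = (j + 1) + m by omega, he]; rfl
    choose L h1 h2 h3 h4 using fun x => ih (scons x e) fun e' he => ht e' (hext x e' he)
    refine ⟨(List.finRange n).flatMap L, ?_, ?_, fun y hy => ?_, fun e' he hP => ?_⟩
    · simp only [Emitter.allN, Emitter.out, h1, List.flatMap_assoc]
    · simp only [Emitter.allN, Emitter.ticks, h2, List.length_flatMap]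
    · obtain ⟨x, -, hy⟩ := List.mem_flatMap.1 hy
      obtain ⟨e', he, hP, hR⟩ := h3 x y hy
      exact ⟨e', hext x e' he, hP, hR⟩
    · obtain ⟨y, hy, hR⟩ := h4 (e' m) e' (fun j => by
        rcases j with _ | j
        · rw [Nat.zero_add]; rfl
        · rw [show j + 1 + m = j + (m + 1) by omega, he]; rfl) hP
      exact ⟨y, List.mem_flatMap.2 ⟨_, List.mem_finRange _, hy⟩, hR⟩

end Transducers

/-! ### Copies of instances -/

section Copies

theorem ReachIn.map_iso {V V' : Type} {G : SimpleGraph V} {G' : SimpleGraph V'} (φ : G ≃g G')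
    {S : Set V'} {x y : V} (h : ReachIn G (φ ⁻¹' S) x y) : ReachIn G' S (φ x) (φ y) :=
  (h.closed (P := fun y => ReachIn G' S (φ x) (φ y)) (.refl h.left_mem)
    fun _ _ _ hb h hab => h.tail (φ.map_adj_iff.2 hab) hb).1

theorem Suitable.map_iso {V V' : Type} {G : SimpleGraph V} {G' : SimpleGraph V'} (φ : G ≃g G')
    (hG : G.Connected) {k : ℕ} (hk : 0 < k) {u v : V} (h : Suitable k G u v) :
    Suitable k G' (φ u) (φ v) := by
  obtain ⟨r, hr⟩ := (suitable_iff_bagSuitable hG hk).1 h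
  refine (suitable_iff_bagSuitable (φ.connected_iff.1 hG) hk).2 ⟨fun x => r (φ.symm x),
    fun x => hr.lt _, fun x y hxy => hr.lip _ _ (φ.symm.map_adj_iff.2 hxy), fun i hi => ?_,
    fun x => ?_, fun x => ?_⟩
  · have hc := connectedSet_iff.1 (hr.connected i hi)
    refine connectedSet_iff.2 ⟨?_, fun x hx y hy => ?_⟩
    · obtain ⟨x, hx⟩ := hc.1
      exact ⟨φ x, by simpa using hx⟩
    · have := (hc.2 (φ.symm x) hx (φ.symm y) hy).mono
        (T := φ ⁻¹' {x | r (φ.symm x) = i}) (fun z hz => by simpa using hz)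
      simpa using this.map_iso φ
  · rw [hr.first, Set.mem_singleton_iff, Set.mem_singleton_iff]
    exact ⟨fun h => by rw [← h]; simp, fun h => by rw [h]; simp⟩
  · rw [hr.last]
    exact ⟨fun h => by rw [← h]; simp, fun h => by rw [h]; simp⟩

theorem HFree.of_iso {V V' W : Type} {G : SimpleGraph V} {G' : SimpleGraph V'} {H : SimpleGraph W}
    (φ : G ≃g G') (h : HFree H G) : HFree H G' := fun h' =>
  h (h'.trans ⟨φ.symm.toEmbedding⟩)

/-- In an increasing list, the position of an entry is the number of smaller entries. Thus the new
names of `u` and `v` can be found by counting. -/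
theorem List.getElem_length_filter_lt {α : Type} [LinearOrder α] {l : List α}
    (hl : l.Pairwise (· < ·)) {u : α} (hu : u ∈ l) :
    ∃ h : (l.filter (· < u)).length < l.length, l[(l.filter (· < u)).length] = u := by
  induction l with
  | nil => simp at hu
  | cons a l ih =>
    obtain ⟨ha, hl'⟩ := List.pairwise_cons.1 hl
    rcases List.mem_cons.1 hu with rfl | hu
    · have : l.filter (· < u) = [] := by
        rw [List.filter_eq_nil_iff]
        exact fun x hx => by simpa using (ha x hx).le
      simp [this]
    · obtain ⟨h1, h2⟩ := ih hl' hu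
      have hau := ha u hu
      simp only [List.filter_cons, hau, decide_true, if_true, List.length_cons,
        List.getElem_cons_succ]
      exact ⟨by omega, h2⟩

open Classical in
/-- The induced subgraph of `K` on the vertices in `X`, with the vertices numbered in
increasing order. -/
theorem exists_numbered_copy {n : ℕ} (K : SimpleGraph (Fin n)) (X : Set (Fin n)) {u v : Fin n}
    (hu : u ∈ X) (hv : v ∈ X) :
    ∃ (y : PairInput) (ι : Fin y.n → Fin n), Function.Injective ι ∧ Set.range ι = X ∧
      (∀ i j, y.graph.Adj i j ↔ K.Adj (ι i) (ι j)) ∧ ι y.u = u ∧ ι y.v = v ∧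
      y.word = (List.finRange n).countP (· ∈ X) ::
        (List.finRange n).countP (fun x => x ∈ X ∧ x < u) ::
        (List.finRange n).countP (fun x => x ∈ X ∧ x < v) ::
        (List.finRange n).flatMap fun a => if a ∈ X then (List.finRange n).flatMap fun b =>
          if b ∈ X then [if K.Adj a b then 1 else 0] else [] else [] := by
  set L : List (Fin n) := (List.finRange n).filter (· ∈ X) with hL
  have hsort : L.Pairwise (· < ·) := (List.pairwise_lt_finRange n).filter _
  have hmem : ∀ x, x ∈ L ↔ x ∈ X := fun x => by simp [hL]
  have hcount : ∀ u : Fin n, (List.finRange n).countP (fun x => x ∈ X ∧ x < u) =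
      (L.filter (· < u)).length := by
    intro u
    rw [hL, List.filter_filter, List.countP_eq_length_filter]
    congr 2
    funext x
    by_cases h1 : x ∈ X <;> by_cases h2 : x < u <;> simp [h1, h2]
  -- Looping over all vertices with a membership test visits the new vertices in the order of their
  -- numbers.
  have hflat : ∀ g : Fin n → List ℕ, (List.finRange n).flatMap (fun a => if a ∈ X then g a else []) =
      (List.finRange L.length).flatMap fun i => g L[i] := by
    intro g
    have h1 : (List.finRange L.length).flatMap (fun i => g L[i]) = L.flatMap g := by
      conv_rhs => rw [← List.map_getElem_finRange L, List.flatMap_map]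
      rfl
    rw [h1, hL]
    generalize List.finRange n = M
    induction M with
    | nil => rfl
    | cons a M ih =>
      rw [List.flatMap_cons, ih, List.filter_cons]
      by_cases ha : a ∈ X <;> simp [ha]
  obtain ⟨hu1, hu2⟩ := List.getElem_length_filter_lt hsort ((hmem u).2 hu)
  obtain ⟨hv1, hv2⟩ := List.getElem_length_filter_lt hsort ((hmem v).2 hv)
  refine ⟨⟨L.length, K.comap fun i : Fin L.length => L[i], ⟨_, hu1⟩, ⟨_, hv1⟩⟩,
    fun i => L[i.1]'i.2, fun i j h => ?_, ?_, fun i j => Iff.rfl, hu2, hv2, ?_⟩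
  · exact Fin.ext ((List.Nodup.getElem_inj_iff (hsort.imp fun h => h.ne)).1 h)
  · ext x
    rw [← hmem]
    constructor
    · rintro ⟨i, rfl⟩
      exact List.getElem_mem i.2
    · intro hx
      obtain ⟨i, hi, rfl⟩ := List.getElem_of_mem hx
      exact ⟨⟨i, hi⟩, rfl⟩
  · rw [PairInput.word, hcount, hcount, List.countP_eq_length_filter, hflat]
    simp only [hflat, adjacencyWord, ← List.map_eq_flatMap]
    rfl

end Copies

/-! ### The reduction from `P_k`-Suitability to `P_{k-1}`-Suitability -/

section Reduction

/-- Pulling the contracted graph back to the old vertices lets formulas about `G` speak of its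
edges. -/
theorem DefinableSet.contract_adj {B : Family} (hB : DefinableSet B) (i j : ℕ) :
    Definable fun n G e => ((contractSet G (B n G e)).comap (toContracted _)).Adj (e i) (e j) := by
  refine Definable.congr (P := fun n G e => ¬ (e i = e j ∨ (e i ∈ B n G e ∧ e j ∈ B n G e)) ∧
    ∃ a, ∃ b, (a = e i ∨ (a ∈ B n G e ∧ e i ∈ B n G e)) ∧
      (b = e j ∨ (b ∈ B n G e ∧ e j ∈ B n G e)) ∧ G.Adj a b) ?_ fun n G e => ?_
  · exact ((Definable.eq i j).or ((hB.mem' i).and (hB.mem' j))).not.and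
      (((Definable.eq 1 (i + 2)).or ((hB.mem (· + 2) 1).and (hB.mem (· + 2) (i + 2)))).and
        (((Definable.eq 0 (j + 2)).or ((hB.mem (· + 2) 0).and (hB.mem (· + 2) (j + 2)))).and
          (Definable.adj 1 0))).ex.ex
  · simp only [SimpleGraph.comap_adj, contractSet, ne_eq, toContracted_eq_iff]

/-- The block to be contracted for the guess in the first `α` variables. -/
def chosenBlock {n : ℕ} (α : ℕ) (G : SimpleGraph (Fin n)) (u v : Fin n) (e : ℕ → Fin n) :
    Set (Fin n) :=
  separated G (outerNbrs G {u} ∪ picked α G {u} v e) v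

/-- The guess makes the neighbourhood of `u` connected, and `u` and `v` have no common
neighbour. -/
def IsChoice {n : ℕ} (α : ℕ) (G : SimpleGraph (Fin n)) (u v : Fin n) (e : ℕ → Fin n) : Prop :=
  ConnectedSet G (outerNbrs G {u} ∪ picked α G {u} v e) ∧ ¬ ∃ a, G.Adj u a ∧ G.Adj a v

theorem definableSet_chosenBlock (α : ℕ) :
    DefinableSet fun _ G e => chosenBlock α G (e α) (e (α + 1)) e :=
  ((DefinableSet.singleton α).outerNbrs.union ((DefinableSet.singleton α).picked α (α + 1))).separated
    (α + 1)

theorem definable_isChoice (α : ℕ) : Definable fun _ G e => IsChoice α G (e α) (e (α + 1)) e :=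
  ((DefinableSet.singleton α).outerNbrs.union
    ((DefinableSet.singleton α).picked α (α + 1))).connectedSet.and
    ((Definable.adj (α + 1) 0).and (Definable.adj 0 (α + 2))).ex.not

/-- `y` is a copy of the graph obtained by contracting `B`. -/
def IsCopy {n : ℕ} (G : SimpleGraph (Fin n)) (B : Set (Fin n)) (u v : Fin n) (y : PairInput) :
    Prop :=
  ∃ φ : contractSet G B ≃g y.graph, φ (toContracted _ u) = y.u ∧ φ (toContracted _ v) = y.v

/-- One vertex for each vertex of the graph obtained by contracting `B`, where `u ∈ B`. -/
def representatives {n : ℕ} (B : Set (Fin n)) (u : Fin n) : Set (Fin n) :=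
  {x | x = u ∨ x ∉ B}

open Classical in
theorem exists_copy {n : ℕ} (G : SimpleGraph (Fin n)) {B : Set (Fin n)} {u v : Fin n}
    (hu : u ∈ B) (hv : v ∉ B) (X : Set (Fin n)) (hX : X = representatives B u) :
    ∃ y : PairInput, IsCopy G B u v y ∧
      y.word = (List.finRange n).countP (· ∈ X) ::
        (List.finRange n).countP (fun x => x ∈ X ∧ x < u) ::
        (List.finRange n).countP (fun x => x ∈ X ∧ x < v) ::
        (List.finRange n).flatMap fun a => if a ∈ X then (List.finRange n).flatMap fun b =>
          if b ∈ X then [if ((contractSet G B).comap (toContracted _)).Adj a b then 1 else 0]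
            else [] else [] := by
  have huX : u ∈ X := hX ▸ Or.inl rfl
  have hvX : v ∈ X := hX ▸ Or.inr hv
  obtain ⟨y, ι, hinj, hrange, hadj, hyu, hyv, hword⟩ :=
    exists_numbered_copy ((contractSet G B).comap (toContracted _)) X huX hvX
  refine ⟨y, ?_, hword⟩
  have hmem : ∀ i, ι i = u ∨ ι i ∉ B := fun i => by
    have : ι i ∈ X := hrange ▸ Set.mem_range_self i
    rwa [hX] at this
  have hbij : Function.Bijective fun i => toContracted B (ι i) := by
    refine ⟨fun i j hij => hinj ?_, fun q => ?_⟩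
    · rcases toContracted_eq_iff.1 hij with h | ⟨h1, h2⟩
      · exact h
      · rw [(hmem i).resolve_right (not_not.2 h1), (hmem j).resolve_right (not_not.2 h2)]
    · obtain ⟨x, rfl⟩ := toContracted_surjective q
      by_cases hx : x ∈ B
      · exact ⟨y.u, by simp only [hyu]; exact toContracted_eq_iff.2 (Or.inr ⟨hu, hx⟩)⟩
      · have : x ∈ Set.range ι := by
          rw [hrange, hX]
          exact Or.inr hx
        obtain ⟨i, rfl⟩ := this
        exact ⟨i, rfl⟩
  let ψ : y.graph ≃g contractSet G B :=
    ⟨Equiv.ofBijective _ hbij, fun {i j} => (hadj i j).symm⟩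
  refine ⟨ψ.symm, ?_, ?_⟩
  · rw [← hyu]
    exact ψ.symm_apply_apply y.u
  · rw [← hyv]
    exact ψ.symm_apply_apply y.v

/-- Variables `0, …, α - 1` hold the guess, `α` holds `u` and `α + 1` holds `v`. The list has one
entry or none, according to `IsChoice`; the three counts give the new number of vertices and the new
names of `u` and `v`. -/
theorem exists_emitter (α : ℕ) : ∃ t : Emitter, ∀ n (G : SimpleGraph (Fin n)) (e : ℕ → Fin n),
    (e α ∈ chosenBlock α G (e α) (e (α + 1)) e) → (e (α + 1) ∉ chosenBlock α G (e α) (e (α + 1)) e) →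
    ∃ L : List PairInput, t.out G e = L.flatMap PairInput.word ∧ t.ticks G e = L.length ∧
      (∀ y ∈ L, IsChoice α G (e α) (e (α + 1)) e ∧
        IsCopy G (chosenBlock α G (e α) (e (α + 1)) e) (e α) (e (α + 1)) y) ∧
      (IsChoice α G (e α) (e (α + 1)) e →
        ∃ y ∈ L, IsCopy G (chosenBlock α G (e α) (e (α + 1)) e) (e α) (e (α + 1)) y) := by
  classical
  have hB := definableSet_chosenBlock α
  have hX : DefinableSet fun n G e =>
      representatives (chosenBlock α G (e α) (e (α + 1)) e) (e α) :=
    (DefinableSet.singleton α).union hB.compl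
  obtain ⟨ψ, hψ⟩ := definable_isChoice α
  -- Under the counted variable, `u` and `v` have moved to `α + 1` and `α + 2`.
  obtain ⟨φ₂, h₂⟩ := (hX.mem (· + 1) 0).and (Definable.lt 0 (α + 1))
  obtain ⟨φ₃, h₃⟩ := (hX.mem (· + 1) 0).and (Definable.lt 0 (α + 2))
  obtain ⟨φ₄, h₄⟩ := hX.mem (· + 2) 0
  obtain ⟨φ₁, h₁⟩ := hX
  obtain ⟨φ₅, h₅⟩ := (hB.reindex (· + 2)).contract_adj 1 0
  refine ⟨.guard ψ (.seq .tick (.seq (.count φ₁) (.seq (.count φ₂) (.seq (.count φ₃)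
    (.all (.guard φ₁ (.all (.guard φ₄ (.emit φ₅))))))))), fun n G e hu hv => ?_⟩
  by_cases hc : IsChoice α G (e α) (e (α + 1)) e
  · obtain ⟨y, hy, hword⟩ := exists_copy G hu hv _ rfl
    have hsat : Sat G ψ e := (hψ n G e).2 hc
    refine ⟨[y], ?_, ?_, ?_, fun _ => ⟨y, by simp, hy⟩⟩
    · simp only [Emitter.out, hsat, if_true, List.flatMap_cons, List.flatMap_nil, List.append_nil,
        List.nil_append, List.cons_append, h₁, h₂, h₃, h₄, h₅, hword]
      rfl
    · simp [Emitter.ticks, hsat]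
    · intro y' hy'
      obtain rfl : y' = y := by simpa using hy'
      exact ⟨hc, hy⟩
  · have hsat : ¬ Sat G ψ e := fun h => hc ((hψ n G e).1 h)
    exact ⟨[], by simp [Emitter.out, hsat], by simp [Emitter.ticks, hsat], by simp,
      fun h => absurd h hc⟩

/-- The properties of a copy of the instance that belongs to an admissible set. -/
theorem IsCopy.isReduced {s : ℕ} {x y : PairInput} {S : Set (Fin x.n)}
    (hi : IsSuitabilityInstance x.graph x.u x.v) (hf : HFree (sP1P4 s) x.graph)
    (hg : IsBagGuess ((s + 2) * (2 * s + 4)) x.graph {x.u} x.v S)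
    (hcom : ¬ ∃ a, x.graph.Adj x.u a ∧ x.graph.Adj a x.v)
    (hy : IsCopy x.graph (separated x.graph (outerNbrs x.graph {x.u} ∪ S) x.v) x.u x.v y) :
    (IsSuitabilityInstance y.graph y.u y.v ∧ HFree (sP1P4 s) y.graph ∧ y.n < x.n ∧
      IsReducedInstance ((s + 2) * (2 * s + 4)) x y) ∧
    ∀ k, 0 < k → (Suitable k y.graph y.u y.v ↔
      Suitable k (contractSet x.graph (guessBlock x.graph x.u x.v S)) (toContracted _ x.u)
        (toContracted _ x.v)) := by
  obtain ⟨hG, huv, hadj⟩ := hi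
  obtain ⟨φ, hφu, hφv⟩ := hy
  have hgb := guessBlock_eq huv hadj (isGuess_iff.2 hg).1
  have hvB : x.v ∉ ({x.u} : Set (Fin x.n)) := fun h => huv h.symm
  have hvN : x.v ∉ outerNbrs x.graph {x.u} := by rwa [outerNbrs_singleton]
  have hconn := hg.connectedSet_separated hG (connectedSet_singleton x.u) hvB
  have huB : x.u ∈ separated x.graph (outerNbrs x.graph {x.u} ∪ S) x.v :=
    bag_subset_separated hvB rfl
  have hvB' := notMem_separated (G := x.graph) (hg.notMem hvN)
  have hCG := contractSet_connected hG hconn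
  refine ⟨⟨⟨φ.connected_iff.1 hCG, fun h => ?_, fun h => ?_⟩, (hf.contractSet hconn).of_iso φ, ?_,
    S, isGuess_iff.2 hg, ?_⟩, fun k hk => ?_⟩
  · rw [← hφu, ← hφv] at h
    rcases toContracted_eq_iff.1 (φ.injective h) with h | h
    · exact huv h
    · exact hvB' h.2
  · rw [← hφu, ← hφv, φ.map_adj_iff] at h
    obtain ⟨-, a, b, ha, hb, hab⟩ := h
    have haB : a ∈ separated x.graph (outerNbrs x.graph {x.u} ∪ S) x.v := by
      rcases toContracted_eq_iff.1 ha with rfl | h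
      exacts [huB, h.1]
    obtain rfl : b = x.v := by
      rcases toContracted_eq_iff.1 hb with h | h
      exacts [h, absurd h.2 hvB']
    -- A separated neighbour `a` of `v` would have to lie in `N(u) ∪ S`; the first is excluded by
    -- `hcom`, the second because `S` avoids `N(v)`.
    refine haB (.adj ?_ hab (hg.notMem hvN))
    rintro (h | h)
    · rw [outerNbrs_singleton] at h
      exact hcom ⟨a, h, hab⟩
    · exact (hg.1 h).2.2.2 hab.symm
  -- The contraction identifies `u` with one of its neighbours, so the number of vertices drops.
  · obtain ⟨c, hc⟩ := outerNbrs_nonempty hG (Set.singleton_nonempty x.u) hvB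
    let f : Fin x.n → Fin y.n := fun a => φ (toContracted _ a)
    have hsurj : Function.Surjective f := φ.surjective.comp toContracted_surjective
    have hninj : ¬ Function.Injective f := fun hinj => hc.1 (hinj (congrArg φ
      (toContracted_eq_iff.2 (Or.inr ⟨subset_separated (Or.inl hc), huB⟩))))
    simpa using Fintype.card_lt_of_surjective_not_injective f hsurj hninj
  · rw [hgb]
    exact ⟨φ, hφu, hφv⟩
  · rw [hgb, ← hφu, ← hφv]
    constructor
    · intro h
      simpa using h.map_iso φ.symm (φ.connected_iff.1 hCG) hk
    · exact fun h => h.map_iso φ hCG hk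

theorem suitabilityReduction (s : ℕ) :
    SuitabilityReduction (sP1P4 s) ((s + 2) * (2 * s + 4)) := by
  set α := (s + 2) * (2 * s + 4) with hα
  obtain ⟨t, ht⟩ := exists_emitter α
  obtain ⟨c, hc⟩ := (((PolyBounded.const 1).forCost.add (.const 8)).add
    (t.allN α).polyBounded_cost).exists_bound
  -- Registers 7 and 8 hold `u` and `v`; all further variables are the dummy vertex in register 5.
  let ρ : ℕ → ℕ := scons 7 (scons 8 fun _ => 5)
  -- The output starts at the end of the input, saved in register 1. Cells `1` and `2`, addressed by
  -- `R[3]` and by the constant `2`, contain `u` and `v`.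
  refine ⟨.seq (setupProg 3) (.seq (.move 1 6) (.seq (.load 7 3) (.seq (.const 8 2)
    (.seq (.load 8 8) ((t.allN α).prog ρ 9))))), c, fun x hx => ?_⟩
  obtain ⟨hi, hf⟩ := hx
  obtain ⟨hG, huv, hadj⟩ := hi
  have hword : x.word = [x.n, x.u.val, x.v.val] ++ adjacencyWord x.graph := rfl
  have hlen : x.n ≤ x.word.length := by
    have := Nat.le_mul_self x.n
    rw [hword, List.length_append, adjacencyWord_length]
    omega
  let z : Fin x.n := ⟨0, x.u.pos⟩
  let e : ℕ → Fin x.n := scons x.u (scons x.v fun _ => z)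
  have hvB : x.v ∉ ({x.u} : Set (Fin x.n)) := fun h => huv h.symm
  have hvN : x.v ∉ outerNbrs x.graph {x.u} := by rwa [outerNbrs_singleton]
  have he0 : ∀ e' : ℕ → Fin x.n, (∀ j, e' (j + α) = e j) → e' α = x.u := fun e' he' => by
    rw [← Nat.zero_add α, he' 0]; rfl
  have he1 : ∀ e' : ℕ → Fin x.n, (∀ j, e' (j + α) = e j) → e' (α + 1) = x.v := fun e' he' => by
    rw [Nat.add_comm, he' 1]; rfl
  obtain ⟨L, hL1, hL2, hL3, hL4⟩ := exists_list_allN (G := x.graph) (t := t)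
    (P := IsChoice α x.graph x.u x.v)
    (R := fun e y => IsCopy x.graph (chosenBlock α x.graph x.u x.v e) x.u x.v y) α e
    (fun e' he' => by
      have := ht x.n x.graph e'
      rw [he0 e' he', he1 e' he'] at this
      refine this (bag_subset_separated hvB rfl) (notMem_separated ?_)
      rintro (h | h)
      · exact hvN h
      · exact h.2.2.2.1 rfl)
  have hcopy : ∀ e' : ℕ → Fin x.n, (∀ j, e' (j + α) = e j) → IsChoice α x.graph x.u x.v e' →
      IsBagGuess α x.graph {x.u} x.v (picked α x.graph {x.u} x.v e') := by
    intro e' he' hch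
    obtain ⟨S, hS, rfl⟩ := (exists_bagGuess_iff e
      (P := fun S => picked α x.graph {x.u} x.v e' = S)).2 ⟨e', he', hch.1, rfl⟩
    exact hS
  have main : Exec (.seq (setupProg 3) (.seq (.move 1 6) (.seq (.load 7 3) (.seq (.const 8 2)
      (.seq (.load 8 8) ((t.allN α).prog ρ 9)))))) (inputState x.word)
      (forCost x.n 1 + 8 + (t.allN α).cost x.n) fun τ => OutputsInstances τ L := by
    refine (Exec.seq (T := forCost x.n 1 + 4) (T' := 4 + (t.allN α).cost x.n) ?_).le (by omega)
    refine (exec_setupProg x.graph [x.n, x.u.val, x.v.val] hword (by simp [hword])).imp ?_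
    intro σ hσ
    refine (Exec.seq (T := 1) (.move (.seq (T := 1) (.load (.seq (T := 1) (.const
      (.seq (T := 1) (T' := (t.allN α).cost x.n) (.load ?_)))))))).le (by omega)
    set σ' := (((σ.setReg 1 (σ.reg 6)).setReg 7 _).setReg 8 2).setReg 8 _ with hσ'
    have hset : IsSetUp x.graph x.word 3 σ' :=
      (((hσ.setReg (by omega)).setReg (by omega)).setReg (by omega)).setReg (by omega)
    have h1 : σ'.reg 1 = σ'.reg 6 := by simp [hσ']
    have h7 : σ'.reg 7 = x.u := by simp [hσ', hσ.one, hσ.mem, inputState, hword]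
    have h8 : σ'.reg 8 = x.v := by simp [hσ', hσ.mem, inputState, hword]
    have hr : Ready x.graph 3 e ρ 6 9 σ' := by
      refine ⟨hset.size, hset.one, hset.header, hset.adj, hset.heap.ge, by omega, by omega, ?_, ?_⟩
      · rintro (_ | _ | i)
        exacts [show 7 < 9 by omega, show 8 < 9 by omega, show 5 < 9 by omega]
      · rintro (_ | _ | i)
        exacts [h7, h8, hset.zero]
    refine ((t.allN α).exec_prog hr ?_).imp fun τ hτ => ⟨?_, fun a ha => ?_⟩
    · rintro (_ | _ | i)
      exacts [show 7 ≠ 0 ∧ 7 ≠ 6 by omega, show 8 ≠ 0 ∧ 8 ≠ 6 by omega,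
        show 5 ≠ 0 ∧ 5 ≠ 6 by omega]
    · rw [hτ.ticks, hset.ticks, hL2, Nat.zero_add]
    · rw [hτ.reg 1 (by omega) (by omega) (by omega), h1]
      simp only [← hL1] at ha ⊢
      exact hτ.out a ha
  obtain ⟨T, τ, hrun, hT, hout⟩ := main
  refine ⟨T, τ, hrun, hT.trans (hc _ _ hlen), L, hout, fun y hy => ?_, fun k hk => ?_⟩
  · obtain ⟨e', he', hch, hy'⟩ := hL3 y hy
    exact (hy'.isReduced ⟨hG, huv, hadj⟩ hf (hcopy e' he' hch) hch.2).1
  · constructor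
    · intro hsuit
      -- A common neighbour would force `v` to have rank at most two, impossible for `k ≥ 4`; so the
      -- second condition of `IsChoice` loses no yes-instance.
      have hcom : ¬ ∃ a, x.graph.Adj x.u a ∧ x.graph.Adj a x.v := by
        rintro ⟨a, hua, hav⟩
        obtain ⟨r, hr⟩ := (suitable_iff_bagSuitable hG (by omega)).1 hsuit
        have h0 := (hr.first x.u).2 rfl
        have h1 := hr.lip' hua
        have h2 := hr.lip' hav
        have h3 := hr.last_eq
        omega
      obtain ⟨S, hS, hSs⟩ := (suitable_iff_exists_guess hk ⟨hG, huv, hadj⟩ hf).1 hsuit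
      obtain ⟨e', he', hconn, hSs⟩ := (exists_bagGuess_iff e
        (P := fun S => Suitable (k - 1) (contractSet x.graph (guessBlock x.graph x.u x.v S))
          (toContracted _ x.u) (toContracted _ x.v))).1 ⟨S, isGuess_iff.1 hS, hSs⟩
      obtain ⟨y, hy, hy'⟩ := hL4 e' he' ⟨hconn, hcom⟩
      exact ⟨y, hy, ((hy'.isReduced ⟨hG, huv, hadj⟩ hf (hcopy e' he' ⟨hconn, hcom⟩) hcom).2 _
        (by omega)).2 hSs⟩
    · rintro ⟨y, hy, hsuit⟩
      obtain ⟨e', he', hch, hy'⟩ := hL3 y hy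
      have hg := hcopy e' he' hch
      exact (suitable_iff_exists_guess hk ⟨hG, huv, hadj⟩ hf).2 ⟨_, isGuess_iff.2 hg,
        ((hy'.isReduced ⟨hG, huv, hadj⟩ hf hg hch.2).2 _ (by omega)).1 hsuit⟩

end Reduction

/-- For every fixed `s`: Longest Path Contractibility is polynomial-time solvable on
`(sP₁ + P₄)`-free graphs; every yes-instance of `P_k`-Suitability on such graphs has an
`α`-constant solution with `α = (s + 2)(2s + 4)`; and, by contracting the closure of a set of at
most `α` vertices, `P_k`-Suitability reduces to `P_{k-1}`-Suitability in polynomial time. -/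
theorem theorem6 (s : ℕ) :
    LongestPathContractibilityPolyTime (sP1P4 s) ∧
    (∀ (V : Type) [Finite V] (G : SimpleGraph V) (u v : V) (k : ℕ), 4 ≤ k →
      IsSuitabilityInstance G u v → HFree (sP1P4 s) G → Suitable k G u v →
      ∃ W : Fin k → Set V, IsConstantSolution ((s + 2) * (2 * s + 4)) k G u v W) ∧
    (∀ (V : Type) [Finite V] (G : SimpleGraph V) (u v : V) (k : ℕ), 4 ≤ k →
      IsSuitabilityInstance G u v → HFree (sP1P4 s) G →
      (Suitable k G u v ↔
        ∃ S : Set V, IsGuess ((s + 2) * (2 * s + 4)) G u v S ∧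
          Suitable (k - 1) (contractSet G (guessBlock G u v S))
            (toContracted _ u) (toContracted _ v))) ∧
    SuitabilityReduction (sP1P4 s) ((s + 2) * (2 * s + 4)) := by
  exact ⟨longestPathContractibility_polyTime s,
    fun V _ G u v k hk hi hf h => exists_constant_solution hk hi.1 hf h,
    fun V _ G u v k hk hi hf => suitable_iff_exists_guess hk hi hf,
    suitabilityReduction s⟩
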